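/- Let $g\ge 0$ be an integer and let $\mathrm{USp}(2g)$ be the group of unitary matrices $A\in\mathbb{C}^{2g\times 2g}$ with $AJA^{T}=J$, $J=\begin{pmatrix}0&-I_g\\ I_g&0\end{pmatrix}$. For $x\in \mathrm{USp}(2g)$ with characteristic polynomial $f_x$, let $g_x\in\mathbb{R}[T]$ be its normalized real characteristic polynomial, i.e. the unique real polynomial with $f_x(T)=T^{g}g_x(T+1/T)$, and for $0\le i\le g$ let $s_i(x)$ be $(-1)^i$ times the coefficient of $T^{g-i}$ in $g_x$. Take the maximal torus of the matrices $\mathrm{diag}(z_1,\dots,z_g,z_1^{-1},\dots,z_g^{-1})$ with $|z_k|=1$, let $e_k$ be the weight $z\mapsto z_k$, and take the simple roots $e_1-e_2,\dots,e_{g-1}-e_g,2e_g$. Let $\chi_0=1$, and for $1\le j\le g$ let $\chi_j$ be the $j$-th fundamental irreducible character of $\mathrm{USp}(2g)$, i.e. the character of the continuous irreducible finite-dimensional complex representation whose highest weight is the fundamental dominant weight $\varpi_j=e_1+\dots+e_j$. Then these characters exist, and as functions on $\mathrm{USp}(2g)$ $$\chi_j=\sum_{i=0}^{g}c_{i,j}\,s_i\qquad(0\le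 j\le g),$$ where the integers $c_{i,j}$ ($0\le i\le g$, $j\in\mathbb{Z}$) are determined uniquely by $$c_{g,g}=1,\qquad c_{g,j}=0\ (j\ne g),\qquad c_{i,j}=0\ (i<g,\ j>g),\qquad c_{i,j}=c_{i+1,j-1}+c_{i+1,j+1}\ (i<g,\ j\le g).$$ For $0\le i,j\le g$ they are given by the closed formula $$c_{i,j}=\frac{1+(-1)^{i+j}}{2}\cdot\frac{2(g+1-j)}{2(g+1)-(i+j)}\binom{g-i}{g-\frac{i+j}{2}}.$$ Conversely, for $0\le j\le g$, $$s_j=\sum_{i=0}^{g}d_{i,j}\,\chi_i,\qquad d_{i,j}=\frac12\left(\mathbf{i}^{\,i-j}+\mathbf{i}^{\,j-i}\right)\binom{g-\frac{i+j}{2}}{\frac{j-i}{2}},$$ where $\mathbf{i}\in\mathbb{C}$ is the imaginary unit. Here a binomial coefficient with negative lower entry is $0$, and in both closed formulas the value is $0$ when $i+j$ is odd (the factor in front of the binomial coefficient vanishes). -/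

import Mathlib

/-- The compact group `USp(2g)`: the unitary `2g × 2g` complex matrices `A` that are symplectic,
`A * J * Aᵀ = J` with `J = (0, -1; 1, 0)`. It carries the topology induced from the matrices. -/
def USp (g : ℕ) : Subgroup (Matrix.unitaryGroup (Fin g ⊕ Fin g) ℂ) where
  carrier := {A | (A : Matrix (Fin g ⊕ Fin g) (Fin g ⊕ Fin g) ℂ) ∈
    Matrix.symplecticGroup (Fin g) ℂ}
  one_mem' := (Matrix.symplecticGroup (Fin g) ℂ).one_mem
  mul_mem' := fun ha hb => (Matrix.symplecticGroup (Fin g) ℂ).mul_mem ha hb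
  inv_mem' := by
    intro A hA
    have h1 : (A : Matrix (Fin g ⊕ Fin g) (Fin g ⊕ Fin g) ℂ) *
        ((A⁻¹ : Matrix.unitaryGroup (Fin g ⊕ Fin g) ℂ) :
          Matrix (Fin g ⊕ Fin g) (Fin g ⊕ Fin g) ℂ) = 1 :=
      congrArg Subtype.val (mul_inv_cancel A)
    have h2 := (⟨_, hA⟩ : Matrix.symplecticGroup (Fin g) ℂ)⁻¹.2
    rw [SymplecticGroup.coe_inv', Matrix.inv_eq_right_inv h1] at h2
    exact h2

/-- The underlying matrix of an element of `USp(2g)`. -/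
def USp.toMatrix {g : ℕ} (x : USp g) : Matrix (Fin g ⊕ Fin g) (Fin g ⊕ Fin g) ℂ :=
  x.1.1

/-- The element `diag(z₁, …, z_g, z₁⁻¹, …, z_g⁻¹)` of the standard maximal torus of `USp(2g)`,
for `z₁, …, z_g` on the unit circle. -/
noncomputable def USp.torus {g : ℕ} (z : Fin g → Circle) : USp g :=
  ⟨⟨Matrix.diagonal (Sum.elim (fun i => (z i : ℂ)) (fun i => ((z i)⁻¹ : Circle))), by
      rw [Matrix.mem_unitaryGroup_iff, Matrix.star_eq_conjTranspose,
        Matrix.diagonal_conjTranspose, Matrix.diagonal_mul_diagonal, ← Matrix.diagonal_one]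
      congr 1
      ext i
      rcases i with i | i <;> simp [← Circle.coe_inv_eq_conj]⟩, by
    change Matrix.diagonal _ ∈ Matrix.symplecticGroup (Fin g) ℂ
    rw [← Matrix.fromBlocks_diagonal, SymplecticGroup.mem_iff, Matrix.J]
    rw [Matrix.fromBlocks_transpose, Matrix.fromBlocks_multiply, Matrix.fromBlocks_multiply]
    simp [Matrix.diagonal_transpose, Matrix.diagonal_mul_diagonal]
    rw [← Matrix.diagonal_one, Matrix.diagonal_neg]⟩

/-- `p` is a normalized real characteristic polynomial of `x ∈ USp(2g)`: a real polynomial with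
`f_x(T) = T^g * p(T + 1/T)`, where `f_x` is the characteristic polynomial of `x`. -/
def IsRealCharpoly {g : ℕ} (x : USp g) (p : Polynomial ℝ) : Prop :=
  ∀ z : ℂ, z ≠ 0 → (USp.toMatrix x).charpoly.eval z = z ^ g * Polynomial.aeval (z + z⁻¹) p

/-- There is at most one normalized real characteristic polynomial. -/
theorem IsRealCharpoly.unique {g : ℕ} {x : USp g} {p q : Polynomial ℝ}
    (hp : IsRealCharpoly x p) (hq : IsRealCharpoly x q) : p = q := by
  have key : ∀ z : ℂ, z ≠ 0 →
      Polynomial.aeval (z + z⁻¹) p = Polynomial.aeval (z + z⁻¹) q := fun z hz =>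
    mul_left_cancel₀ (pow_ne_zero g hz) ((hp z hz).symm.trans (hq z hz))
  apply Polynomial.map_injective (algebraMap ℝ ℂ) (algebraMap ℝ ℂ).injective
  apply Polynomial.funext
  intro w
  obtain ⟨z, hz⟩ := IsAlgClosed.exists_eval₂_eq_zero (RingHom.id ℂ)
    (Polynomial.X ^ 2 - Polynomial.C w * Polynomial.X + 1) (by
      rw [show (Polynomial.X ^ 2 - Polynomial.C w * Polynomial.X + 1 : Polynomial ℂ).degree = 2 by
        compute_degree!]
      norm_num)
  simp only [Polynomial.eval₂_id, Polynomial.eval_add, Polynomial.eval_sub, Polynomial.eval_pow,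
    Polynomial.eval_X, Polynomial.eval_mul, Polynomial.eval_C, Polynomial.eval_one] at hz
  have hz0 : z ≠ 0 := by
    rintro rfl
    norm_num at hz
  have hw : z + z⁻¹ = w := by
    field_simp
    linear_combination hz
  have := key z hz0
  rwa [hw, Polynomial.aeval_def, Polynomial.aeval_def, ← Polynomial.eval_map,
    ← Polynomial.eval_map] at this

open Classical in
/-- The normalized real characteristic polynomial `g_x` of `x ∈ USp(2g)`
(with the value `0` should none exist). -/
noncomputable def realCharpoly {g : ℕ} (x : USp g) : Polynomial ℝ :=
  if h : ∃ p, IsRealCharpoly x p then h.choose else 0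

/-- The function `s_i` on `USp(2g)`, for `0 ≤ i ≤ g`: `(-1)^i` times the coefficient of `T^(g-i)`
in the normalized real characteristic polynomial. -/
noncomputable def sCoeff (g i : ℕ) (x : USp g) : ℂ :=
  (-1) ^ i * (((realCharpoly x).coeff (g - i) : ℝ) : ℂ)

/-- `μ ∈ ℤ^g` is a weight of the representation `ρ` of `USp(2g)`: some nonzero vector is
multiplied by `z₁^μ₁ ⋯ z_g^μ_g` by each element `diag(z, z⁻¹)` of the maximal torus. -/
def IsWeight {g : ℕ} {V : Type*} [AddCommGroup V] [Module ℂ V]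
    (ρ : Representation ℂ (USp g) V) (μ : Fin g → ℤ) : Prop :=
  ∃ v : V, v ≠ 0 ∧ ∀ z : Fin g → Circle,
    ρ (USp.torus z) v = (∏ i, (z i : ℂ) ^ (μ i)) • v

/-- The simple roots of `USp(2g)`: `e₁ - e₂, …, e_{g-1} - e_g, 2 e_g`. -/
def simpleRoot (g : ℕ) (k : Fin g) : Fin g → ℤ :=
  if h : (k : ℕ) + 1 < g then Pi.single k 1 - Pi.single ⟨(k : ℕ) + 1, h⟩ 1
  else Pi.single k 2

/-- `lam` is the highest weight of `ρ`: it is a weight, and each weight is obtained from it by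
subtracting a sum of simple roots. -/
def HasHighestWeight {g : ℕ} {V : Type*} [AddCommGroup V] [Module ℂ V]
    (ρ : Representation ℂ (USp g) V) (lam : Fin g → ℤ) : Prop :=
  IsWeight ρ lam ∧ ∀ μ, IsWeight ρ μ → ∃ n : Fin g → ℕ, lam - μ = ∑ k, n k • simpleRoot g k

/-- The fundamental dominant weight `ϖ_j = e₁ + ⋯ + e_j`. -/
def fundamentalWeight (g j : ℕ) : Fin g → ℤ := fun i => if (i : ℕ) < j then 1 else 0

/-- `χ` is the character of a continuous irreducible finite-dimensional complex representation
of `USp(2g)` with highest weight `ϖ_j`. -/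
def IsFundamentalCharacter (g j : ℕ) (χ : USp g → ℂ) : Prop :=
  ∃ (n : ℕ) (ρ : Representation ℂ (USp g) (Fin n → ℂ)),
    (∀ v, Continuous fun x => ρ x v) ∧ ρ.IsIrreducible ∧
    HasHighestWeight ρ (fundamentalWeight g j) ∧ χ = ρ.character

/-- The recurrence for the integers `c_{i,j}`, `0 ≤ i ≤ g`. The index `j` runs through `ℤ`, so
that `c_{i+1,j-1}` makes sense at `j = 0`. -/
structure IsCoeffFamily (g : ℕ) (c : ℕ → ℤ → ℤ) : Prop where
  last_of_ne : ∀ j : ℤ, j ≠ g → c g j = 0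
  last : c g g = 1
  of_gt : ∀ i : ℕ, i < g → ∀ j : ℤ, (g : ℤ) < j → c i j = 0
  step : ∀ i : ℕ, i < g → ∀ j : ℤ, j ≤ g → c i j = c (i + 1) (j - 1) + c (i + 1) (j + 1)

/-- The numbers
`d_{i,j} = (1/2) * (I^(i-j) + I^(j-i)) * binom (g - (i+j)/2) ((j-i)/2)`, for `0 ≤ i, j ≤ g`. The
binomial coefficient is `0` when its lower entry is negative; for `i + j` odd the factor in front
of it is `0`, so that the rounded divisions do not matter. -/
noncomputable def dCoeff (g i j : ℕ) : ℂ :=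
  1 / 2 * (Complex.I ^ ((i : ℤ) - j) + Complex.I ^ ((j : ℤ) - i)) *
    (if i ≤ j then (((g - (i + j) / 2).choose ((j - i) / 2) : ℕ) : ℂ) else 0)

/-! The representation of highest weight ϖ_j is realised on the primitive alternating j-forms, the
kernel of the contraction Λ from j-forms to (j-2)-forms with the symplectic bivector. If L is
exterior multiplication by the symplectic form, then [Λ, L] = g - degree, which makes Λ surjective
onto degrees below g (`contract_surjective`). Every element of `USp g` is conjugate into the torus
(`exists_eq_conj_torus`), and there the primitive character is e_j(z, z⁻¹) - e_{j-2}(z, z⁻¹). Since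
∏ (1 + z_i T)(1 + z_i⁻¹ T) = ∑ s_k T^k (1 + T²)^(g-k), the coefficient of s_k for j = k + 2r is
binom(g-k, r) - binom(g-k, r-1). The recurrence, with its absorbing wall above g, yields the same
ballot numbers (`coeffAux_eq_ballot`, `character_primitiveRep`). The converse expansion is a matrix
inversion that rests on Pascal's rule (`sum_coeffFamily_mul_dCoeff`).

Irreducibility: a subspace stable under the group is stable under sp(2g, ℂ), so if nonzero it
contains a vector killed by all raising operators (`exists_isKilled`). Such a primitive form is
determined by its coordinate at e_1, …, e_n (`IsKilled.eq_zero`). A proper nonzero invariant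
subspace and its orthogonal complement would both contain one, which is absurd
(`eq_primitive_of_le`).

Uniqueness of the character needs neither the general highest weight theorem nor integration over
the group. If the highest weight is ϖ_j, Weyl symmetry puts the weights occurring in the character
into {-1, 0, 1}^g, so the character is a combination of the s_k (`exists_character_eq_sum_sCoeff`),
hence of the primitive characters. Irreducible characters are independent enough, by Jacobson
density, that the representation must be one of the primitive ones
(`exists_equiv_of_character_eq_sum`); comparing highest weights identifies which. -/

section

/-! ### The recurrence, ballot numbers, and the inverse matrix. -/

/-- The coefficients `c (g - n) j`, defined by recursion on `n`. -/
def coeffAux (g : ℕ) : ℕ → ℤ → ℤ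
  | 0, j => if j = g then 1 else 0
  | n + 1, j => if j ≤ g then coeffAux g n (j - 1) + coeffAux g n (j + 1) else 0

/-- The family `c i j` satisfying the recurrence. -/
def coeffFamily (g i : ℕ) (j : ℤ) : ℤ := coeffAux g (g - i) j

theorem isCoeffFamily_coeffFamily (g : ℕ) : IsCoeffFamily g (coeffFamily g) where
  last_of_ne j hj := by simp [coeffFamily, coeffAux, hj]
  last := by simp [coeffFamily, coeffAux]
  of_gt i hi j hj := by
    obtain ⟨n, hn⟩ : ∃ n, g - i = n + 1 := ⟨g - i - 1, by omega⟩
    simp [coeffFamily, hn, coeffAux, not_le.2 hj]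
  step i hi j hj := by
    obtain ⟨n, hn⟩ : ∃ n, g - i = n + 1 := ⟨g - i - 1, by omega⟩
    have hn' : g - (i + 1) = n := by omega
    simp [coeffFamily, hn, hn', coeffAux, hj]

theorem IsCoeffFamily.eq {g : ℕ} {c c' : ℕ → ℤ → ℤ} (hc : IsCoeffFamily g c)
    (hc' : IsCoeffFamily g c') {i : ℕ} (hi : i ≤ g) : ∀ j, c' i j = c i j := by
  induction hi using Nat.decreasingInduction with
  | self =>
    intro j
    by_cases hj : j = g
    · rw [hj, hc.last, hc'.last]
    · rw [hc.last_of_ne j hj, hc'.last_of_ne j hj]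
  | of_succ i hi ih =>
    intro j
    by_cases hj : j ≤ g
    · rw [hc.step i hi j hj, hc'.step i hi j hj, ih, ih]
    · rw [hc.of_gt i hi j (not_le.1 hj), hc'.of_gt i hi j (not_le.1 hj)]

/-- The difference `binom n r - binom n (r - 1)`. -/
def ballot (n : ℕ) : ℕ → ℤ
  | 0 => 1
  | r + 1 => n.choose (r + 1) - n.choose r

theorem ballot_succ (n r : ℕ) : ballot (n + 1) (r + 1) = ballot n r + ballot n (r + 1) := by
  cases r with
  | zero => simp [ballot]
  | succ r =>
    simp only [ballot, Nat.choose_succ_succ n (r + 1), Nat.choose_succ_succ n r]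
    push_cast
    ring

theorem coeffAux_of_gt (g n : ℕ) (j : ℤ) (hj : (g : ℤ) < j) : coeffAux g n j = 0 := by
  cases n with
  | zero => simp [coeffAux, hj.ne']
  | succ n => simp [coeffAux, not_le.2 hj]

theorem coeffAux_of_lt (g n : ℕ) : ∀ j : ℤ, j < g - n → coeffAux g n j = 0 := by
  induction n with
  | zero => intro j hj; simp only [coeffAux]; rw [if_neg]; push_cast at hj; omega
  | succ n ih =>
    intro j hj
    push_cast at hj
    rw [coeffAux, ih _ (by omega), ih _ (by omega)]
    simp

theorem coeffAux_of_odd (g n : ℕ) : ∀ j : ℤ, Odd (j - (g - n)) → coeffAux g n j = 0 := by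
  induction n with
  | zero =>
    intro j hj
    simp only [coeffAux]
    rw [if_neg]
    rintro rfl
    simp at hj
  | succ n ih =>
    intro j hj
    rw [coeffAux, ih, ih]
    · simp
    · rw [show j + 1 - ((g : ℤ) - n) = j - (g - (n + 1 : ℕ)) by push_cast; ring]
      exact hj
    · rw [show j - 1 - ((g : ℤ) - n) = j - (g - (n + 1 : ℕ)) - 2 by push_cast; ring]
      exact hj.sub_even even_two

/-- The recurrence counts lattice paths that may not rise above g; by reflection their number is a
difference of binomials. The bound `2 * r ≤ n + 1` admits one position past the wall, g + 1, where
the two binomials cancel by symmetry. This lets Pascal's rule hold at the wall itself. -/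
theorem coeffAux_eq_ballot (g n : ℕ) : ∀ r : ℕ, 2 * r ≤ n + 1 →
    coeffAux g n (g - n + 2 * r) = ballot n r := by
  induction n with
  | zero =>
    intro r hr
    obtain rfl : r = 0 := by omega
    simp [coeffAux, ballot]
  | succ n ih =>
    intro r hr
    rcases Nat.lt_or_ge (n + 1) (2 * r) with h | h
    · rw [coeffAux_of_gt _ _ _ (by push_cast; omega)]
      obtain ⟨s, rfl⟩ : ∃ s, r = s + 1 := ⟨r - 1, by omega⟩
      rw [ballot, Nat.choose_symm_of_eq_add (a := s + 1) (b := s) (by omega), sub_self]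
    · rw [coeffAux, if_pos (by push_cast; omega)]
      rw [show ((g : ℤ) - (n + 1 : ℕ) + 2 * r + 1) = g - n + 2 * r by push_cast; ring, ih r h]
      cases r with
      | zero =>
        rw [coeffAux_of_lt _ _ _ (by push_cast; omega)]
        simp [ballot]
      | succ r =>
        rw [show ((g : ℤ) - (n + 1 : ℕ) + 2 * (r + 1 : ℕ) - 1) = g - n + 2 * r by push_cast; ring,
          ih r (by omega), ballot_succ]

theorem coeffFamily_of_lt {g i : ℕ} {j : ℤ} (hi : i ≤ g) (h : j < i) : coeffFamily g i j = 0 :=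
  coeffAux_of_lt _ _ _ (by omega)

theorem coeffFamily_of_odd {g i : ℕ} {j : ℤ} (hi : i ≤ g) (h : Odd (j - i)) :
    coeffFamily g i j = 0 :=
  coeffAux_of_odd _ _ _ (by rwa [show j - ((g : ℤ) - (g - i : ℕ)) = j - i by omega])

theorem coeffFamily_eq_ballot {g i r : ℕ} (h : i + 2 * r ≤ g) :
    coeffFamily g i (i + 2 * r : ℕ) = ballot (g - i) r := by
  rw [← coeffAux_eq_ballot g (g - i) r (by omega), coeffFamily]
  congr 1
  omega

theorem coeffFamily_closed_formula {g i j : ℕ} (hi : i ≤ g) (hj : j ≤ g) :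
    (coeffFamily g i (j : ℤ) : ℚ) =
      (1 + (-1) ^ (i + j)) / 2 *
        (2 * ((g : ℚ) + 1 - j) / (2 * ((g : ℚ) + 1) - ((i : ℚ) + j))) *
        (((g - i).choose (g - (i + j) / 2) : ℕ) : ℚ) := by
  rcases Nat.even_or_odd (i + j) with hp | hp
  · rcases Nat.lt_or_ge j i with h | h
    · rw [coeffFamily_of_lt hi (by exact_mod_cast h), Nat.choose_eq_zero_of_lt (by omega)]
      simp
    · obtain ⟨r, rfl⟩ : ∃ r, j = i + 2 * r := by
        obtain ⟨s, hs⟩ := hp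
        exact ⟨s - i, by omega⟩
      -- In terms of r and m the rational factor is (m + 1) / (r + m + 1), and the formula becomes
      -- the ratio of two consecutive binomials.
      obtain ⟨m, rfl⟩ : ∃ m, g = i + 2 * r + m := ⟨g - (i + 2 * r), by omega⟩
      rw [coeffFamily_eq_ballot hj, hp.neg_one_pow,
        show i + 2 * r + m - i = 2 * r + m by omega,
        show i + 2 * r + m - (i + (i + 2 * r)) / 2 = r + m by omega,
        Nat.choose_symm_of_eq_add (n := 2 * r + m) (a := r + m) (b := r) (by omega)]
      have h0 : ((m : ℚ) + 1 + r) ≠ 0 := by positivity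
      cases r with
      | zero =>
        have h1 : ((m : ℚ) + 1) ≠ 0 := by positivity
        have h2 : (2 * (((i + 2 * 0 + m : ℕ) : ℚ) + 1) - ((i : ℚ) + (i + 2 * 0 : ℕ))) =
          2 * (m + 1) := by push_cast; ring
        have h3 : (((i + 2 * 0 + m : ℕ) : ℚ) + 1 - (i + 2 * 0 : ℕ)) = m + 1 := by
          push_cast; ring
        rw [h2, h3, div_self (by positivity)]
        simp [ballot]
      | succ r =>
        have key := Nat.choose_succ_right_eq (2 * (r + 1) + m) r
        rw [show 2 * (r + 1) + m - r = r + m + 2 by omega] at key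
        have key' : ((2 * (r + 1) + m).choose (r + 1) : ℚ) * (r + 1) =
            (2 * (r + 1) + m).choose r * (r + m + 2) := by exact_mod_cast key
        have h1 : (2 * (((i + 2 * (r + 1) + m : ℕ) : ℚ) + 1) - ((i : ℚ) + (i + 2 * (r + 1) : ℕ))) =
          2 * (r + m + 2) := by push_cast; ring
        have h2 : (((i + 2 * (r + 1) + m : ℕ) : ℚ) + 1 - (i + 2 * (r + 1) : ℕ)) = m + 1 := by
          push_cast; ring
        have h3 : ((r : ℚ) + m + 2) ≠ 0 := by positivity
        rw [h1, h2, ballot]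
        push_cast
        field_simp
        linear_combination (2 : ℚ) * key'
  · rw [coeffFamily_of_odd hi, hp.neg_one_pow]
    · simp
    · have : Odd ((i : ℤ) + j) := by exact_mod_cast hp
      have := this.sub_even (even_two_mul (i : ℤ))
      rwa [show (i : ℤ) + j - 2 * i = j - i by ring] at this

theorem dCoeff_of_gt {g i j : ℕ} (h : j < i) : dCoeff g i j = 0 := by
  simp [dCoeff, not_le.2 h]

theorem dCoeff_add_two_mul (g i p : ℕ) :
    dCoeff g i (i + 2 * p) = (-1) ^ p * ((g - i - p).choose p : ℕ) := by
  have h1 : Complex.I ^ ((i : ℤ) - (i + 2 * p : ℕ)) = (-1) ^ p := by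
    rw [show ((i : ℤ) - (i + 2 * p : ℕ)) = (-2) * p by push_cast; ring, zpow_mul, zpow_natCast]
    congr 1
    simp [zpow_neg]
  have h2 : Complex.I ^ (((i + 2 * p : ℕ) : ℤ) - i) = (-1) ^ p := by
    rw [show (((i + 2 * p : ℕ) : ℤ) - i) = 2 * p by push_cast; ring, zpow_mul, zpow_natCast]
    congr 1
    exact_mod_cast Complex.I_sq
  rw [dCoeff, h1, h2, if_pos (by omega), show (i + 2 * p - i) / 2 = p by omega,
    show g - (i + (i + 2 * p)) / 2 = g - i - p by omega]
  ring

theorem dCoeff_of_odd {g i j : ℕ} (h : Odd (i + j)) : dCoeff g i j = 0 := by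
  rcases Nat.lt_or_ge j i with hij | hij
  · exact dCoeff_of_gt hij
  obtain ⟨p, rfl⟩ : ∃ p, j = i + 2 * p + 1 := by
    obtain ⟨s, hs⟩ := h
    exact ⟨s - i, by omega⟩
  have h1 : Complex.I ^ ((i : ℤ) - (i + 2 * p + 1 : ℕ)) =
      - Complex.I ^ (((i + 2 * p + 1 : ℕ) : ℤ) - i) := by
    have h2 : Complex.I ^ (2 * (((i + 2 * p + 1 : ℕ) : ℤ) - i)) = -1 := by
      rw [zpow_mul, show (((i + 2 * p + 1 : ℕ) : ℤ) - i) = ((2 * p + 1 : ℕ) : ℤ) by push_cast; ring,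
        zpow_natCast, show (Complex.I ^ (2 : ℤ)) = -1 from by exact_mod_cast Complex.I_sq]
      exact Odd.neg_one_pow ⟨p, rfl⟩
    have h3 := zpow_add₀ Complex.I_ne_zero ((i : ℤ) - (i + 2 * p + 1 : ℕ))
      (2 * (((i + 2 * p + 1 : ℕ) : ℤ) - i))
    rw [show ((i : ℤ) - (i + 2 * p + 1 : ℕ)) + (2 * (((i + 2 * p + 1 : ℕ) : ℤ) - i)) =
      (((i + 2 * p + 1 : ℕ) : ℤ) - i) by ring, h2] at h3
    linear_combination h3
  rw [dCoeff, h1]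
  ring

theorem dCoeff_self (g i : ℕ) : dCoeff g i i = 1 := by
  simpa using dCoeff_add_two_mul g i 0

/-- Pascal's rule with alternating signs. It is the recurrence of the coefficients c transposed, so
that summation by parts moves the one onto the other. -/
theorem dCoeff_succ_add {g i j : ℕ} (hi : i + 1 ≤ g) (hj : j ≤ g) :
    dCoeff g (i + 2) j + dCoeff g i j = if j < g then dCoeff g (i + 1) (j + 1) else 0 := by
  rcases Nat.even_or_odd (i + j) with hp | hp
  · rcases Nat.lt_or_ge j i with h | h
    · rw [dCoeff_of_gt h, dCoeff_of_gt (by omega), dCoeff_of_gt (by omega)]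
      simp
    obtain ⟨p, rfl⟩ : ∃ p, j = i + 2 * p := by
      obtain ⟨s, hs⟩ := hp
      exact ⟨s - i, by omega⟩
    cases p with
    | zero =>
      rw [dCoeff_of_gt (by omega), mul_zero, add_zero, dCoeff_self, dCoeff_self, if_pos (by omega)]
      simp
    | succ p =>
      obtain ⟨m, rfl⟩ : ∃ m, g = i + 2 * p + 2 + m := ⟨g - (i + 2 * p + 2), by omega⟩
      rw [dCoeff_add_two_mul, show i + 2 * (p + 1) = i + 2 + 2 * p by ring,
        dCoeff_add_two_mul, show i + 2 + 2 * p + 1 = i + 1 + 2 * (p + 1) by ring,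
        dCoeff_add_two_mul]
      rw [show i + 2 * p + 2 + m - i - (p + 1) = p + m + 1 by omega,
        show i + 2 * p + 2 + m - (i + 2) - p = p + m by omega,
        show i + 2 * p + 2 + m - (i + 1) - (p + 1) = p + m by omega, Nat.choose_succ_succ]
      split_ifs with h
      · push_cast; ring
      · obtain rfl : m = 0 := by omega
        simp [pow_succ]
  · rw [dCoeff_of_odd hp, dCoeff_of_odd (i := i + 2), dCoeff_of_odd (i := i + 1)]
    · simp
    · rw [show i + 1 + (j + 1) = i + j + 2 by ring]
      exact hp.add_even even_two
    · rw [show i + 2 + j = i + j + 2 by ring]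
      exact hp.add_even even_two

/-- Descending induction on the row: the two recurrences turn entry (k, j) of the product into entry
(k+1, j+1). In the last column the transposed recurrence gives 0, as it should, because there k < g
= j. -/
theorem sum_coeffFamily_mul_dCoeff {g k : ℕ} (hk : k ≤ g) : ∀ j ≤ g,
    ∑ i ∈ Finset.range (g + 1), (coeffFamily g k (i : ℤ) : ℂ) * dCoeff g i j =
      if k = j then 1 else 0 := by
  have hc := isCoeffFamily_coeffFamily g
  induction hk using Nat.decreasingInduction with
  | self =>
    intro j hj
    rw [Finset.sum_eq_single g]
    · rw [hc.last]
      split_ifs with h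
      · rw [← h, dCoeff_self]; simp
      · rw [dCoeff_of_gt (by omega)]; simp
    · intro i _ hi
      rw [hc.last_of_ne i (by exact_mod_cast hi)]
      simp
    · simp
  | of_succ k hk ih =>
    intro j hj
    have key : ∑ i ∈ Finset.range (g + 1), (coeffFamily g k (i : ℤ) : ℂ) * dCoeff g i j =
        ∑ i ∈ Finset.range g, (coeffFamily g (k + 1) ((i + 1 : ℕ) : ℤ) : ℂ) *
          (dCoeff g (i + 2) j + dCoeff g i j) := by
      have h1 : ∀ i ∈ Finset.range (g + 1), (coeffFamily g k (i : ℤ) : ℂ) * dCoeff g i j =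
          (coeffFamily g (k + 1) ((i : ℤ) - 1) : ℂ) * dCoeff g i j +
            (coeffFamily g (k + 1) ((i : ℤ) + 1) : ℂ) * dCoeff g i j := by
        intro i hi
        rw [hc.step k hk i (by exact_mod_cast Nat.lt_succ_iff.1 (Finset.mem_range.1 hi))]
        push_cast
        ring
      rw [Finset.sum_congr rfl h1, Finset.sum_add_distrib]
      simp_rw [mul_add]
      rw [Finset.sum_add_distrib]
      congr 1
      · rw [Finset.sum_range_succ', coeffFamily_of_lt hk (by push_cast; omega)]
        have h2 : ∀ f : ℕ → ℂ, f 0 = 0 → f g = 0 →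
            ∑ i ∈ Finset.range g, f i = ∑ i ∈ Finset.range g, f (i + 1) := by
          intro f h0 hg
          have := (Finset.sum_range_succ f g).symm.trans (Finset.sum_range_succ' f g)
          rw [h0, hg] at this
          simpa using this
        -- The shift of the summation index costs nothing: the term at 0 vanishes since 0 < k + 1,
        -- the one at g since j < g + 1.
        have := h2 (fun i => (coeffFamily g (k + 1) (i : ℤ) : ℂ) * dCoeff g (i + 1) j)
          (by rw [coeffFamily_of_lt hk (by push_cast; omega)]; simp)
          (by rw [dCoeff_of_gt (by omega)]; simp)
        simpa using this
      · rw [Finset.sum_range_succ]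
        have : coeffFamily g (k + 1) ((g : ℤ) + 1) = 0 := coeffAux_of_gt _ _ _ (by omega)
        rw [this]
        simp
    rw [key]
    rw [Finset.sum_congr rfl fun i hi => by
      rw [dCoeff_succ_add (Finset.mem_range.1 hi) hj]]
    split_ifs with h1 h2 h2
    · have := ih (j + 1) h1
      rw [Finset.sum_range_succ', coeffFamily_of_lt hk (by push_cast; omega)] at this
      simpa [h2] using this
    · have := ih (j + 1) h1
      rw [Finset.sum_range_succ', coeffFamily_of_lt hk (by push_cast; omega)] at this
      simpa [h2] using this
    · omega
    · simp

end

/-! ### Independence of irreducible characters, by Jacobson density. -/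

section

namespace Representation

open scoped MonoidAlgebra

variable {k G : Type*} [Field k] [Group G]

theorem trace_asAlgebraHom_eq_sum {ι V : Type*} [Fintype ι] {W : ι → Type*}
    [AddCommGroup V] [Module k V] [∀ i, AddCommGroup (W i)] [∀ i, Module k (W i)]
    {ρ : Representation k G V} {σ : ∀ i, Representation k G (W i)} {a : ι → k}
    (h : ∀ x, ρ.character x = ∑ i, a i * (σ i).character x) (r : k[G]) :
    LinearMap.trace k V (ρ.asAlgebraHom r) =
      ∑ i, a i * LinearMap.trace k (W i) ((σ i).asAlgebraHom r) := by
  induction r using MonoidAlgebra.induction_linear with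
  | zero => simp
  | add x y hx hy => simp [hx, hy, mul_add, Finset.sum_add_distrib]
  | single g c =>
    simp only [asAlgebraHom_single, map_smul, smul_eq_mul]
    have := h g
    simp only [character] at this
    rw [this, Finset.mul_sum]
    exact Finset.sum_congr rfl fun i _ => by ring

theorem linearMap_eq_zero_of_isEmpty_equiv {V W : Type*} [AddCommGroup V] [Module k V]
    [AddCommGroup W] [Module k W] {ρ : Representation k G V} {σ : Representation k G W}
    [IsIrreducible ρ] [IsIrreducible σ] (h : IsEmpty (Equiv ρ σ))
    (f : ρ.asModule →ₗ[k[G]] σ.asModule) : f = 0 := by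
  have := Subsingleton.elim ((IntertwiningMap.equivLinearMapAsModule ρ σ).symm f) 0
  rwa [LinearEquiv.map_eq_zero_iff] at this

/-- If the character of an irreducible representation is a linear combination of the characters
of finitely many irreducible representations, then the representation is one of these. -/
theorem exists_equiv_of_character_eq_sum [CharZero k] {ι V : Type*} [Fintype ι] {W : ι → Type*}
    [AddCommGroup V] [Module k V] [FiniteDimensional k V]
    [∀ i, AddCommGroup (W i)] [∀ i, Module k (W i)] [∀ i, FiniteDimensional k (W i)]
    (ρ : Representation k G V) (σ : ∀ i, Representation k G (W i))
    [IsIrreducible ρ] [∀ i, IsIrreducible (σ i)] (a : ι → k)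
    (h : ∀ x, ρ.character x = ∑ i, a i * (σ i).character x) :
    ∃ i, Nonempty (Equiv ρ (σ i)) := by
  classical
  by_contra! hne
  have hne' : ∀ i, IsEmpty (Equiv (σ i) ρ) := fun i => ⟨fun e => (hne i).false e.symm⟩
  have h1 : ∀ (e : Module.End k[G] (ρ.asModule × ∀ i, (σ i).asModule)) (v : ρ.asModule), (e (v, 0)).2 = 0 := by
    intro e v
    ext i
    exact LinearMap.congr_fun (linearMap_eq_zero_of_isEmpty_equiv (hne i)
      (LinearMap.proj i ∘ₗ LinearMap.snd _ _ _ ∘ₗ e ∘ₗ LinearMap.inl _ _ _)) v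
  have h2 : ∀ (e : Module.End k[G] (ρ.asModule × ∀ i, (σ i).asModule)) (w : ∀ i, (σ i).asModule), (e (0, w)).1 = 0 := by
    intro e w
    have : LinearMap.fst _ _ _ ∘ₗ e ∘ₗ LinearMap.inr _ _ _ =
        (0 : (∀ i, (σ i).asModule) →ₗ[k[G]] ρ.asModule) := by
      refine LinearMap.pi_ext' fun i => ?_
      exact linearMap_eq_zero_of_isEmpty_equiv (hne' i) _
    exact LinearMap.congr_fun this w
  -- By Schur's lemma (`h1`, `h2`) no endomorphism mixes the factor ρ with the σ_i. So the
  -- projection onto ρ commutes with all endomorphisms, and density makes it agree on a finite set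
  -- with an element of the group algebra.
  let f : Module.End (Module.End k[G] (ρ.asModule × ∀ i, (σ i).asModule))
      (ρ.asModule × ∀ i, (σ i).asModule) :=
    { toFun := fun m => (m.1, 0)
      map_add' := fun m m' => by simp
      map_smul' := fun e m => by
        have h3 : e m = e (m.1, 0) + e (0, m.2) := by
          rw [← map_add]; simp
        change ((e m).1, 0) = e (m.1, 0)
        ext1
        · rw [h3, Prod.fst_add, h2]
          exact add_zero _
        · exact (h1 e _).symm }
  let b := Module.finBasis k V
  let b' := fun i => Module.finBasis k (σ i).asModule
  let s : Finset (ρ.asModule × ∀ i, (σ i).asModule) := Finset.univ.image (fun j => ((b j : ρ.asModule), 0)) ∪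
    Finset.univ.image (fun p : Σ i, Fin (Module.finrank k (σ i).asModule) =>
      ((0 : ρ.asModule), (Pi.single p.1 (b' p.1 p.2) :
        ∀ i, (σ i).asModule)))
  have hss : IsSemisimpleModule k[G] (ρ.asModule × ∀ i, (σ i).asModule) := by
    have : IsSemisimpleModule k[G] (⊤ : Submodule k[G] (ρ.asModule × ∀ i, (σ i).asModule)) := by
      rw [← LinearMap.sup_range_inl_inr]
      exact .sup (.range _) (.range _)
    exact .congr Submodule.topEquiv.symm
  obtain ⟨r, hr⟩ := jacobson_density f s
  have hV : ρ.asAlgebraHom r = 1 := by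
    refine b.ext fun j => ?_
    have := hr ((b j : ρ.asModule), 0) (by simp [s])
    exact (congrArg Prod.fst this).symm
  have hW : ∀ i, (σ i).asAlgebraHom r = 0 := by
    intro i
    refine (b' i).ext fun j => ?_
    have := hr ((0 : ρ.asModule), (Pi.single i (b' i j)))
      (Finset.mem_union_right _ (Finset.mem_image.2 ⟨⟨i, j⟩, Finset.mem_univ _, rfl⟩))
    have := congrFun (congrArg Prod.snd this) i
    have h4 : (r • (Pi.single i (b' i j) : ∀ i, (σ i).asModule)) i =
      r • b' i j := by simp
    exact (this.trans h4).symm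
  -- The element `r` acts as 1 on ρ and as 0 on every σ_i, so the character identity, extended to
  -- the group algebra, reads dim V = 0.
  have := trace_asAlgebraHom_eq_sum h r
  simp only [hV, hW, map_zero, mul_zero, Finset.sum_const_zero, LinearMap.trace_one] at this
  have h5 : Module.finrank k V = 0 := by exact_mod_cast this
  have h6 : Subsingleton V := Module.finrank_zero_iff.1 h5
  have : Nontrivial (Subrepresentation ρ) := inferInstance
  obtain ⟨x, y, hxy⟩ := this
  apply hxy
  apply Subrepresentation.toSubmodule_injective
  exact Subsingleton.elim _ _

end Representation

end

/-! ### Diagonalisation in `USp(2g)`. -/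

section

open Matrix
open scoped ComplexOrder

namespace USp

variable {g : ℕ}

/-- A unitary symplectic matrix as an element of `USp g`. -/
def ofMatrix (A : Matrix (Fin g ⊕ Fin g) (Fin g ⊕ Fin g) ℂ)
    (h : A ∈ unitaryGroup (Fin g ⊕ Fin g) ℂ) (h' : A ∈ symplecticGroup (Fin g) ℂ) : USp g :=
  ⟨⟨A, h⟩, h'⟩

theorem toMatrix_injective : Function.Injective (toMatrix : USp g → _) :=
  fun _ _ h => Subtype.ext (Subtype.ext h)

@[simp]
theorem toMatrix_one : toMatrix (1 : USp g) = 1 := rfl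

@[simp]
theorem toMatrix_mul (x y : USp g) : toMatrix (x * y) = toMatrix x * toMatrix y := rfl

@[simp]
theorem toMatrix_inv (x : USp g) : toMatrix x⁻¹ = (toMatrix x)ᴴ := rfl

theorem toMatrix_torus (z : Fin g → Circle) : toMatrix (torus z) =
    diagonal (Sum.elim (fun i => (z i : ℂ)) (fun i => ((z i)⁻¹ : Circle))) := rfl

theorem conjTranspose_mul_toMatrix (x : USp g) : (toMatrix x)ᴴ * toMatrix x = 1 :=
  mem_unitaryGroup_iff'.1 x.1.2

theorem toMatrix_mul_J_mul_transpose (x : USp g) :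
    toMatrix x * J (Fin g) ℂ * (toMatrix x)ᵀ = J (Fin g) ℂ := x.2

theorem transpose_mul_J_mul_toMatrix (x : USp g) :
    (toMatrix x)ᵀ * J (Fin g) ℂ * toMatrix x = J (Fin g) ℂ :=
  SymplecticGroup.mem_iff'.1 x.2

theorem torus_mul (z w : Fin g → Circle) : torus (z * w) = torus z * torus w := by
  apply toMatrix_injective
  rw [toMatrix_mul, toMatrix_torus, toMatrix_torus, toMatrix_torus, diagonal_mul_diagonal]
  congr 1
  ext i
  rcases i with i | i <;> simp [mul_comm]

theorem torus_one : torus (1 : Fin g → Circle) = 1 := by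
  apply toMatrix_injective
  rw [toMatrix_torus, toMatrix_one, ← diagonal_one]
  congr 1
  ext i
  rcases i with i | i <;> simp

theorem continuous_toMatrix : Continuous (toMatrix : USp g → _) :=
  continuous_subtype_val.comp continuous_subtype_val

theorem continuous_torus : Continuous (torus : (Fin g → Circle) → USp g) := by
  refine Continuous.subtype_mk (Continuous.subtype_mk ?_ _) _
  refine Continuous.matrix_diagonal ?_
  refine continuous_pi fun i => ?_
  rcases i with i | i
  · exact continuous_subtype_val.comp (continuous_apply i)
  · exact continuous_subtype_val.comp (continuous_apply i).inv

/-- For a unitary matrix the inverse transpose is the entrywise conjugate, so the symplectic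
condition says that x commutes with the antilinear map v ↦ J v̄. -/
theorem toMatrix_mul_J (x : USp g) :
    toMatrix x * J (Fin g) ℂ = J (Fin g) ℂ * (toMatrix x).map star := by
  have h : (toMatrix x)ᵀ * (toMatrix x).map star = 1 := by
    have := congrArg Matrix.transpose (conjTranspose_mul_toMatrix x)
    rw [transpose_mul, transpose_one] at this
    exact this
  calc toMatrix x * J (Fin g) ℂ =
      toMatrix x * J (Fin g) ℂ * ((toMatrix x)ᵀ * (toMatrix x).map star) := by
        rw [h, mul_one]
    _ = J (Fin g) ℂ * (toMatrix x).map star := by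
        rw [← mul_assoc, toMatrix_mul_J_mul_transpose]

end USp

/-- The antiunitary quaternionic structure on `ℂ^(2g)`. -/
def quatConj {g : ℕ} (v : Fin g ⊕ Fin g → ℂ) : Fin g ⊕ Fin g → ℂ :=
  Sum.elim (fun i => -star (v (Sum.inr i))) (fun i => star (v (Sum.inl i)))

section quatConj

variable {g : ℕ} (u v : Fin g ⊕ Fin g → ℂ)

theorem quatConj_eq : quatConj v = J (Fin g) ℂ *ᵥ star v := by
  ext i
  rcases i with i | i <;>
    simp [quatConj, J, mulVec, dotProduct, Matrix.one_apply]

theorem quatConj_smul (a : ℂ) : quatConj (a • v) = star a • quatConj v := by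
  ext i
  rcases i with i | i <;> simp [quatConj]

theorem toMatrix_mulVec_quatConj (x : USp g) :
    USp.toMatrix x *ᵥ quatConj v = quatConj (USp.toMatrix x *ᵥ v) := by
  rw [quatConj_eq, quatConj_eq, mulVec_mulVec, USp.toMatrix_mul_J, ← mulVec_mulVec]
  congr 1
  ext i
  simp [mulVec, dotProduct]

theorem dotProduct_quatConj_quatConj :
    star (quatConj u) ⬝ᵥ quatConj v = star (star u ⬝ᵥ v) := by
  simp only [dotProduct, Fintype.sum_sum_type, quatConj, Pi.star_apply, Sum.elim_inl,
    Sum.elim_inr, star_add, star_sum, star_mul', star_neg, star_star]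
  rw [add_comm]
  congr 1
  all_goals exact Finset.sum_congr rfl fun i _ => by ring

theorem dotProduct_quatConj_comm :
    star u ⬝ᵥ quatConj v = -(star v ⬝ᵥ quatConj u) := by
  simp only [dotProduct, Fintype.sum_sum_type, quatConj, Pi.star_apply, Sum.elim_inl,
    Sum.elim_inr]
  rw [neg_add, add_comm, ← Finset.sum_neg_distrib, ← Finset.sum_neg_distrib]
  congr 1 <;> exact Finset.sum_congr rfl fun i _ => by ring

theorem dotProduct_quatConj_self : star v ⬝ᵥ quatConj v = 0 := by
  have := dotProduct_quatConj_comm v v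
  exact CharZero.eq_neg_self_iff.1 this

end quatConj

namespace USp

variable {g : ℕ}

theorem dotProduct_toMatrix_mulVec (x : USp g) (u w : Fin g ⊕ Fin g → ℂ) :
    star (toMatrix x *ᵥ u) ⬝ᵥ (toMatrix x *ᵥ w) = star u ⬝ᵥ w := by
  rw [star_mulVec, dotProduct_mulVec, vecMul_vecMul, conjTranspose_mul_toMatrix, vecMul_one]

/-- Unitarity makes the orthogonal complement of an eigenvector invariant. An eigenvalue 0 would
force u = 0, as norms are preserved. -/
theorem dotProduct_toMatrix_mulVec_eq_zero (x : USp g) {u w : Fin g ⊕ Fin g → ℂ} {a : ℂ}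
    (hu : toMatrix x *ᵥ u = a • u) (h : star u ⬝ᵥ w = 0) :
    star u ⬝ᵥ (toMatrix x *ᵥ w) = 0 := by
  have h1 := dotProduct_toMatrix_mulVec x u w
  rw [hu, h, star_smul, smul_dotProduct, smul_eq_zero] at h1
  rcases h1 with h1 | h1
  · have h2 := dotProduct_toMatrix_mulVec x u u
    rw [hu, star_eq_zero.1 h1, zero_smul, dotProduct_zero] at h2
    rw [dotProduct_star_self_eq_zero.1 h2.symm]
    simp
  · exact h1

/-- An eigenvector of `x ∈ USp(2g)` orthogonal to given eigenvectors and their images under the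
quaternionic structure. -/
theorem exists_eigenvector (x : USp g) {k : ℕ} (hk : k < g) (v : Fin k → Fin g ⊕ Fin g → ℂ)
    (a : Fin k → ℂ) (hv : ∀ i, toMatrix x *ᵥ v i = a i • v i) :
    ∃ (w : Fin g ⊕ Fin g → ℂ) (b : ℂ), star w ⬝ᵥ w = 1 ∧ toMatrix x *ᵥ w = b • w ∧
      ∀ i, star (v i) ⬝ᵥ w = 0 ∧ star (quatConj (v i)) ⬝ᵥ w = 0 := by
  -- The kernel of `F` is the orthogonal complement of the v_i and their conjugates: only 2k < 2g
  -- conditions, so it is nonzero. It is stable under x, because the conjugates are eigenvectors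
  -- too.
  let F : (Fin g ⊕ Fin g → ℂ) →ₗ[ℂ] (Fin k ⊕ Fin k → ℂ) :=
    Matrix.mulVecLin (Matrix.of (Sum.elim (fun i => star (v i)) (fun i => star (quatConj (v i)))))
  have hF : ∀ w, w ∈ LinearMap.ker F ↔
      ∀ i, star (v i) ⬝ᵥ w = 0 ∧ star (quatConj (v i)) ⬝ᵥ w = 0 := by
    intro w
    rw [LinearMap.mem_ker, funext_iff, Sum.forall, ← forall_and]
    rfl
  have hker : LinearMap.ker F ≠ ⊥ := by
    apply LinearMap.ker_ne_bot_of_finrank_lt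
    simp
    omega
  have hmaps : ∀ w ∈ LinearMap.ker F, (toMatrix x).mulVecLin w ∈ LinearMap.ker F := by
    intro w hw
    rw [hF] at hw ⊢
    intro i
    refine ⟨dotProduct_toMatrix_mulVec_eq_zero x (hv i) (hw i).1, ?_⟩
    refine dotProduct_toMatrix_mulVec_eq_zero x (a := star (a i)) ?_ (hw i).2
    rw [toMatrix_mulVec_quatConj, hv, quatConj_smul]
  have := Submodule.nontrivial_iff_ne_bot.2 hker
  obtain ⟨b, hb⟩ := Module.End.exists_eigenvalue ((toMatrix x).mulVecLin.restrict hmaps)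
  obtain ⟨w, hw⟩ := hb.exists_hasEigenvector
  have hw1 : toMatrix x *ᵥ w.1 = b • w.1 := congrArg Subtype.val hw.apply_eq_smul
  have hw0 : w.1 ≠ 0 := fun h => hw.2 (Subtype.ext h)
  have hw2 := (hF _).1 w.2
  have hpos : 0 < star w.1 ⬝ᵥ w.1 := dotProduct_star_self_pos_iff.2 hw0
  obtain ⟨r, hr, hr'⟩ : ∃ r : ℝ, 0 < r ∧ star w.1 ⬝ᵥ w.1 = (r : ℂ) := by
    refine ⟨(star w.1 ⬝ᵥ w.1).re, (Complex.pos_iff.1 hpos).1, ?_⟩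
    apply Complex.ext
    · simp
    · simpa using (Complex.pos_iff.1 hpos).2.symm
  refine ⟨((Real.sqrt r : ℝ) : ℂ)⁻¹ • w.1, b, ?_, ?_, ?_⟩
  · rw [star_smul, smul_dotProduct, dotProduct_smul, hr']
    have : ((Real.sqrt r : ℝ) : ℂ) * ((Real.sqrt r : ℝ) : ℂ) = r := by
      rw [← Complex.ofReal_mul, Real.mul_self_sqrt hr.le]
    have h0 : ((Real.sqrt r : ℝ) : ℂ) ≠ 0 := by
      exact_mod_cast (Real.sqrt_pos.2 hr).ne'
    simp only [star_inv₀, Complex.star_def, Complex.conj_ofReal, smul_eq_mul]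
    rw [← this]
    field_simp
  · rw [mulVec_smul, hw1, smul_comm]
  · intro i
    simp [dotProduct_smul, hw2 i]

/-- Eigenvectors come in pairs v, J v̄ that are automatically orthogonal, with conjugate
eigenvalues. Choosing one pair at a time in the complement of the earlier ones ends, at k = g, with
an orthonormal eigenbasis of the form required of the columns of a symplectic matrix. -/
theorem exists_eigenbasis (x : USp g) : ∀ k ≤ g, ∃ (v : Fin k → Fin g ⊕ Fin g → ℂ)
    (a : Fin k → ℂ), (∀ i j, star (v i) ⬝ᵥ v j = if i = j then 1 else 0) ∧
      (∀ i j, star (v i) ⬝ᵥ quatConj (v j) = 0) ∧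
      ∀ i, toMatrix x *ᵥ v i = a i • v i := by
  intro k
  induction k with
  | zero => exact fun _ => ⟨Fin.elim0, Fin.elim0, fun i => i.elim0, fun i => i.elim0,
      fun i => i.elim0⟩
  | succ k ih =>
    intro hk
    obtain ⟨v, a, h1, h2, h3⟩ := ih (by omega)
    obtain ⟨w, b, hw1, hw2, hw3⟩ := exists_eigenvector x hk v a h3
    have hw4 : ∀ i, star w ⬝ᵥ v i = 0 := fun i => by
      rw [star_dotProduct, (hw3 i).1, star_zero]
    have hw5 : ∀ i, star w ⬝ᵥ quatConj (v i) = 0 := fun i => by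
      rw [star_dotProduct, (hw3 i).2, star_zero]
    refine ⟨Fin.cons w v, Fin.cons b a, ?_, ?_, ?_⟩
    · intro i j
      refine Fin.cases ?_ (fun i => ?_) i <;> refine Fin.cases ?_ (fun j => ?_) j
      · simpa using hw1
      · simpa [(Fin.succ_ne_zero j).symm] using hw4 j
      · simpa using (hw3 i).1
      · simpa using h1 i j
    · intro i j
      refine Fin.cases ?_ (fun i => ?_) i <;> refine Fin.cases ?_ (fun j => ?_) j
      · simpa using dotProduct_quatConj_self w
      · simpa using hw5 j
      · simpa [hw5 i] using dotProduct_quatConj_comm (v i) w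
      · simpa using h2 i j
    · intro i
      refine Fin.cases ?_ (fun i => ?_) i
      · simpa using hw2
      · simpa using h3 i

/-- Each element of `USp(2g)` is conjugate to an element of the standard maximal torus. -/
theorem exists_eq_conj_torus (x : USp g) :
    ∃ (y : USp g) (z : Fin g → Circle), x = y * torus z * y⁻¹ := by
  obtain ⟨v, a, h1, h2, h3⟩ := exists_eigenbasis x g le_rfl
  let A : Matrix (Fin g ⊕ Fin g) (Fin g ⊕ Fin g) ℂ :=
    (Matrix.of (Sum.elim v (fun i => quatConj (v i))))ᵀ
  have hA : Aᴴ * A = 1 := by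
    ext i j
    have : (Aᴴ * A) i j = star (Sum.elim v (fun i => quatConj (v i)) i) ⬝ᵥ
      (Sum.elim v (fun i => quatConj (v i)) j) := rfl
    rw [this]
    rcases i with i | i <;> rcases j with j | j
    · simpa [Matrix.one_apply] using h1 i j
    · simpa using h2 i j
    · simp only [Sum.elim_inl, Sum.elim_inr]
      rw [star_dotProduct, h2]
      simp
    · simp only [Sum.elim_inr]
      rw [dotProduct_quatConj_quatConj, h1]
      simp [Matrix.one_apply, apply_ite]
  have hA' : A * Aᴴ = 1 := mul_eq_one_comm.1 hA
  -- The right half of the columns is the quaternionic conjugate of the left half; together with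
  -- unitarity this is the symplectic condition.
  have hAJ : A * J (Fin g) ℂ = J (Fin g) ℂ * A.map star := by
    ext i j
    rcases i with i | i <;> rcases j with j | j <;>
      simp [A, J, Matrix.mul_apply, Matrix.one_apply, quatConj, fromBlocks]
  have hAs : A ∈ symplecticGroup (Fin g) ℂ := by
    rw [SymplecticGroup.mem_iff, hAJ, Matrix.mul_assoc]
    have : A.map star * Aᵀ = 1 := by
      have := congrArg Matrix.transpose hA'
      rw [transpose_mul, transpose_one] at this
      exact this
    rw [this, Matrix.mul_one]
  have ha : ∀ i, star (a i) * a i = 1 := by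
    intro i
    have := dotProduct_toMatrix_mulVec x (v i) (v i)
    rw [h3, star_smul, smul_dotProduct, dotProduct_smul, h1] at this
    simpa using this
  have ha' : ∀ i, a i ∈ Submonoid.unitSphere ℂ := by
    intro i
    rw [Submonoid.unitSphere, ← SetLike.mem_coe]
    refine mem_sphere_zero_iff_norm.2 ?_
    have := congrArg norm (ha i)
    rw [norm_mul, norm_star, norm_one] at this
    nlinarith [norm_nonneg (a i)]
  let z : Fin g → Circle := fun i => ⟨a i, ha' i⟩
  let y : USp g := ofMatrix A (mem_unitaryGroup_iff'.2 hA) hAs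
  refine ⟨y, z, ?_⟩
  rw [eq_mul_inv_iff_mul_eq]
  apply toMatrix_injective
  rw [toMatrix_mul, toMatrix_mul, toMatrix_torus]
  ext i j
  rw [Matrix.mul_diagonal]
  rcases j with j | j
  · have := congrFun (h3 j) i
    simp only [Pi.smul_apply, smul_eq_mul] at this
    exact this.trans (mul_comm _ _)
  · have h4 : toMatrix x *ᵥ quatConj (v j) = star (a j) • quatConj (v j) := by
      rw [toMatrix_mulVec_quatConj, h3, quatConj_smul]
    have := congrFun h4 i
    simp only [Pi.smul_apply, smul_eq_mul] at this
    refine this.trans ((mul_comm _ _).trans ?_)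
    congr 1
    exact (Circle.coe_inv_eq_conj (z j)).symm

end USp

end

/-! ### Elementary symmetric functions and the values of `s_k` on the torus. -/

section

open Matrix

/-- The `k`-th elementary symmetric function of a finite family. -/
def elemSymm {ι : Type*} [Fintype ι] (k : ℕ) (t : ι → ℂ) : ℂ :=
  ∑ A ∈ Finset.powersetCard k Finset.univ, ∏ i ∈ A, t i

section elemSymm

open Polynomial

variable {ι : Type*} [Fintype ι]

theorem elemSymm_zero (t : ι → ℂ) : elemSymm 0 t = 1 := by
  simp [elemSymm]

theorem coeff_prod_one_add_C_mul_X (t : ι → ℂ) (k : ℕ) :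
    (∏ i, (1 + C (t i) * X : ℂ[X])).coeff k = elemSymm k t := by
  rw [Finset.prod_one_add, finsetSum_coeff, elemSymm, Finset.powersetCard_eq_filter,
    Finset.sum_filter]
  refine Finset.sum_congr rfl fun A _ => ?_
  rw [Finset.prod_mul_distrib, Finset.prod_const, ← map_prod, coeff_C_mul_X_pow]
  simp only [eq_comm]

/-- Each pair of factors is (1 + zX)(1 + wX) = (1 + X²) + (z + w)X; expanding, k counts the factors
that contribute (z + w)X. -/
theorem elemSymm_sumElim {g j : ℕ} (z w : Fin g → ℂ) (h : ∀ i, z i * w i = 1) :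
    elemSymm j (Sum.elim z w) = ∑ k ∈ Finset.range (g + 1),
      (X ^ k * (1 + X ^ 2) ^ (g - k) : ℂ[X]).coeff j * elemSymm k (fun i => z i + w i) := by
  classical
  have h1 : ∏ i, (1 + C (Sum.elim z w i) * X : ℂ[X]) =
      ∏ i, (C (z i + w i) * X + (1 + X ^ 2) : ℂ[X]) := by
    rw [Fintype.prod_sum_type, ← Finset.prod_mul_distrib]
    refine Finset.prod_congr rfl fun i _ => ?_
    have : C (z i) * C (w i) = (1 : ℂ[X]) := by rw [← C_mul, h, C_1]
    simp only [Sum.elim_inl, Sum.elim_inr, C_add]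
    linear_combination X ^ 2 * this
  rw [← coeff_prod_one_add_C_mul_X, h1, Finset.prod_add, finsetSum_coeff, Finset.sum_powerset]
  simp only [Finset.card_univ, Fintype.card_fin]
  refine Finset.sum_congr rfl fun k _ => ?_
  rw [elemSymm, Finset.mul_sum]
  refine Finset.sum_congr rfl fun A hA => ?_
  rw [Finset.mem_powersetCard] at hA
  rw [Finset.prod_mul_distrib, Finset.prod_const, Finset.prod_const, ← map_prod,
    Finset.card_sdiff_of_subset hA.1, hA.2, Finset.card_univ, Fintype.card_fin, mul_assoc,
    coeff_C_mul, mul_comm]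

theorem coeff_one_add_X_sq_pow (n r : ℕ) :
    ((1 + X ^ 2) ^ n : ℂ[X]).coeff (2 * r) = n.choose r := by
  have : ((1 + X ^ 2) ^ n : ℂ[X]) = expand ℂ 2 ((1 + X) ^ n) := by simp
  rw [this, mul_comm, coeff_expand_mul two_pos, coeff_one_add_X_pow]

theorem coeff_one_add_X_sq_pow_of_odd (n : ℕ) {r : ℕ} (h : Odd r) :
    ((1 + X ^ 2) ^ n : ℂ[X]).coeff r = 0 := by
  have : ((1 + X ^ 2) ^ n : ℂ[X]) = expand ℂ 2 ((1 + X) ^ n) := by simp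
  rw [this, coeff_expand two_pos, if_neg]
  exact h.not_two_dvd_nat

theorem coeffFamily_eq_coeff_sub {g k j : ℕ} (hk : k ≤ g) (hj : j + 2 ≤ g) :
    (coeffFamily g k ((j + 2 : ℕ) : ℤ) : ℂ) =
      (X ^ k * (1 + X ^ 2) ^ (g - k) : ℂ[X]).coeff (j + 2) -
        (X ^ k * (1 + X ^ 2) ^ (g - k) : ℂ[X]).coeff j := by
  rw [coeff_X_pow_mul', coeff_X_pow_mul']
  split_ifs with h1 h2 h2
  · rcases Nat.even_or_odd (j - k) with h | h
    · obtain ⟨r, hr⟩ := h.two_dvd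
      obtain rfl : j = k + 2 * r := by omega
      rw [show k + 2 * r + 2 = k + 2 * (r + 1) by ring, coeffFamily_eq_ballot (by omega),
        Nat.add_sub_cancel_left, Nat.add_sub_cancel_left, coeff_one_add_X_sq_pow,
        coeff_one_add_X_sq_pow, ballot]
      push_cast
      rfl
    · rw [coeffFamily_of_odd hk, coeff_one_add_X_sq_pow_of_odd _ h,
        coeff_one_add_X_sq_pow_of_odd]
      · simp
      · rw [show j + 2 - k = j - k + 2 by omega]
        exact h.add_even even_two
      · have : Odd ((j - k : ℕ) : ℤ) := by exact_mod_cast h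
        have := this.add_even even_two
        rwa [show ((j - k : ℕ) : ℤ) + 2 = (j + 2 : ℕ) - k by omega] at this
  · rcases Nat.eq_or_lt_of_le h1 with h | h
    · have := coeffFamily_eq_ballot (g := g) (i := k) (r := 0) (by omega)
      simp only [mul_zero, add_zero] at this
      rw [← h, this, ballot, Nat.sub_self, coeff_zero_eq_eval_zero]
      simp
    · obtain rfl : k = j + 1 := by omega
      rw [coeffFamily_of_odd hk, coeff_one_add_X_sq_pow_of_odd]
      · simp
      · rw [show j + 2 - (j + 1) = 1 by omega]; exact odd_one
      · rw [show (((j + 2 : ℕ) : ℤ) - (j + 1 : ℕ)) = 1 by push_cast; ring]; exact odd_one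
  · omega
  · rw [coeffFamily_of_lt hk (by exact_mod_cast not_le.1 h1)]
    simp

/-- In degrees 0 and 1 there is nothing to subtract: all forms are primitive. -/
theorem coeffFamily_of_lt_two {g k j : ℕ} (hj : j ≤ g) (hj' : j < 2) :
    coeffFamily g k (j : ℤ) = if k = j then 1 else if k ≤ g then 0 else coeffFamily g k j := by
  split_ifs with h h'
  · have := coeffFamily_eq_ballot (g := g) (i := j) (r := 0) (by omega)
    simpa [ballot, h] using this
  · rcases Nat.lt_or_ge j k with h1 | h1
    · exact coeffFamily_of_lt h' (by exact_mod_cast h1)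
    · apply coeffFamily_of_odd h'
      rw [show ((j : ℤ) - k) = 1 by omega]
      exact odd_one
  · rfl

theorem elemSymm_sumElim_of_lt_two {g j : ℕ} (hj : j ≤ g) (hj' : j < 2) (z w : Fin g → ℂ)
    (h : ∀ i, z i * w i = 1) :
    elemSymm j (Sum.elim z w) = ∑ k ∈ Finset.range (g + 1),
      (coeffFamily g k (j : ℤ) : ℂ) * elemSymm k (fun i => z i + w i) := by
  rw [elemSymm_sumElim z w h]
  refine Finset.sum_congr rfl fun k hk => ?_
  have hk' : k ≤ g := Nat.lt_succ_iff.1 (Finset.mem_range.1 hk)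
  congr 1
  rw [coeffFamily_of_lt_two hj hj', if_pos hk', coeff_X_pow_mul']
  split_ifs with h1 h2 h2
  · rw [h2, Nat.sub_self, coeff_zero_eq_eval_zero]
    simp
  · rw [show j - k = 1 by omega, coeff_one_add_X_sq_pow_of_odd _ odd_one]
    simp
  · omega
  · simp

theorem elemSymm_sumElim_sub {g j : ℕ} (hj : j + 2 ≤ g) (z w : Fin g → ℂ)
    (h : ∀ i, z i * w i = 1) :
    elemSymm (j + 2) (Sum.elim z w) - elemSymm j (Sum.elim z w) = ∑ k ∈ Finset.range (g + 1),
      (coeffFamily g k ((j + 2 : ℕ) : ℤ) : ℂ) * elemSymm k (fun i => z i + w i) := by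
  rw [elemSymm_sumElim z w h, elemSymm_sumElim z w h, ← Finset.sum_sub_distrib]
  refine Finset.sum_congr rfl fun k hk => ?_
  rw [coeffFamily_eq_coeff_sub (Nat.lt_succ_iff.1 (Finset.mem_range.1 hk)) hj]
  ring

/-- The sum of the monomials with exponents in `{-1, 0, 1}`, weighted by a function of the number
of nonzero exponents, in terms of the elementary symmetric functions of `z + z⁻¹`. -/
theorem sum_piFinset_prod_zpow {g : ℕ} (z : Fin g → ℂ) (M : ℕ → ℂ) :
    ∑ μ ∈ Fintype.piFinset (fun _ : Fin g => ({-1, 0, 1} : Finset ℤ)),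
      M (∑ i, (μ i).natAbs) * ∏ i, z i ^ μ i =
    ∑ k ∈ Finset.range (g + 1), M k * elemSymm k (fun i => z i + (z i)⁻¹) := by
  -- The variable X records the number of nonzero exponents: 1 + (z + z⁻¹)X is the sum of z^s X^|s|
  -- over s in {-1, 0, 1}.
  have h1 : ∏ i, (1 + C (z i + (z i)⁻¹) * X : ℂ[X]) =
      ∑ μ ∈ Fintype.piFinset (fun _ : Fin g => ({-1, 0, 1} : Finset ℤ)),
        C (∏ i, z i ^ μ i) * X ^ (∑ i, (μ i).natAbs) := by
    have : ∀ i, (1 + C (z i + (z i)⁻¹) * X : ℂ[X]) =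
        ∑ s ∈ ({-1, 0, 1} : Finset ℤ), C (z i ^ s) * X ^ s.natAbs := by
      intro i
      rw [Finset.sum_insert (by decide), Finset.sum_insert (by decide), Finset.sum_singleton]
      simp only [_root_.zpow_neg, zpow_one, zpow_zero, Int.natAbs_neg, Int.natAbs_one, Int.natAbs_zero,
        pow_one, pow_zero, C_1, C_add]
      ring
    rw [Finset.prod_congr rfl fun i _ => this i, Finset.prod_univ_sum]
    refine Finset.sum_congr rfl fun μ _ => ?_
    rw [Finset.prod_mul_distrib, ← map_prod, Finset.prod_pow_eq_pow_sum]
  have h2 : ∀ k, elemSymm k (fun i => z i + (z i)⁻¹) =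
      ∑ μ ∈ Fintype.piFinset (fun _ : Fin g => ({-1, 0, 1} : Finset ℤ)),
        if k = ∑ i, (μ i).natAbs then ∏ i, z i ^ μ i else 0 := by
    intro k
    rw [← coeff_prod_one_add_C_mul_X, h1, finsetSum_coeff]
    exact Finset.sum_congr rfl fun μ _ => coeff_C_mul_X_pow _ _ _
  simp_rw [h2, Finset.mul_sum]
  rw [Finset.sum_comm]
  refine Finset.sum_congr rfl fun μ hμ => ?_
  have h3 : ∑ i, (μ i).natAbs ∈ Finset.range (g + 1) := by
    rw [Finset.mem_range, Nat.lt_succ_iff]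
    calc ∑ i, (μ i).natAbs ≤ ∑ _i : Fin g, 1 := by
          refine Finset.sum_le_sum fun i _ => ?_
          have := Fintype.mem_piFinset.1 hμ i
          simp only [Finset.mem_insert, Finset.mem_singleton] at this
          omega
      _ = g := by simp
  rw [Finset.sum_eq_single_of_mem _ h3 fun k _ hk => by rw [if_neg hk, mul_zero], if_pos rfl]

end elemSymm

namespace USp

open Polynomial

variable {g : ℕ}

theorem charpoly_conj_torus (y : USp g) (z : Fin g → Circle) :
    (toMatrix (y * torus z * y⁻¹)).charpoly =
      ∏ i, ((X - C (z i : ℂ)) * (X - C ((z i : ℂ)⁻¹))) := by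
  rw [toMatrix_mul, Matrix.charpoly_mul_comm, ← toMatrix_mul, ← mul_assoc, inv_mul_cancel, one_mul,
    toMatrix_torus, charpoly_diagonal, Fintype.prod_sum_type, ← Finset.prod_mul_distrib]
  simp

theorem isRealCharpoly_conj_torus (y : USp g) (z : Fin g → Circle) :
    IsRealCharpoly (y * torus z * y⁻¹) (∏ i, (X - C (2 * (z i : ℂ).re))) := by
  intro w hw
  rw [charpoly_conj_torus, eval_prod, map_prod]
  have : w ^ g = ∏ _i : Fin g, w := by simp
  rw [this, ← Finset.prod_mul_distrib]
  refine Finset.prod_congr rfl fun i _ => ?_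
  have h1 : ((2 * (z i : ℂ).re : ℝ) : ℂ) = z i + (z i : ℂ)⁻¹ := by
    rw [← Circle.coe_inv, Circle.coe_inv_eq_conj, Complex.add_conj]
  simp only [eval_mul, eval_sub, eval_X, eval_C, map_sub, aeval_X, aeval_C]
  rw [Complex.coe_algebraMap, h1]
  field_simp
  ring

theorem realCharpoly_conj_torus (y : USp g) (z : Fin g → Circle) :
    realCharpoly (y * torus z * y⁻¹) = ∏ i, (X - C (2 * (z i : ℂ).re)) := by
  have h : ∃ p, IsRealCharpoly (y * torus z * y⁻¹) p := ⟨_, isRealCharpoly_conj_torus y z⟩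
  rw [realCharpoly, dif_pos h]
  exact h.choose_spec.unique (isRealCharpoly_conj_torus y z)

/-- The roots of the normalized polynomial are 2 Re z_i = z_i + z_i⁻¹, and the sign in Vieta's
formula cancels the one in `sCoeff`. -/
theorem sCoeff_conj_torus (y : USp g) (z : Fin g → Circle) {k : ℕ} (hk : k ≤ g) :
    sCoeff g k (y * torus z * y⁻¹) = elemSymm k (fun i => (z i : ℂ) + (z i : ℂ)⁻¹) := by
  have h1 : ∀ i, (z i : ℂ) + (z i : ℂ)⁻¹ = ((2 * (z i : ℂ).re : ℝ) : ℂ) := by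
    intro i
    rw [← Circle.coe_inv, Circle.coe_inv_eq_conj, Complex.add_conj]
  have h2 := Multiset.prod_X_sub_C_coeff
    (Finset.univ.val.map fun i : Fin g => (2 * (z i : ℂ).re)) (k := g - k) (by simp)
  rw [Multiset.map_map] at h2
  have h3 : g - (g - k) = k := by omega
  simp only [Multiset.card_map, Finset.card_val, Finset.card_univ, Fintype.card_fin, h3,
    Finset.esymm_map_val] at h2
  have h4 : (∏ i, (X - C (2 * (z i : ℂ).re))).coeff (g - k) =
    (-1) ^ k * ∑ A ∈ Finset.powersetCard k Finset.univ, ∏ i ∈ A, 2 * (z i : ℂ).re := h2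
  simp only [h1]
  rw [sCoeff, realCharpoly_conj_torus, h4, elemSymm]
  push_cast
  rw [← mul_assoc, ← mul_pow]
  simp

end USp

end

/-! ### Continuous representations of a torus. -/

section

/-- Some Fourier coefficient of f is nonzero, since otherwise its Fourier series would give f(1) =
0. Translating the integral that defines this n-th coefficient multiplies it by z⁻ⁿ f(z), so that
factor is 1. -/
theorem Circle.exists_eq_zpow_of_continuous (f : Circle →* ℂ) (hf : Continuous f) :
    ∃ n : ℤ, ∀ z : Circle, f z = (z : ℂ) ^ n := by
  have : Fact (0 < 2 * Real.pi) := ⟨Real.two_pi_pos⟩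
  let F : C(AddCircle (2 * Real.pi), ℂ) :=
    ⟨fun t => f (AddCircle.toCircle t), hf.comp AddCircle.continuous_toCircle⟩
  have hF : ∀ s t, F (s + t) = F s * F t := fun s t => by
    simp [F, AddCircle.toCircle_add]
  have hF0 : F 0 = 1 := by simp [F]
  obtain ⟨n, hn⟩ : ∃ n, fourierCoeff F n ≠ 0 := by
    by_contra! h
    have h1 : Summable (fourierCoeff F) := by
      rw [funext h]
      exact summable_zero
    have h2 := has_pointwise_sum_fourier_series_of_summable h1 0
    simp only [h, zero_smul] at h2
    have := h2.unique hasSum_zero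
    rw [hF0] at this
    exact one_ne_zero this
  refine ⟨n, ?_⟩
  have key : ∀ s, fourier (-n) s * F s = 1 := by
    intro s
    have h1 : ∫ t, fourier (-n) (t + s) • F (t + s) ∂AddCircle.haarAddCircle =
        fourierCoeff F n :=
      MeasureTheory.integral_add_right_eq_self
        (fun t => fourier (-n) t • F t) s
    have h2 : ∀ t, fourier (-n) (t + s) • F (t + s) =
        (fourier (-n) s * F s) * (fourier (-n) t • F t) := by
      intro t
      have : (fourier (-n) (t + s) : ℂ) = fourier (-n) t * fourier (-n) s := by
        simp only [fourier_apply, smul_add, AddCircle.toCircle_add, Circle.coe_mul]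
      rw [hF, this]
      simp only [smul_eq_mul]
      ring
    simp_rw [h2] at h1
    rw [MeasureTheory.integral_const_mul] at h1
    exact mul_right_cancel₀ hn (h1.trans (one_mul _).symm)
  intro z
  obtain ⟨s, rfl⟩ := (AddCircle.homeomorphCircle (T := 2 * Real.pi)
    Real.two_pi_pos.ne').surjective z
  have h1 := key s
  rw [AddCircle.homeomorphCircle_apply]
  have h2 : (fourier (-n) s : ℂ) * (AddCircle.toCircle s : ℂ) ^ n = 1 := by
    rw [fourier_apply, AddCircle.toCircle_zsmul, Circle.coe_zpow, ← zpow_add₀ (Circle.coe_ne_zero _)]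
    simp
  have h3 : (fourier (-n) s : ℂ) ≠ 0 := left_ne_zero_of_mul_eq_one h1
  exact mul_left_cancel₀ h3 (h1.trans h2.symm)

theorem exists_eq_prod_zpow_of_continuous {g : ℕ} (f : (Fin g → Circle) →* ℂ)
    (hf : Continuous f) : ∃ μ : Fin g → ℤ, ∀ z, f z = ∏ i, (z i : ℂ) ^ μ i := by
  have h : ∀ i, ∃ n : ℤ, ∀ w : Circle, f (Pi.mulSingle i w) = (w : ℂ) ^ n := fun i =>
    Circle.exists_eq_zpow_of_continuous (f.comp (MonoidHom.mulSingle (fun _ => Circle) i))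
      (hf.comp (continuous_mulSingle (A := fun _ : Fin g => Circle) i))
  choose μ hμ using h
  refine ⟨μ, fun z => ?_⟩
  conv_lhs => rw [← Finset.univ_prod_mulSingle z, map_prod]
  exact Finset.prod_congr rfl fun i _ => hμ i _

section torusRep

variable {g n : ℕ} (ρ : Representation ℂ (Fin g → Circle) (Fin n → ℂ))

theorem exists_norm_le_of_continuous (hρ : ∀ v, Continuous fun z => ρ z v) (v : Fin n → ℂ) :
    ∃ C, ∀ z, ‖ρ z v‖ ≤ C := by
  obtain ⟨C, hC⟩ := (isCompact_range (hρ v)).isBounded.exists_norm_le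
  exact ⟨C, fun z => hC _ ⟨z, rfl⟩⟩

/-- Orbits are bounded, the torus being compact, so the powers of an eigenvalue cannot grow. -/
theorem norm_le_one_of_apply_eq_smul (hρ : ∀ v, Continuous fun z => ρ z v) {v : Fin n → ℂ}
    (hv : v ≠ 0) {z : Fin g → Circle} {a : ℂ} (h : ρ z v = a • v) : ‖a‖ ≤ 1 := by
  by_contra! ha
  obtain ⟨C, hC⟩ := exists_norm_le_of_continuous ρ hρ v
  obtain ⟨k, hk⟩ := pow_unbounded_of_one_lt (C / ‖v‖) ha
  have h1 : ∀ k : ℕ, ρ (z ^ k) v = a ^ k • v := by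
    intro k
    induction k with
    | zero => simp
    | succ k ih =>
      rw [pow_succ, map_mul, Module.End.mul_apply, h, map_smul, ih, smul_smul, pow_succ,
        mul_comm]
  have h2 := hC (z ^ k)
  rw [h1, norm_smul, norm_pow] at h2
  rw [div_lt_iff₀ (norm_pos_iff.2 hv)] at hk
  linarith

theorem norm_eq_one_of_apply_eq_smul (hρ : ∀ v, Continuous fun z => ρ z v) {v : Fin n → ℂ}
    (hv : v ≠ 0) {z : Fin g → Circle} {a : ℂ} (h : ρ z v = a • v) : ‖a‖ = 1 := by
  refine le_antisymm (norm_le_one_of_apply_eq_smul ρ hρ hv h) ?_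
  have h1 : v = a • ρ z⁻¹ v := by
    rw [← map_smul, ← h, ← Module.End.mul_apply, ← map_mul]
    simp
  have ha : a ≠ 0 := by
    rintro rfl
    exact hv (by simpa using h1)
  have h2 : ρ z⁻¹ v = a⁻¹ • v := by
    conv_rhs => rw [h1]
    rw [smul_smul, inv_mul_cancel₀ ha, one_smul]
  have h3 := norm_le_one_of_apply_eq_smul ρ hρ hv h2
  rw [norm_inv] at h3
  exact (inv_le_one₀ (norm_pos_iff.2 ha)).1 h3

/-- A Jordan block of size two with an eigenvalue of modulus 1 would make the norm of ρ(z^k) v grow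
linearly in k, against boundedness of orbits. Hence every ρ(z) is diagonalisable, without averaging
an inner product. -/
theorem apply_eq_smul_of_apply_apply (hρ : ∀ v, Continuous fun z => ρ z v) {v : Fin n → ℂ}
    {z : Fin g → Circle} {a : ℂ} (h : ρ z (ρ z v - a • v) = a • (ρ z v - a • v)) :
    ρ z v - a • v = 0 := by
  by_contra hw
  set w := ρ z v - a • v with hw_def
  have ha := norm_eq_one_of_apply_eq_smul ρ hρ hw h
  have ha0 : a ≠ 0 := by
    rintro rfl
    simp at ha
  have hv : ρ z v = a • v + w := by rw [hw_def]; abel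
  have h1 : ∀ k : ℕ, ρ (z ^ k) v = a ^ k • v + (k * a ^ k * a⁻¹) • w := by
    intro k
    induction k with
    | zero => simp
    | succ k ih =>
      rw [pow_succ', map_mul, Module.End.mul_apply, ih, map_add, map_smul, map_smul, h, hv,
        smul_add, smul_smul, smul_smul, add_assoc, ← add_smul]
      congr 2
      push_cast
      field_simp
      ring
  obtain ⟨C, hC⟩ := exists_norm_le_of_continuous ρ hρ v
  obtain ⟨k, hk⟩ := exists_nat_gt ((C + ‖v‖) / ‖w‖)
  rw [div_lt_iff₀ (norm_pos_iff.2 hw)] at hk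
  have h2 : ‖((k : ℂ) * a ^ k * a⁻¹) • w‖ = k * ‖w‖ := by
    rw [norm_smul, norm_mul, norm_mul, norm_pow, norm_inv, ha]
    simp
  have h3 : ‖a ^ k • v‖ = ‖v‖ := by rw [norm_smul, norm_pow, ha]; simp
  have h4 : ((k : ℂ) * a ^ k * a⁻¹) • w = ρ (z ^ k) v - a ^ k • v := by rw [h1]; abel
  have h5 := norm_sub_le (ρ (z ^ k) v) (a ^ k • v)
  rw [← h4, h2, h3] at h5
  linarith [hC (z ^ k)]

theorem maxGenEigenspace_eq_eigenspace (hρ : ∀ v, Continuous fun z => ρ z v)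
    (z : Fin g → Circle) (a : ℂ) :
    Module.End.maxGenEigenspace (ρ z) a = Module.End.eigenspace (ρ z) a := by
  refine le_antisymm (fun v hv => ?_) (Module.End.eigenspace_le_maxGenEigenspace)
  obtain ⟨k, hk⟩ := (Module.End.mem_maxGenEigenspace _ _ _).1 hv
  have key : ∀ k (v : Fin n → ℂ), ((ρ z - a • (1 : Module.End ℂ (Fin n → ℂ))) ^ k) v = 0 →
      (ρ z - a • (1 : Module.End ℂ (Fin n → ℂ))) v = 0 := by
    intro k
    induction k with
    | zero => intro v hv; simp at hv; simp [hv]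
    | succ k ih =>
      intro v hv
      rw [pow_succ, Module.End.mul_apply] at hv
      have h1 := ih _ hv
      simp only [LinearMap.sub_apply, LinearMap.smul_apply, Module.End.one_apply] at h1 ⊢
      exact apply_eq_smul_of_apply_apply ρ hρ (sub_eq_zero.1 h1)
  have := key k v hk
  rw [Module.End.mem_eigenspace_iff]
  exact sub_eq_zero.1 this

theorem exists_weight_of_forall_eigen (hρ : ∀ v, Continuous fun z => ρ z v)
    {χ : (Fin g → Circle) → ℂ} {v : Fin n → ℂ} (hv : v ≠ 0) (h : ∀ z, ρ z v = χ z • v) :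
    ∃ μ : Fin g → ℤ, ∀ z, χ z = ∏ i, (z i : ℂ) ^ μ i := by
  obtain ⟨j, hj⟩ : ∃ j, v j ≠ 0 := by
    by_contra! h0
    exact hv (funext h0)
  have h0 : ∀ z, χ z * v j = (ρ z v) j := fun z => by rw [h]; rfl
  let f : (Fin g → Circle) →* ℂ :=
    { toFun := χ
      map_one' := by
        apply mul_right_cancel₀ hj
        rw [h0]; simp
      map_mul' := fun z w => by
        apply mul_right_cancel₀ hj
        rw [h0, map_mul, Module.End.mul_apply, h, map_smul, Pi.smul_apply, ← h0, smul_eq_mul]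
        ring }
  refine exists_eq_prod_zpow_of_continuous f ?_
  have : (f : (Fin g → Circle) → ℂ) = fun z => (ρ z v) j / v j := by
    ext z
    rw [← h0, mul_div_cancel_right₀ _ hj]
    rfl
  rw [this]
  exact ((continuous_apply j).comp (hρ v)).div_const _

/-- The trace of a continuous representation of a torus is a sum of characters `z ↦ z^μ` at which
there are eigenvectors. -/
theorem exists_trace_eq_sum (hρ : ∀ v, Continuous fun z => ρ z v) :
    ∃ m : (Fin g → ℤ) →₀ ℂ,
      (∀ μ ∈ m.support, ∃ v, v ≠ 0 ∧ ∀ z, ρ z v = (∏ i, (z i : ℂ) ^ μ i) • v) ∧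
      ∀ z, LinearMap.trace ℂ _ (ρ z) = m.sum fun μ c => c * ∏ i, (z i : ℂ) ^ μ i := by
  classical
  have hcomm : ∀ z w, Commute (ρ z) (ρ w) := fun z w => by
    rw [commute_iff_eq, ← map_mul, ← map_mul, mul_comm]
  have hmaps : ∀ z w a, Set.MapsTo (ρ z) (Module.End.maxGenEigenspace (ρ w) a)
      (Module.End.maxGenEigenspace (ρ w) a) := fun z w a =>
    Module.End.mapsTo_maxGenEigenspace_of_comm (hcomm w z) a
  -- The operators commute, so their generalised eigenspaces decompose the space simultaneously; the
  -- joint eigenvalues will be the weights.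
  have htop := Module.End.iSup_iInf_maxGenEigenspace_eq_top_of_forall_mapsTo
    (fun z => ρ z) hmaps (fun z => Module.End.iSup_maxGenEigenspace_eq_top _)
  have hind := Module.End.independent_iInf_maxGenEigenspace_of_forall_mapsTo (fun z => ρ z) hmaps
  set N : ((Fin g → Circle) → ℂ) → Submodule ℂ (Fin n → ℂ) :=
    fun χ => ⨅ z, Module.End.maxGenEigenspace (ρ z) (χ z) with hN
  have hmem : ∀ χ v, v ∈ N χ → ∀ z, ρ z v = χ z • v := by
    intro χ v hv z
    have := (Submodule.mem_iInf _).1 hv z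
    rw [maxGenEigenspace_eq_eigenspace ρ hρ] at this
    exact Module.End.mem_eigenspace_iff.1 this
  have hint : DirectSum.IsInternal N :=
    (DirectSum.isInternal_submodule_iff_iSupIndep_and_iSup_eq_top _).2 ⟨hind, htop⟩
  have hfin : {χ | N χ ≠ ⊥}.Finite := WellFoundedGT.finite_ne_bot_of_iSupIndep hind
  have hex : ∀ χ, N χ ≠ ⊥ → ∃ μ : Fin g → ℤ, (∀ z, χ z = ∏ i, (z i : ℂ) ^ μ i) ∧
      ∃ v, v ≠ 0 ∧ ∀ z, ρ z v = (∏ i, (z i : ℂ) ^ μ i) • v := by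
    intro χ hχ
    obtain ⟨v, hv, hv0⟩ := Submodule.exists_mem_ne_zero_of_ne_bot hχ
    obtain ⟨μ, hμ⟩ := exists_weight_of_forall_eigen ρ hρ hv0 (hmem χ v hv)
    exact ⟨μ, hμ, v, hv0, fun z => by rw [← hμ, hmem χ v hv]⟩
  choose! μ hμ hv using hex
  refine ⟨∑ χ ∈ hfin.toFinset, Finsupp.single (μ χ) (Module.finrank ℂ (N χ) : ℂ), ?_, ?_⟩
  · intro ν hν
    obtain ⟨χ, hχ, hν'⟩ := Finset.mem_biUnion.1 (Finsupp.support_finsetSum hν)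
    rw [Set.Finite.mem_toFinset] at hχ
    obtain rfl : ν = μ χ := Finset.mem_singleton.1 (Finsupp.support_single_subset hν')
    exact hv χ hχ
  · intro z
    have hNz : ∀ χ, Set.MapsTo (ρ z) (N χ) (N χ) := fun χ v hv => by
      rw [SetLike.mem_coe] at hv ⊢
      rw [hmem χ v hv]
      exact (N χ).smul_mem _ hv
    rw [LinearMap.trace_eq_sum_trace_restrict' hint hfin hNz, ← Finsupp.sum_finsetSum_index]
    · refine Finset.sum_congr rfl fun χ hχ => ?_
      rw [Set.Finite.mem_toFinset] at hχ
      rw [Finsupp.sum_single_index (by simp), ← hμ χ hχ]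
      have : (ρ z).restrict (hNz χ) = χ z • LinearMap.id := by
        ext v : 2
        exact hmem χ v v.2 z
      rw [this, map_smul, LinearMap.trace_id, smul_eq_mul, mul_comm]
    · simp
    · intro _ _ _
      ring

end torusRep

end

/-! ### Weyl group symmetry of characters. -/

section

open Matrix

namespace USp

variable {g : ℕ}

/-- The unitary symplectic matrix `(P, -Q; Q, P)` for real matrices `P`, `Q`. -/
def ofRealBlocks (P Q : Matrix (Fin g) (Fin g) ℂ) (hP : Pᴴ = Pᵀ) (hQ : Qᴴ = Qᵀ)
    (h1 : P * Pᵀ + Q * Qᵀ = 1) (h2 : P * Qᵀ = Q * Pᵀ) : USp g :=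
  ofMatrix (fromBlocks P (-Q) Q P)
    (by
      rw [mem_unitaryGroup_iff, star_eq_conjTranspose, fromBlocks_conjTranspose,
        fromBlocks_multiply, ← fromBlocks_one, conjTranspose_neg, hP, hQ]
      simp only [neg_mul_neg, Matrix.mul_neg, Matrix.neg_mul]
      rw [h1, h2, add_comm (Q * Qᵀ), h1]
      simp)
    (by
      rw [SymplecticGroup.mem_iff, J, fromBlocks_transpose, fromBlocks_multiply,
        fromBlocks_multiply, transpose_neg]
      simp only [Matrix.mul_zero, Matrix.mul_one, Matrix.mul_neg, Matrix.neg_mul, neg_neg,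
        zero_add, add_zero]
      rw [h1, h2, ← neg_add, add_comm (Q * Qᵀ), h1]
      simp)

theorem toMatrix_ofRealBlocks (P Q : Matrix (Fin g) (Fin g) ℂ) (hP : Pᴴ = Pᵀ) (hQ : Qᴴ = Qᵀ)
    (h1 : P * Pᵀ + Q * Qᵀ = 1) (h2 : P * Qᵀ = Q * Pᵀ) :
    toMatrix (ofRealBlocks P Q hP hQ h1 h2) = fromBlocks P (-Q) Q P := rfl

/-- With `exists_conj_torus_flip` this realises the Weyl group: permutation matrices permute the
coordinates of the torus, quarter turns in the planes of e_i and f_i invert them. -/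
theorem exists_conj_torus_comp (σ : Equiv.Perm (Fin g)) (z : Fin g → Circle) :
    ∃ y : USp g, y * torus z * y⁻¹ = torus (z ∘ σ) := by
  have hP : (σ.permMatrix ℂ)ᴴ = (σ.permMatrix ℂ)ᵀ := by
    simp [Matrix.conjTranspose_permMatrix, Matrix.transpose_permMatrix]
  refine ⟨ofRealBlocks (σ.permMatrix ℂ) 0 hP
    (by rw [conjTranspose_zero, transpose_zero]) ?_
    (by rw [transpose_zero, Matrix.mul_zero, Matrix.zero_mul]), ?_⟩
  · rw [transpose_permMatrix, ← permMatrix_mul]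
    simp
  · rw [mul_inv_eq_iff_eq_mul]
    apply toMatrix_injective
    rw [toMatrix_mul, toMatrix_mul, toMatrix_torus, toMatrix_torus,
      toMatrix_ofRealBlocks]
    ext i j
    rw [Matrix.mul_diagonal, Matrix.diagonal_mul]
    rcases i with i | i <;> rcases j with j | j <;>
      simp [PEquiv.toMatrix_apply, Equiv.Perm.permMatrix] <;>
      by_cases h : σ i = j <;> simp [h]

theorem exists_conj_torus_flip (d : Fin g → Prop) [DecidablePred d] (z : Fin g → Circle) :
    ∃ y : USp g, y * torus z * y⁻¹ = torus (fun i => if d i then (z i)⁻¹ else z i) := by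
  refine ⟨ofRealBlocks (diagonal fun i => if d i then 0 else 1)
    (diagonal fun i => if d i then 1 else 0) ?_ ?_ ?_ ?_, ?_⟩
  · rw [diagonal_conjTranspose, diagonal_transpose]
    congr 1
    ext i
    by_cases h : d i <;> simp [h]
  · rw [diagonal_conjTranspose, diagonal_transpose]
    congr 1
    ext i
    by_cases h : d i <;> simp [h]
  · rw [diagonal_transpose, diagonal_transpose, diagonal_mul_diagonal, diagonal_mul_diagonal,
      diagonal_add, ← diagonal_one]
    congr 1
    ext i
    by_cases h : d i <;> simp [h]
  · rw [diagonal_transpose, diagonal_transpose, diagonal_mul_diagonal, diagonal_mul_diagonal]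
    congr 1
    ext i
    by_cases h : d i <;> simp [h]
  · rw [mul_inv_eq_iff_eq_mul]
    apply toMatrix_injective
    rw [toMatrix_mul, toMatrix_mul, toMatrix_torus, toMatrix_torus,
      toMatrix_ofRealBlocks]
    ext i j
    rw [Matrix.mul_diagonal, Matrix.diagonal_mul]
    rcases i with i | i <;> rcases j with j | j <;>
      by_cases hij : i = j <;> by_cases h : d i <;> simp [hij, h] <;>
      (try (subst hij; simp [h]))

end USp

section monomials

variable {g : ℕ}

/-- The character `z ↦ z^μ` of the torus. -/
noncomputable def torusMonomial (μ : Fin g → ℤ) : (Fin g → Circle) →* ℂ where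
  toFun z := ∏ i, (z i : ℂ) ^ μ i
  map_one' := by simp
  map_mul' z w := by
    simp [mul_zpow, Finset.prod_mul_distrib]

theorem torusMonomial_apply (μ : Fin g → ℤ) (z : Fin g → Circle) :
    torusMonomial μ z = ∏ i, (z i : ℂ) ^ μ i := rfl

theorem torusMonomial_injective :
    Function.Injective (torusMonomial : (Fin g → ℤ) → (Fin g → Circle) →* ℂ) := by
  intro μ ν h
  ext i
  by_contra hne
  have h1 : ∀ w : Circle, (w : ℂ) ^ μ i = (w : ℂ) ^ ν i := by
    intro w
    have := DFunLike.congr_fun h (Pi.mulSingle i w)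
    rw [torusMonomial_apply, torusMonomial_apply, Finset.prod_eq_single i, Finset.prod_eq_single i]
      at this
    · simpa using this
    · intro j _ hj
      simp [Pi.mulSingle_eq_of_ne hj]
    · simp
    · intro j _ hj
      simp [Pi.mulSingle_eq_of_ne hj]
    · simp
  have h2 : ((μ i - ν i : ℤ) : ℝ) ≠ 0 := by
    exact_mod_cast sub_ne_zero.2 hne
  -- At this point the quotient of the two powers is exp(πi) = -1, while it should be 1.
  have h3 := h1 (Circle.exp (Real.pi / ((μ i - ν i : ℤ) : ℝ)))
  have h4 : (Circle.exp (Real.pi / ((μ i - ν i : ℤ) : ℝ))) ^ (μ i - ν i) = 1 := by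
    rw [_root_.zpow_sub, mul_inv_eq_one]
    exact Circle.ext (by rw [Circle.coe_zpow, Circle.coe_zpow, h3])
  rw [← Circle.exp_zsmul, zsmul_eq_mul, mul_div_cancel₀ _ h2] at h4
  have h5 := congrArg (fun z : Circle => (z : ℂ)) h4
  rw [Circle.coe_exp, Complex.exp_pi_mul_I] at h5
  norm_num at h5

theorem finsupp_eq_of_sum_torusMonomial_eq {m m' : (Fin g → ℤ) →₀ ℂ}
    (h : ∀ z, (m.sum fun μ c => c * torusMonomial μ z) =
      m'.sum fun μ c => c * torusMonomial μ z) : m = m' := by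
  have h1 : LinearIndependent ℂ
      (fun μ : Fin g → ℤ => (torusMonomial μ : (Fin g → Circle) → ℂ)) :=
    (linearIndependent_monoidHom (Fin g → Circle) ℂ).comp torusMonomial torusMonomial_injective
  apply h1
  ext z
  have := h z
  simp only [Finsupp.linearCombination_apply, Finsupp.sum, Finset.sum_apply, Pi.smul_apply,
    smul_eq_mul] at this ⊢
  exact this

/-- Distinct monomials are linearly independent (Dedekind), so a substitution that permutes the
monomials and leaves the trace unchanged preserves the multiplicities. -/
theorem apply_eq_of_sum_torusMonomial_comp_eq {m : (Fin g → ℤ) →₀ ℂ}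
    {φ : (Fin g → Circle) → Fin g → Circle} {ψ : (Fin g → ℤ) → Fin g → ℤ}
    (hψ : Function.Injective ψ)
    (h : ∀ z, (m.sum fun μ c => c * torusMonomial μ (φ z)) =
      m.sum fun μ c => c * torusMonomial μ z)
    (hφ : ∀ μ z, torusMonomial μ (φ z) = torusMonomial (ψ μ) z) (μ : Fin g → ℤ) :
    m (ψ μ) = m μ := by
  have : m.mapDomain ψ = m := by
    apply finsupp_eq_of_sum_torusMonomial_eq
    intro z
    rw [Finsupp.sum_mapDomain_index (by simp) (by intros; ring), ← h]
    simp only [hφ]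
  conv_lhs => rw [← this]
  exact Finsupp.mapDomain_apply hψ _ _

end monomials

theorem exists_perm_comp_eq {g : ℕ} {μ ν : Fin g → ℤ} (hμ : ∀ i, μ i = 0 ∨ μ i = 1)
    (hν : ∀ i, ν i = 0 ∨ ν i = 1) (h : ∑ i, (μ i).natAbs = ∑ i, (ν i).natAbs) :
    ∃ σ : Equiv.Perm (Fin g), ν ∘ σ = μ := by
  classical
  have hcard : ∀ ξ : Fin g → ℤ, (∀ i, ξ i = 0 ∨ ξ i = 1) →
      Fintype.card {i // ξ i = 1} = ∑ i, (ξ i).natAbs := by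
    intro ξ hξ
    rw [Fintype.card_subtype, Finset.card_filter]
    refine Finset.sum_congr rfl fun i _ => ?_
    rcases hξ i with h | h <;> simp [h]
  have e : {i // μ i = 1} ≃ {i // ν i = 1} :=
    Fintype.equivOfCardEq (by rw [hcard μ hμ, hcard ν hν, h])
  refine ⟨e.extendSubtype, funext fun i => ?_⟩
  rcases hμ i with h0 | h1
  · have := e.extendSubtype_not_mem i (by simp [h0])
    rw [h0]
    exact (hν _).resolve_right this
  · rw [h1]
    exact e.extendSubtype_mem i h1

/-- If all weights of a continuous representation have first coordinate at most `1`, then the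
character is a combination of the functions `s_k`. -/
theorem exists_character_eq_sum_sCoeff {g n : ℕ} (ρ : Representation ℂ (USp g) (Fin n → ℂ))
    (hρ : ∀ v, Continuous fun x => ρ x v)
    (hw : ∀ μ, IsWeight ρ μ → ∀ i : Fin g, (i : ℕ) = 0 → μ i ≤ 1) :
    ∃ M : ℕ → ℂ, ∀ x, ρ.character x =
      ∑ k ∈ Finset.range (g + 1), M k * sCoeff g k x := by
  classical
  let τ : (Fin g → Circle) →* USp g :=
    { toFun := USp.torus, map_one' := USp.torus_one, map_mul' := USp.torus_mul }
  obtain ⟨m, hm, htr⟩ := exists_trace_eq_sum (ρ.comp τ)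
    (fun v => (hρ v).comp USp.continuous_torus)
  have htr' : ∀ z, ρ.character (USp.torus z) = m.sum fun μ c => c * torusMonomial μ z := htr
  have hperm : ∀ (σ : Equiv.Perm (Fin g)) μ, m (μ ∘ σ) = m μ := by
    intro σ
    refine apply_eq_of_sum_torusMonomial_comp_eq (φ := fun z => z ∘ σ.symm)
      (ψ := fun μ => μ ∘ σ) σ.surjective.injective_comp_right (fun z => ?_) (fun μ z => ?_)
    · obtain ⟨y, hy⟩ := USp.exists_conj_torus_comp σ.symm z
      rw [← htr', ← htr', ← hy, Representation.char_conj]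
    · rw [torusMonomial_apply, torusMonomial_apply, ← Equiv.prod_comp σ]
      simp
  have hflip : ∀ (d : Fin g → Prop) [DecidablePred d] μ,
      m (fun i => if d i then -μ i else μ i) = m μ := by
    intro d _
    refine apply_eq_of_sum_torusMonomial_comp_eq (φ := fun z i => if d i then (z i)⁻¹ else z i)
      (ψ := fun μ i => if d i then -μ i else μ i) (fun μ ν h => ?_) (fun z => ?_) (fun μ z => ?_)
    · ext i
      have := congrFun h i
      by_cases hi : d i <;> simpa [hi] using this
    · obtain ⟨y, hy⟩ := USp.exists_conj_torus_flip d z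
      rw [← htr', ← htr', ← hy, Representation.char_conj]
    · rw [torusMonomial_apply, torusMonomial_apply]
      refine Finset.prod_congr rfl fun i _ => ?_
      by_cases hi : d i <;> simp [hi]
  have habs : ∀ μ : Fin g → ℤ, m (fun i => |μ i|) = m μ := by
    intro μ
    rw [← hflip (fun i => μ i < 0) μ]
    congr 1
    ext i
    split_ifs with h
    · exact abs_of_neg h
    · exact abs_of_nonneg (not_lt.1 h)
  -- Making all entries nonnegative and moving the i-th to the front stays in the Weyl orbit, so the
  -- bound on first coordinates bounds them all.
  have hsupp : ∀ μ, m μ ≠ 0 → ∀ i, |μ i| ≤ 1 := by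
    intro μ hμ i
    have hg : 0 < g := i.pos
    have h1 := hm ((fun i => |μ i|) ∘ Equiv.swap i ⟨0, hg⟩)
      (by rw [Finsupp.mem_support_iff, hperm, habs]; exact hμ)
    simpa using hw _ h1 ⟨0, hg⟩ rfl
  -- On vectors with entries in {-1, 0, 1} a Weyl orbit is determined by the number k of nonzero
  -- entries; ϖ_k represents it.
  let M : ℕ → ℂ := fun k => m (fun i => if (i : ℕ) < k then 1 else 0)
  have hM : ∀ μ : Fin g → ℤ, (∀ i, |μ i| ≤ 1) → m μ = M (∑ i, (μ i).natAbs) := by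
    intro μ hμ
    have h0 : ∑ i, (μ i).natAbs ≤ g := by
      calc ∑ i, (μ i).natAbs ≤ ∑ _i : Fin g, 1 := by
            refine Finset.sum_le_sum fun i _ => ?_
            have := abs_le.1 (hμ i)
            omega
        _ = g := by simp
    obtain ⟨σ, hσ⟩ := exists_perm_comp_eq (μ := fun i => |μ i|)
      (ν := fun i => if (i : ℕ) < ∑ i, (μ i).natAbs then 1 else 0)
      (fun i => by have := hμ i; have := abs_nonneg (μ i); omega)
      (fun i => by split_ifs <;> simp) (by
        simp only [Int.natAbs_abs, apply_ite Int.natAbs, Int.natAbs_one, Int.natAbs_zero]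
        rw [Finset.sum_boole, Fin.card_filter_val_lt]
        simp [h0])
    rw [← habs, ← hσ, hperm]
  refine ⟨M, fun x => ?_⟩
  obtain ⟨y, z, rfl⟩ := USp.exists_eq_conj_torus x
  rw [Representation.char_conj, htr', Finset.sum_congr rfl fun k hk => by
    rw [USp.sCoeff_conj_torus y z (Nat.lt_succ_iff.1 (Finset.mem_range.1 hk))],
    ← sum_piFinset_prod_zpow]
  have hbox : ∀ μ : Fin g → ℤ, μ ∈ Fintype.piFinset (fun _ : Fin g => ({-1, 0, 1} : Finset ℤ)) ↔
      ∀ i, |μ i| ≤ 1 := by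
    intro μ
    rw [Fintype.mem_piFinset]
    refine forall_congr' fun i => ?_
    simp only [Finset.mem_insert, Finset.mem_singleton]
    rw [abs_le]
    omega
  rw [Finsupp.sum_of_support_subset m (s := Fintype.piFinset fun _ => {-1, 0, 1})]
  · refine Finset.sum_congr rfl fun μ hμ => ?_
    rw [hM μ ((hbox μ).1 hμ)]
    rfl
  · intro μ hμ
    rw [hbox]
    exact hsupp μ (Finsupp.mem_support_iff.1 hμ)
  · simp

end

/-! ### Alternating forms and the Lefschetz operators. -/

section

open Matrix

/-- The alternating `n`-forms on `ℂ^(2g)`. -/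
abbrev AltForm (g n : ℕ) : Type := (Fin g ⊕ Fin g → ℂ) [⋀^Fin n]→ₗ[ℂ] ℂ

/-- Normal ordering of two annihilators and two creators that belong to the same pair of indices;
the primed version is for different pairs. -/
theorem mul_mul_mul_of_anticomm {R : Type*} [Ring R] {A B D E : R} (h1 : B * E = 1 - E * B)
    (h2 : B * D = -(D * B)) (h3 : A * E = -(E * A)) (h4 : A * D = 1 - D * A) :
    A * B * (E * D) = E * D * (A * B) + (1 - E * B - D * A) := by
  calc A * B * (E * D) = A * (B * E) * D := by simp only [mul_assoc]
    _ = A * D - (A * E) * (B * D) := by rw [h1]; noncomm_ring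
    _ = A * D - E * (A * D) * B := by rw [h3, h2]; noncomm_ring
    _ = E * D * (A * B) + (1 - E * B - D * A) := by rw [h4]; noncomm_ring

theorem mul_mul_mul_of_anticomm' {R : Type*} [Ring R] {A B D E : R} (h1 : B * E = -(E * B))
    (h2 : B * D = -(D * B)) (h3 : A * E = -(E * A)) (h4 : A * D = -(D * A)) :
    A * B * (E * D) = E * D * (A * B) := by
  calc A * B * (E * D) = A * (B * E) * D := by simp only [mul_assoc]
    _ = -((A * E) * (B * D)) := by rw [h1]; noncomm_ring
    _ = -(E * (A * D) * B) := by rw [h3, h2]; noncomm_ring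
    _ = E * D * (A * B) := by rw [h4]; noncomm_ring

namespace AltForm

variable {g : ℕ}

/-- The standard basis vectors of `ℂ^(2g)`. -/
def stdVec (a : Fin g ⊕ Fin g) : Fin g ⊕ Fin g → ℂ := Pi.single a 1

/-- The coordinates on `ℂ^(2g)`. -/
def coord (a : Fin g ⊕ Fin g) : (Fin g ⊕ Fin g → ℂ) →ₗ[ℂ] ℂ := LinearMap.proj a

theorem coord_stdVec (a b : Fin g ⊕ Fin g) :
    coord a (stdVec b) = if a = b then 1 else 0 := by
  simp [coord, stdVec, Pi.single_apply]

theorem sum_coe_apply {ι : Type*} (s : Finset ι) {n : ℕ} (φ : ι → AltForm g n)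
    (v : Fin n → Fin g ⊕ Fin g → ℂ) : (∑ i ∈ s, φ i) v = ∑ i ∈ s, φ i v :=
  map_sum (⟨⟨fun ψ : AltForm g n => ψ v, rfl⟩, fun _ _ => rfl⟩ : AltForm g n →+ ℂ) φ s

/-- Insertion of a vector into an alternating form. -/
def contractVec (n : ℕ) (y : Fin g ⊕ Fin g → ℂ) : AltForm g (n + 1) →ₗ[ℂ] AltForm g n :=
  (LinearMap.applyₗ y) ∘ₗ AlternatingMap.curryLeftLinearMap

theorem contractVec_apply {n : ℕ} (y : Fin g ⊕ Fin g → ℂ) (φ : AltForm g (n + 1))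
    (v : Fin n → Fin g ⊕ Fin g → ℂ) : contractVec n y φ v = φ (vecCons y v) := rfl

/-- Exterior multiplication of an alternating form by a linear form. -/
noncomputable def wedgeForm (n : ℕ) (l : (Fin g ⊕ Fin g → ℂ) →ₗ[ℂ] ℂ) :
    AltForm g n →ₗ[ℂ] AltForm g (n + 1) :=
  AlternatingMap.alternatizeUncurryFinLM ∘ₗ LinearMap.smulRightₗ l

theorem wedgeForm_apply {n : ℕ} (l : (Fin g ⊕ Fin g → ℂ) →ₗ[ℂ] ℂ) (φ : AltForm g n)
    (v : Fin (n + 1) → Fin g ⊕ Fin g → ℂ) :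
    wedgeForm n l φ v = ∑ p : Fin (n + 1), (-1) ^ (p : ℕ) * (l (v p) * φ (p.removeNth v)) := by
  simp [wedgeForm, AlternatingMap.alternatizeUncurryFin_apply]

theorem contractVec_wedgeForm_zero (y : Fin g ⊕ Fin g → ℂ) (l : (Fin g ⊕ Fin g → ℂ) →ₗ[ℂ] ℂ)
    (φ : AltForm g 0) : contractVec 0 y (wedgeForm 0 l φ) = l y • φ := by
  ext v
  rw [contractVec_apply, wedgeForm_apply]
  rw [Fin.sum_univ_one, AlternatingMap.smul_apply,
    Subsingleton.elim v (Fin.removeNth 0 (vecCons y v))]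
  simp

theorem contractVec_wedgeForm_succ (n : ℕ) (y : Fin g ⊕ Fin g → ℂ)
    (l : (Fin g ⊕ Fin g → ℂ) →ₗ[ℂ] ℂ) (φ : AltForm g (n + 1)) :
    contractVec (n + 1) y (wedgeForm (n + 1) l φ) =
      l y • φ - wedgeForm n l (contractVec n y φ) := by
  ext v
  rw [contractVec_apply, wedgeForm_apply, Fin.sum_univ_succ, AlternatingMap.sub_apply,
    AlternatingMap.smul_apply, wedgeForm_apply, sub_eq_add_neg, ← Finset.sum_neg_distrib]
  congr 1
  · simp only [Fin.val_zero, pow_zero, one_mul, cons_val_zero, smul_eq_mul]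
    rfl
  · refine Finset.sum_congr rfl fun p _ => ?_
    have h : p.succ.removeNth (vecCons y v) = vecCons y (p.removeNth v) := by
      ext i : 1
      refine Fin.cases ?_ (fun i => ?_) i
      · simp [Fin.removeNth]
      · simp [Fin.removeNth, Fin.succ_succAbove_succ]
    rw [h, contractVec_apply]
    simp [pow_succ]

theorem sum_wedgeForm_contractVec (n : ℕ) (φ : AltForm g (n + 1)) :
    ∑ a, wedgeForm n (coord a) (contractVec n (stdVec a) φ) = ((n : ℂ) + 1) • φ := by
  ext v
  rw [AltForm.sum_coe_apply]
  simp_rw [wedgeForm_apply, contractVec_apply]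
  rw [Finset.sum_comm]
  have h : ∀ p : Fin (n + 1), ∑ a, (-1) ^ (p : ℕ) * (coord a (v p) *
      φ (vecCons (stdVec a) (p.removeNth v))) = φ v := by
    intro p
    rw [← Finset.mul_sum]
    have h1 : ∑ a, coord a (v p) * φ (vecCons (stdVec a) (p.removeNth v)) =
        φ (vecCons (v p) (p.removeNth v)) := by
      have h2 : v p = ∑ a, coord a (v p) • stdVec a := by
        ext b
        simp [coord, stdVec, Finset.sum_apply, Pi.single_apply]
      conv_rhs => rw [← AlternatingMap.curryLeft_apply_apply, h2, map_sum, AltForm.sum_coe_apply]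
      exact Finset.sum_congr rfl fun a _ => by rw [map_smul]; rfl
    rw [h1, ← AlternatingMap.neg_one_pow_smul_map_insertNth, Fin.insertNth_self_removeNth,
      zsmul_eq_mul, ← mul_assoc]
    push_cast
    rw [← pow_add, Even.neg_one_pow ⟨_, rfl⟩, one_mul]
  simp_rw [h]
  simp [AlternatingMap.smul_apply]

/-- The contraction of an alternating form with the symplectic bivector `∑ e_i ∧ f_i`. -/
def contract (g n : ℕ) : AltForm g (n + 2) →ₗ[ℂ] AltForm g n :=
  ∑ i : Fin g, contractVec n (stdVec (Sum.inr i)) ∘ₗ contractVec (n + 1) (stdVec (Sum.inl i))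

theorem contract_apply {n : ℕ} (φ : AltForm g (n + 2)) (v : Fin n → Fin g ⊕ Fin g → ℂ) :
    contract g n φ v =
      ∑ i : Fin g, φ (vecCons (stdVec (Sum.inl i)) (vecCons (stdVec (Sum.inr i)) v)) := by
  simp [contract, LinearMap.sum_apply, AltForm.sum_coe_apply, contractVec_apply]

end AltForm

/-- The product of the spaces of alternating forms of all degrees. -/
abbrev AltFock (g : ℕ) : Type := ∀ n, AltForm g n

namespace AltFock

open AltForm

variable {g : ℕ}

/-- The annihilation operators. -/
noncomputable def ann (a : Fin g ⊕ Fin g) : Module.End ℂ (AltFock g) :=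
  LinearMap.pi fun n => contractVec n (stdVec a) ∘ₗ LinearMap.proj (n + 1)

/-- The creation operators. -/
noncomputable def cre (a : Fin g ⊕ Fin g) : Module.End ℂ (AltFock g) :=
  LinearMap.pi fun n => match n with
    | 0 => 0
    | n + 1 => wedgeForm n (coord a) ∘ₗ LinearMap.proj n

theorem ann_apply (a : Fin g ⊕ Fin g) (φ : AltFock g) (n : ℕ) :
    ann a φ n = contractVec n (stdVec a) (φ (n + 1)) := rfl

theorem cre_apply_zero (a : Fin g ⊕ Fin g) (φ : AltFock g) : cre a φ 0 = 0 := rfl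

theorem cre_apply_succ (a : Fin g ⊕ Fin g) (φ : AltFock g) (n : ℕ) :
    cre a φ (n + 1) = wedgeForm n (coord a) (φ n) := rfl

/-- The canonical anticommutation relations: insertion of a vector is an antiderivation. -/
theorem ann_mul_cre (a b : Fin g ⊕ Fin g) :
    ann a * cre b = (if b = a then 1 else 0) - cre b * ann a := by
  refine LinearMap.ext fun φ => funext fun n => ?_
  have h : ((if b = a then 1 else 0 : Module.End ℂ (AltFock g)) φ) n =
      (if b = a then (1 : ℂ) else 0) • φ n := by
    split_ifs <;> simp
  rw [LinearMap.sub_apply, Pi.sub_apply, h, Module.End.mul_apply, Module.End.mul_apply, ann_apply,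
    cre_apply_succ, ← coord_stdVec]
  cases n with
  | zero => rw [contractVec_wedgeForm_zero, cre_apply_zero, sub_zero]
  | succ n => rw [contractVec_wedgeForm_succ, cre_apply_succ, ann_apply]

/-- The number operator. -/
noncomputable def num (g : ℕ) : Module.End ℂ (AltFock g) := ∑ a, cre a * ann a

theorem num_apply (φ : AltFock g) (n : ℕ) : num g φ n = (n : ℂ) • φ n := by
  rw [num, LinearMap.sum_apply, Finset.sum_apply]
  cases n with
  | zero => simp [Module.End.mul_apply, cre_apply_zero]
  | succ n =>
    simp only [Module.End.mul_apply, cre_apply_succ, ann_apply]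
    rw [sum_wedgeForm_contractVec]
    push_cast
    rfl

/-- The lowering operator of the Lefschetz triple. -/
noncomputable def lower (g : ℕ) : Module.End ℂ (AltFock g) :=
  ∑ i : Fin g, ann (Sum.inr i) * ann (Sum.inl i)

/-- The raising operator of the Lefschetz triple. -/
noncomputable def raise (g : ℕ) : Module.End ℂ (AltFock g) :=
  ∑ i : Fin g, cre (Sum.inl i) * cre (Sum.inr i)

theorem lower_apply (φ : AltFock g) (n : ℕ) : lower g φ n = contract g n (φ (n + 2)) := by
  rw [lower, contract, LinearMap.sum_apply, Finset.sum_apply, LinearMap.sum_apply]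
  rfl

theorem ann_ann_mul_cre_cre (i k : Fin g) :
    ann (Sum.inr i) * ann (Sum.inl i) * (cre (Sum.inl k) * cre (Sum.inr k)) =
      cre (Sum.inl k) * cre (Sum.inr k) * (ann (Sum.inr i) * ann (Sum.inl i)) +
      if i = k then 1 - cre (Sum.inl i) * ann (Sum.inl i) - cre (Sum.inr i) * ann (Sum.inr i)
      else 0 := by
  have h1 := ann_mul_cre (g := g) (Sum.inl i) (Sum.inl k)
  have h2 := ann_mul_cre (g := g) (Sum.inl i) (Sum.inr k)
  have h3 := ann_mul_cre (g := g) (Sum.inr i) (Sum.inl k)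
  have h4 := ann_mul_cre (g := g) (Sum.inr i) (Sum.inr k)
  simp only [Sum.inl.injEq, Sum.inr.injEq, reduceCtorEq, if_false, zero_sub] at h1 h2 h3 h4
  set A := ann (g := g) (Sum.inr i)
  set B := ann (g := g) (Sum.inl i)
  set D := cre (g := g) (Sum.inr k)
  set E := cre (g := g) (Sum.inl k)
  by_cases hik : i = k
  · subst hik
    rw [if_pos rfl] at h1 h4
    rw [if_pos rfl]
    exact mul_mul_mul_of_anticomm h1 h2 h3 h4
  · rw [if_neg (Ne.symm hik), zero_sub] at h1 h4
    rw [if_neg hik, add_zero]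
    exact mul_mul_mul_of_anticomm' h1 h2 h3 h4

/-- The sl₂ relation: only terms with equal indices fail to commute, and their corrections add up to
g minus the degree. -/
theorem lower_mul_raise : lower g * raise g = raise g * lower g + ((g : ℂ) • 1 - num g) := by
  have h1 : ((g : ℂ) • 1 - num g : Module.End ℂ (AltFock g)) = ∑ i : Fin g,
      (1 - cre (Sum.inl i) * ann (Sum.inl i) - cre (Sum.inr i) * ann (Sum.inr i)) := by
    rw [num, Fintype.sum_sum_type, Finset.sum_sub_distrib, Finset.sum_sub_distrib]
    simp only [Finset.sum_const, Finset.card_univ, Fintype.card_fin]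
    rw [sub_add_eq_sub_sub, Nat.cast_smul_eq_nsmul]
  rw [h1, lower, raise, Finset.sum_mul_sum, Finset.sum_mul_sum, Finset.sum_comm (f := fun i j =>
    cre (Sum.inl i) * cre (Sum.inr i) * (ann (Sum.inr j) * ann (Sum.inl j))),
    ← Finset.sum_add_distrib]
  refine Finset.sum_congr rfl fun i _ => ?_
  simp_rw [ann_ann_mul_cre_cre]
  rw [Finset.sum_add_distrib]
  simp

theorem lower_num (φ : AltFock g) {n : ℕ} (h : num g φ = ((n : ℂ) + 2) • φ) :
    num g (lower g φ) = (n : ℂ) • lower g φ := by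
  ext1 k
  rw [num_apply, Pi.smul_apply, lower_apply]
  have h1 := congrFun h (k + 2)
  rw [num_apply, Pi.smul_apply, ← sub_eq_zero, ← sub_smul] at h1
  rw [← sub_eq_zero, ← sub_smul, ← map_smul]
  push_cast at h1
  rw [show (k : ℂ) - n = k + 2 - (n + 2) by ring, h1, map_zero]

theorem lower_eq_zero (φ : AltFock g) {n : ℕ} (hn : n < 2) (h : num g φ = (n : ℂ) • φ) :
    lower g φ = 0 := by
  ext1 k
  rw [lower_apply]
  have h1 := congrFun h (k + 2)
  rw [num_apply, Pi.smul_apply, ← sub_eq_zero, ← sub_smul, smul_eq_zero] at h1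
  rw [h1.resolve_left, map_zero, Pi.zero_apply]
  rw [sub_eq_zero]
  intro h2
  have : k + 2 = n := by exact_mod_cast h2
  omega

/-- LΛ has no negative eigenvalue in degrees below g. If LΛφ = -cφ, the commutator makes Λφ an
eigenvector, or zero, of LΛ in degree n - 2 with the still more negative eigenvalue -(c + g - (n -
2)). Induction on the degree gives Λφ = 0, and then cφ = 0. -/
theorem eq_zero_of_raise_lower_eq (n : ℕ) : ∀ (φ : AltFock g) (c : ℝ), 0 < c → n < g →
    num g φ = (n : ℂ) • φ → raise g (lower g φ) = (-c : ℂ) • φ → φ = 0 := by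
  induction n using Nat.strong_induction_on with
  | _ n ih =>
  intro φ c hc hn hφ h
  have hc' : (-c : ℂ) ≠ 0 := by
    rw [neg_ne_zero]
    exact_mod_cast hc.ne'
  suffices hl : lower g φ = 0 by
    rw [hl, map_zero] at h
    exact (smul_eq_zero.1 h.symm).resolve_left hc'
  rcases Nat.lt_or_ge n 2 with h2 | h2
  · exact lower_eq_zero φ h2 hφ
  obtain ⟨k, rfl⟩ : ∃ k, n = k + 2 := ⟨n - 2, by omega⟩
  push_cast at hφ
  have h3 := lower_num φ hφ
  refine ih k (by omega) (lower g φ) (c + g - k) ?_ (by omega) h3 ?_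
  · have : (k : ℝ) + 2 < g := by exact_mod_cast hn
    linarith
  · have h4 := LinearMap.congr_fun (lower_mul_raise (g := g)) (lower g φ)
    simp only [Module.End.mul_apply, LinearMap.add_apply, LinearMap.sub_apply,
      LinearMap.smul_apply, Module.End.one_apply] at h4
    rw [h, map_smul, h3] at h4
    rw [← sub_eq_iff_eq_add] at h4
    rw [← h4, ← sub_smul, ← sub_smul]
    push_cast
    congr 1
    ring

theorem eq_zero_of_lower_raise_eq_zero {n : ℕ} (hn : n < g) {φ : AltFock g}
    (hφ : num g φ = (n : ℂ) • φ) (h : lower g (raise g φ) = 0) : φ = 0 := by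
  refine eq_zero_of_raise_lower_eq n φ (g - n) ?_ hn hφ ?_
  · have : (n : ℝ) < g := by exact_mod_cast hn
    linarith
  · have h4 := LinearMap.congr_fun (lower_mul_raise (g := g)) φ
    simp only [Module.End.mul_apply, LinearMap.add_apply, LinearMap.sub_apply,
      LinearMap.smul_apply, Module.End.one_apply] at h4
    rw [h, hφ, ← sub_smul] at h4
    rw [eq_neg_of_add_eq_zero_left h4.symm]
    push_cast
    rw [neg_smul]

end AltFock

namespace AltForm

open AltFock

variable {g : ℕ}

instance (g n : ℕ) : FiniteDimensional ℂ (AltForm g n) :=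
  Module.Finite.equiv (exteriorPower.alternatingMapLinearEquiv (R := ℂ) (n := n)
    (M := Fin g ⊕ Fin g → ℂ) (N := ℂ)).symm

/-- ΛL is an endomorphism of the finite-dimensional space of n-forms. It is injective, since ΛLφ = 0
would mean LΛφ = -(g - n)φ. Hence it is surjective, and so is Λ. -/
theorem contract_surjective {n : ℕ} (hn : n < g) :
    Function.Surjective (contract g n) := by
  let L : AltForm g n →ₗ[ℂ] AltForm g (n + 2) :=
    LinearMap.proj (n + 2) ∘ₗ raise g ∘ₗ LinearMap.single ℂ (AltForm g) n
  have hinj : Function.Injective (contract g n ∘ₗ L) := by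
    rw [injective_iff_map_eq_zero]
    intro φ hφ
    have hnum : num g (Pi.single n φ) = (n : ℂ) • (Pi.single n φ : AltFock g) := by
      ext1 k
      rw [num_apply, Pi.smul_apply]
      by_cases hk : k = n
      · rw [hk]
      · rw [Pi.single_eq_of_ne hk, smul_zero, smul_zero]
    have h0 : lower g (raise g (Pi.single n φ)) = 0 := by
      ext1 k
      by_cases hk : k = n
      · subst hk
        rw [lower_apply]
        exact hφ
      · have h4 := LinearMap.congr_fun (lower_mul_raise (g := g)) (Pi.single n φ)
        have h5 := congrFun h4 k
        simp only [Module.End.mul_apply, LinearMap.add_apply, LinearMap.sub_apply,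
          LinearMap.smul_apply, Module.End.one_apply, Pi.add_apply, Pi.sub_apply, Pi.smul_apply,
          num_apply, Pi.single_eq_of_ne hk, smul_zero, sub_zero, add_zero] at h5
        rw [h5]
        have h6 : ∀ ψ : AltFock g, (ψ : AltFock g) (k - 2) = 0 → raise g ψ k = 0 := by
          intro ψ hψ
          rw [raise, LinearMap.sum_apply, Finset.sum_apply]
          refine Finset.sum_eq_zero fun i _ => ?_
          rw [Module.End.mul_apply]
          match k, hψ with
          | 0, _ => rfl
          | 1, _ => rw [cre_apply_succ, cre_apply_zero, map_zero]
          | k + 2, hψ =>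
            rw [cre_apply_succ, cre_apply_succ]
            rw [show k + 2 - 2 = k by omega] at hψ
            rw [hψ, map_zero, map_zero]
        -- As k ≠ n, equality can only come from truncated subtraction, that is k < 2, and there L
        -- has no component.
        by_cases hk2 : k - 2 + 2 = n
        · have hk3 : k < 2 := by omega
          rw [raise, LinearMap.sum_apply, Finset.sum_apply]
          refine Finset.sum_eq_zero fun i _ => ?_
          rw [Module.End.mul_apply]
          match k, hk3 with
          | 0, _ => rfl
          | 1, _ => rw [cre_apply_succ, cre_apply_zero, map_zero]
        · apply h6
          rw [lower_apply, Pi.single_eq_of_ne hk2, map_zero]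
    have := eq_zero_of_lower_raise_eq_zero hn hnum h0
    exact Pi.single_eq_zero_iff.1 this
  have hsurj := LinearMap.injective_iff_surjective.1 hinj
  intro φ
  obtain ⟨ψ, hψ⟩ := hsurj φ
  exact ⟨L ψ, hψ⟩

end AltForm

end

/-! ### Primitive forms and their characters. -/

section

open Matrix

/-- The trace of an endomorphism of a short exact sequence is additive. -/
theorem LinearMap.trace_eq_trace_restrict_ker_add {K A B : Type*} [Field K] [AddCommGroup A]
    [Module K A] [FiniteDimensional K A] [AddCommGroup B] [Module K B] [FiniteDimensional K B]
    {f : A →ₗ[K] B} (hf : Function.Surjective f) {a : Module.End K A} {b : Module.End K B}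
    (hab : ∀ x, f (a x) = b (f x)) (ha : ∀ x ∈ LinearMap.ker f, a x ∈ LinearMap.ker f) :
    LinearMap.trace K A a =
      LinearMap.trace K (LinearMap.ker f) (a.restrict ha) + LinearMap.trace K B b := by
  obtain ⟨s, hs⟩ := LinearMap.exists_rightInverse_of_surjective f (LinearMap.range_eq_top.2 hf)
  have hs' : ∀ y, f (s y) = y := LinearMap.congr_fun hs
  let e : (LinearMap.ker f × B) ≃ₗ[K] A :=
    LinearEquiv.ofBijective ((LinearMap.ker f).subtype.coprod s) (by
      constructor
      · rw [injective_iff_map_eq_zero]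
        rintro ⟨w, y⟩ h
        have h1 : (w : A) + s y = 0 := by simpa using h
        have h2 : y = 0 := by
          have := congrArg f h1
          rwa [map_add, hs', LinearMap.mem_ker.1 w.2, zero_add, map_zero] at this
        rw [h2, map_zero, add_zero] at h1
        exact Prod.ext (Subtype.ext h1) h2
      · intro x
        refine ⟨(⟨x - s (f x), by rw [LinearMap.mem_ker, map_sub, hs', sub_self]⟩, f x), ?_⟩
        simp)
  have he : ∀ p, e p = (p.1 : A) + s p.2 := fun p => rfl
  have hmem : ∀ y, a (s y) - s (b y) ∈ LinearMap.ker f := fun y => by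
    rw [LinearMap.mem_ker, map_sub, hab, hs', hs', sub_self]
  let n : B →ₗ[K] LinearMap.ker f := LinearMap.codRestrict _ (a ∘ₗ s - s ∘ₗ b) hmem
  -- In a splitting of the sequence the endomorphism is block triangular; the off-diagonal block has
  -- trace 0 by cyclicity.
  have key : e.symm.conj a = LinearMap.prodMap (a.restrict ha) b +
      LinearMap.inl K _ _ ∘ₗ (n ∘ₗ LinearMap.snd K _ _) := by
    refine LinearMap.ext fun p => ?_
    rw [LinearEquiv.conj_apply_apply, LinearEquiv.symm_symm, LinearEquiv.symm_apply_eq, he, he,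
      map_add]
    simp only [LinearMap.add_apply, LinearMap.prodMap_apply, LinearMap.comp_apply,
      LinearMap.inl_apply, LinearMap.snd_apply, Prod.fst_add, Prod.snd_add, add_zero,
      Submodule.coe_add, LinearMap.coe_restrict_apply]
    have : ((n p.2 : LinearMap.ker f) : A) = a (s p.2) - s (b p.2) := rfl
    rw [this]
    abel
  rw [← LinearMap.trace_conj' a e.symm, key, map_add, LinearMap.trace_prodMap',
    LinearMap.trace_comp_comm', LinearMap.comp_assoc, LinearMap.snd_comp_inl, LinearMap.comp_zero,
    map_zero, add_zero]

namespace AltForm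

variable {g : ℕ}

/-- The action of `USp(2g)` on alternating forms. -/
def altRep (g n : ℕ) : Representation ℂ (USp g) (AltForm g n) where
  toFun x :=
    -- The transpose gives a left action in which the torus multiplies the coordinate belonging to
    -- e_i by z_i rather than z_i⁻¹.
    { toFun := fun φ => φ.compLinearMap (USp.toMatrix x)ᵀ.mulVecLin
      map_add' := fun φ ψ => AlternatingMap.add_compLinearMap _ _ _
      map_smul' := fun c φ => rfl }
  map_one' := by
    ext φ v
    simp
  map_mul' x y := by
    ext φ v
    simp [transpose_mul]

theorem altRep_apply {n : ℕ} (x : USp g) (φ : AltForm g n) (v : Fin n → Fin g ⊕ Fin g → ℂ) :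
    altRep g n x φ v = φ fun k => (USp.toMatrix x)ᵀ *ᵥ v k := rfl

theorem transpose_mulVec_stdVec (A : Matrix (Fin g ⊕ Fin g) (Fin g ⊕ Fin g) ℂ)
    (a : Fin g ⊕ Fin g) : Aᵀ *ᵥ stdVec a = ∑ b, A a b • stdVec b := by
  ext c
  simp [stdVec, Finset.sum_apply, Pi.single_apply]

theorem map_vecCons_sum {n : ℕ} (φ : AltForm g (n + 1)) (c : Fin g ⊕ Fin g → ℂ)
    (w : Fin n → Fin g ⊕ Fin g → ℂ) :
    φ (vecCons (∑ a, c a • stdVec a) w) = ∑ a, c a * φ (vecCons (stdVec a) w) := by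
  rw [← AlternatingMap.curryLeft_apply_apply, map_sum, sum_coe_apply]
  exact Finset.sum_congr rfl fun a _ => by rw [map_smul]; rfl

theorem vecCons_vecCons_comm {n : ℕ} (φ : AltForm g (n + 2)) (y z : Fin g ⊕ Fin g → ℂ)
    (w : Fin n → Fin g ⊕ Fin g → ℂ) :
    φ (vecCons y (vecCons z w)) = -φ (vecCons z (vecCons y w)) := by
  rw [← φ.map_swap (v := vecCons z (vecCons y w)) (i := 0) (j := 1) (by simp)]
  congr 1
  ext k : 1
  refine Fin.cases ?_ (fun k => Fin.cases ?_ (fun k => ?_) k) k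
  · simp
  · simp
  · rw [Function.comp_apply, Equiv.swap_apply_of_ne_of_ne]
    · simp
    · exact Fin.succ_ne_zero _
    · rw [← Fin.succ_zero_eq_one]
      exact fun h => Fin.succ_ne_zero _ (Fin.succ_injective _ h)

theorem vecCons_sum_vecCons_sum {n : ℕ} (φ : AltForm g (n + 2)) (c d : Fin g ⊕ Fin g → ℂ)
    (w : Fin n → Fin g ⊕ Fin g → ℂ) :
    φ (vecCons (∑ a, c a • stdVec a) (vecCons (∑ b, d b • stdVec b) w)) =
      ∑ a, ∑ b, c a * d b * φ (vecCons (stdVec a) (vecCons (stdVec b) w)) := by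
  rw [map_vecCons_sum]
  refine Finset.sum_congr rfl fun a _ => ?_
  rw [vecCons_vecCons_comm, map_vecCons_sum, ← Finset.sum_neg_distrib, Finset.mul_sum]
  refine Finset.sum_congr rfl fun b _ => ?_
  rw [vecCons_vecCons_comm φ (stdVec b)]
  ring

/-- Invariance of the symplectic bivector. Doubling the sum and using the antisymmetry of `B`, the
products of entries of x combine into -xᵀJx = -J. -/
theorem sum_toMatrix_mul_antisymm (x : USp g) (B : Fin g ⊕ Fin g → Fin g ⊕ Fin g → ℂ)
    (hB : ∀ a b, B a b = -B b a) :
    ∑ i : Fin g, ∑ a, ∑ b, USp.toMatrix x (Sum.inl i) a * USp.toMatrix x (Sum.inr i) b * B a b =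
      ∑ i : Fin g, B (Sum.inl i) (Sum.inr i) := by
  set X := USp.toMatrix x
  have hX : ∀ a b, ∑ i : Fin g, (X (Sum.inl i) a * X (Sum.inr i) b -
      X (Sum.inr i) a * X (Sum.inl i) b) = -J (Fin g) ℂ a b := by
    intro a b
    rw [← USp.transpose_mul_J_mul_toMatrix x, Matrix.mul_apply, Fintype.sum_sum_type]
    simp only [Matrix.mul_apply, Fintype.sum_sum_type, J, Matrix.transpose_apply,
      fromBlocks_apply₁₁, fromBlocks_apply₁₂, fromBlocks_apply₂₁, fromBlocks_apply₂₂,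
      Matrix.zero_apply, mul_zero, Finset.sum_const_zero, zero_add, add_zero, Matrix.neg_apply,
      Matrix.one_apply, mul_neg, mul_ite, mul_one, Finset.sum_neg_distrib, Finset.sum_ite_eq',
      Finset.mem_univ, if_true, Finset.sum_sub_distrib, neg_mul]
    rw [neg_add, neg_neg]
    ring
  have h2 : ∀ S : ℂ, 2 * S = S + S := two_mul
  apply mul_left_cancel₀ (two_ne_zero (α := ℂ))
  have hswap : ∑ i : Fin g, ∑ a, ∑ b, X (Sum.inl i) a * X (Sum.inr i) b * B a b =
      ∑ i : Fin g, ∑ a, ∑ b, -(X (Sum.inr i) a * X (Sum.inl i) b * B a b) := by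
    refine Finset.sum_congr rfl fun i _ => ?_
    rw [Finset.sum_comm]
    refine Finset.sum_congr rfl fun a _ => Finset.sum_congr rfl fun b _ => ?_
    rw [hB b a]
    ring
  have h3 : ∑ a, ∑ b, -J (Fin g) ℂ a b * B a b = 2 * ∑ i : Fin g, B (Sum.inl i) (Sum.inr i) := by
    simp only [Fintype.sum_sum_type, J, fromBlocks_apply₁₁, fromBlocks_apply₁₂,
      fromBlocks_apply₂₁, fromBlocks_apply₂₂, Matrix.zero_apply, Matrix.neg_apply,
      Matrix.one_apply, zero_mul, Finset.sum_const_zero, zero_add, add_zero,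
      neg_mul, ite_mul, one_mul, Finset.sum_neg_distrib, Finset.sum_ite_eq, Finset.mem_univ,
      if_true]
    have : ∀ i : Fin g, B (Sum.inr i) (Sum.inl i) = -B (Sum.inl i) (Sum.inr i) := fun i => hB _ _
    simp only [this, Finset.sum_neg_distrib]
    ring
  rw [← h3, two_mul]
  conv_lhs => rw [hswap]; arg 1; rw [← hswap]
  rw [← Finset.sum_add_distrib]
  simp_rw [← Finset.sum_add_distrib]
  rw [Finset.sum_comm]
  refine Finset.sum_congr rfl fun a _ => ?_
  rw [Finset.sum_comm]
  refine Finset.sum_congr rfl fun b _ => ?_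
  rw [← hX, Finset.sum_mul]
  refine Finset.sum_congr rfl fun i _ => ?_
  ring

theorem contract_altRep {n : ℕ} (x : USp g) (φ : AltForm g (n + 2)) :
    contract g n (altRep g (n + 2) x φ) = altRep g n x (contract g n φ) := by
  ext v
  rw [altRep_apply, contract_apply, contract_apply,
    ← sum_toMatrix_mul_antisymm x (fun a b => φ (vecCons (stdVec a) (vecCons (stdVec b)
      fun k => (USp.toMatrix x)ᵀ *ᵥ v k))) (fun a b => vecCons_vecCons_comm φ _ _ _)]
  refine Finset.sum_congr rfl fun i _ => ?_
  rw [← vecCons_sum_vecCons_sum, altRep_apply, ← transpose_mulVec_stdVec,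
    ← transpose_mulVec_stdVec]
  congr 1
  ext k : 1
  refine Fin.cases ?_ (fun k => Fin.cases ?_ (fun k => ?_) k) k <;> simp

/-- The primitive alternating forms, as a subrepresentation. -/
def primitive (g : ℕ) : ∀ n, Subrepresentation (altRep g n)
  | 0 => ⊤
  | 1 => ⊤
  | n + 2 =>
    { toSubmodule := LinearMap.ker (contract g n)
      apply_mem_toSubmodule := fun x φ hφ => by
        rw [LinearMap.mem_ker] at hφ ⊢
        rw [contract_altRep, hφ, map_zero] }

/-- Coordinates indexed by n-subsets of the basis, in which the torus acts diagonally. The order on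
the index type serves only to enumerate each subset. -/
theorem exists_evalEquiv (g n : ℕ) : ∃ (a : Set.powersetCard (Fin g ⊕ Fin g) n → Fin n →
    Fin g ⊕ Fin g) (E : AltForm g n ≃ₗ[ℂ] (Set.powersetCard (Fin g ⊕ Fin g) n → ℂ)),
    (∀ s, Function.Injective (a s) ∧ Finset.univ.image (a s) = s.1) ∧
    ∀ φ s, E φ s = φ fun k => stdVec (a s k) := by
  let _ : LinearOrder (Fin g ⊕ Fin g) :=
    LinearOrder.lift' finSumFinEquiv finSumFinEquiv.injective
  refine ⟨fun s => Set.powersetCard.ofFinEmbEquiv.symm s,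
    exteriorPower.alternatingMapLinearEquiv.trans
      (((Pi.basisFun ℂ (Fin g ⊕ Fin g)).exteriorPower n).constr ℂ).symm, fun s => ⟨?_, ?_⟩, ?_⟩
  · exact (Set.powersetCard.ofFinEmbEquiv.symm s).injective
  · ext i
    have := Set.powersetCard.mem_range_ofFinEmbEquiv_symm_iff_mem s i
    rw [Finset.mem_image]
    simp only [Finset.mem_univ, true_and]
    exact this
  · intro φ s
    have : (((Pi.basisFun ℂ (Fin g ⊕ Fin g)).exteriorPower n).constr ℂ).symm
      (exteriorPower.alternatingMapLinearEquiv φ) s = exteriorPower.alternatingMapLinearEquiv φ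
        ((Pi.basisFun ℂ (Fin g ⊕ Fin g)).exteriorPower n s) := rfl
    rw [LinearEquiv.trans_apply, this, exteriorPower.basis_apply, exteriorPower.ιMulti_family,
      exteriorPower.alternatingMapLinearEquiv_apply_ιMulti]
    congr 1
    ext k : 1
    simp [stdVec]

theorem altRep_torus_stdVec {n : ℕ} (z : Fin g → Circle) (φ : AltForm g n)
    (a : Fin n → Fin g ⊕ Fin g) :
    altRep g n (USp.torus z) φ (fun k => stdVec (a k)) =
      (∏ k, Sum.elim (fun i => (z i : ℂ)) (fun i => (z i : ℂ)⁻¹) (a k)) *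
        φ fun k => stdVec (a k) := by
  rw [altRep_apply]
  have : ∀ k, (USp.toMatrix (USp.torus z))ᵀ *ᵥ stdVec (a k) =
      Sum.elim (fun i => (z i : ℂ)) (fun i => (z i : ℂ)⁻¹) (a k) • stdVec (a k) := by
    intro k
    ext c
    rw [USp.toMatrix_torus, diagonal_transpose, mulVec_diagonal]
    by_cases h : c = a k
    · rw [h]
      rcases a k with b | b <;> simp [stdVec]
    · simp [stdVec, h]
  simp_rw [this]
  exact MultilinearMap.map_smul_univ φ.toMultilinearMap _ _

theorem trace_altRep_torus (n : ℕ) (z : Fin g → Circle) :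
    LinearMap.trace ℂ _ (altRep g n (USp.torus z)) =
      elemSymm n (Sum.elim (fun i => (z i : ℂ)) (fun i => (z i : ℂ)⁻¹)) := by
  classical
  obtain ⟨a, E, ha, hE⟩ := exists_evalEquiv g n
  set t := Sum.elim (fun i => (z i : ℂ)) (fun i => (z i : ℂ)⁻¹) with ht
  have hprod : ∀ s, ∏ k, t (a s k) = ∏ i ∈ s.1, t i := by
    intro s
    rw [← (ha s).2, Finset.prod_image fun k _ l _ h => (ha s).1 h]
  have key : E.conj (altRep g n (USp.torus z)) =
      Matrix.toLin' (diagonal fun s : Set.powersetCard (Fin g ⊕ Fin g) n => ∏ i ∈ s.1, t i) := by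
    refine LinearMap.ext fun f => funext fun s => ?_
    rw [LinearEquiv.conj_apply_apply, hE, altRep_torus_stdVec, ← hE, LinearEquiv.apply_symm_apply,
      Matrix.toLin'_apply, mulVec_diagonal, hprod]
  rw [← LinearMap.trace_conj' _ E, key, Matrix.trace_toLin'_eq, Matrix.trace_diagonal, elemSymm]
  exact (Finset.sum_subtype _ (fun s => by
    rw [Finset.mem_powersetCard]; simp [Set.powersetCard]) (fun s => ∏ i ∈ s, t i)).symm

/-- The representation of `USp(2g)` on the primitive alternating forms. -/
def primitiveRep (g n : ℕ) : Representation ℂ (USp g) (primitive g n).toSubmodule :=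
  (primitive g n).toRepresentation

theorem primitiveRep_coe {n : ℕ} (x : USp g) (φ : (primitive g n).toSubmodule) :
    (primitiveRep g n x φ : AltForm g n) = altRep g n x φ := rfl

theorem trace_primitiveRep {n : ℕ} (hn : n + 2 ≤ g) (x : USp g) :
    LinearMap.trace ℂ _ (primitiveRep g (n + 2) x) =
      LinearMap.trace ℂ _ (altRep g (n + 2) x) - LinearMap.trace ℂ _ (altRep g n x) := by
  rw [eq_sub_iff_add_eq]
  exact (LinearMap.trace_eq_trace_restrict_ker_add (contract_surjective (g := g) (by omega))
    (fun φ => contract_altRep x φ)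
    fun φ hφ => (primitive g (n + 2)).apply_mem_toSubmodule x hφ).symm

theorem trace_primitiveRep_of_lt_two {n : ℕ} (hn : n < 2) (x : USp g) :
    LinearMap.trace ℂ _ (primitiveRep g n x) = LinearMap.trace ℂ _ (altRep g n x) := by
  have htop : (primitive g n).toSubmodule = ⊤ := by
    match n, hn with
    | 0, _ => rfl
    | 1, _ => rfl
  rw [← LinearMap.trace_conj' (primitiveRep g n x) (LinearEquiv.ofTop _ htop)]
  rfl

theorem character_primitiveRep {n : ℕ} (hn : n ≤ g) (x : USp g) :
    (primitiveRep g n).character x =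
      ∑ k ∈ Finset.range (g + 1), (coeffFamily g k (n : ℤ) : ℂ) * sCoeff g k x := by
  obtain ⟨y, z, rfl⟩ := USp.exists_eq_conj_torus x
  rw [Representation.char_conj, Finset.sum_congr rfl fun k hk => by
    rw [USp.sCoeff_conj_torus y z (Nat.lt_succ_iff.1 (Finset.mem_range.1 hk))],
    Representation.character]
  have hz : ∀ i, (z i : ℂ) * (z i : ℂ)⁻¹ = 1 := fun i => mul_inv_cancel₀ (Circle.coe_ne_zero _)
  rcases Nat.lt_or_ge n 2 with h | h
  · rw [trace_primitiveRep_of_lt_two h, trace_altRep_torus, elemSymm_sumElim_of_lt_two hn h _ _ hz]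
  · obtain ⟨m, rfl⟩ : ∃ m, n = m + 2 := ⟨n - 2, by omega⟩
    rw [trace_primitiveRep hn, trace_altRep_torus, trace_altRep_torus,
      elemSymm_sumElim_sub hn _ _ hz]

/-- For n ≥ 2 an injective contraction would give binom(2g, n) ≤ binom(2g, n-2), but these binomials
increase strictly up to the middle g. -/
theorem primitive_ne_bot {n : ℕ} (hn : n ≤ g) : (primitive g n).toSubmodule ≠ ⊥ := by
  intro hbot
  have hdim : ∀ m, Module.finrank ℂ (AltForm g m) = (2 * g).choose m := by
    intro m
    rw [LinearEquiv.finrank_eq (exteriorPower.alternatingMapLinearEquiv (R := ℂ) (n := m)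
      (M := Fin g ⊕ Fin g → ℂ) (N := ℂ)), Module.finrank_linearMap_self, exteriorPower.finrank_eq]
    simp [two_mul]
  match n, hbot with
  | 0, hbot =>
    have h1 := hdim 0
    rw [← finrank_top, show (⊤ : Submodule ℂ (AltForm g 0)) = ⊥ from hbot] at h1
    simp at h1
  | 1, hbot =>
    have h1 := hdim 1
    rw [← finrank_top, show (⊤ : Submodule ℂ (AltForm g 1)) = ⊥ from hbot] at h1
    simp at h1
    omega
  | m + 2, hbot =>
    have h1 := LinearMap.finrank_le_finrank_of_injective (LinearMap.ker_eq_bot.1 hbot)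
    rw [hdim, hdim] at h1
    have h2 := Nat.choose_succ_right_eq (2 * g) m
    have h3 := Nat.choose_succ_right_eq (2 * g) (m + 1)
    obtain ⟨d, hd⟩ : ∃ d, 2 * g = 2 * m + 4 + d := ⟨2 * g - (2 * m + 4), by omega⟩
    rw [show 2 * g - m = m + 4 + d by omega] at h2
    rw [show 2 * g - (m + 1) = m + 3 + d by omega] at h3
    have h4 : 0 < (2 * g).choose m := Nat.choose_pos (by omega)
    nlinarith [Nat.zero_le ((2 * g).choose (m + 1)), Nat.zero_le m, Nat.zero_le d]

end AltForm

end

/-! ### The infinitesimal action of `sp(2g, ℂ)`. -/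

section

open Matrix

namespace USp

variable {g : ℕ}

theorem exists_toMatrix_eq_exp {Y : Matrix (Fin g ⊕ Fin g) (Fin g ⊕ Fin g) ℂ} (hY : Yᴴ = -Y)
    (hJ : Y * J (Fin g) ℂ + J (Fin g) ℂ * Yᵀ = 0) (s : ℝ) :
    ∃ x : USp g, toMatrix x = NormedSpace.exp (s • Y) := by
  have hJJ : J (Fin g) ℂ * (-J (Fin g) ℂ) = 1 := by
    rw [Matrix.mul_neg, J_squared, neg_neg]
  have hinv : (J (Fin g) ℂ)⁻¹ = -J (Fin g) ℂ := Matrix.inv_eq_right_inv hJJ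
  have hdet : IsUnit (J (Fin g) ℂ) := IsUnit.of_mul_eq_one _ hJJ
  have hYJ : J (Fin g) ℂ * (s • Y)ᵀ * (J (Fin g) ℂ)⁻¹ = -(s • Y) := by
    rw [hinv, transpose_smul, Matrix.mul_smul, Matrix.smul_mul, ← smul_neg,
      eq_neg_of_add_eq_zero_right hJ, Matrix.neg_mul, Matrix.mul_assoc, hJJ, Matrix.mul_one]
  have hu : NormedSpace.exp (s • Y) * NormedSpace.exp (-(s • Y)) = 1 := by
    rw [← Matrix.exp_add_of_commute _ _ (Commute.neg_right (Commute.refl (s • Y))), add_neg_cancel,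
      NormedSpace.exp_zero]
  refine ⟨ofMatrix (NormedSpace.exp (s • Y)) ?_ ?_, rfl⟩
  · rw [mem_unitaryGroup_iff, star_eq_conjTranspose, ← Matrix.exp_conjTranspose,
      conjTranspose_smul, hY, star_trivial, smul_neg, hu]
  · rw [SymplecticGroup.mem_iff, ← Matrix.exp_transpose]
    have h := Matrix.exp_conj (J (Fin g) ℂ) (s • Y)ᵀ hdet
    rw [hYJ] at h
    have h2 : J (Fin g) ℂ * NormedSpace.exp (s • Y)ᵀ =
        NormedSpace.exp (-(s • Y)) * J (Fin g) ℂ := by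
      rw [h, hinv, Matrix.mul_assoc, Matrix.neg_mul, J_squared, neg_neg, Matrix.mul_one]
    rw [Matrix.mul_assoc, h2, ← Matrix.mul_assoc, hu, Matrix.one_mul]

end USp

namespace AltForm

variable {g n : ℕ}

/-- The coordinates of an alternating form. -/
def coords (g n : ℕ) : AltForm g n →ₗ[ℂ] ((Fin n → Fin g ⊕ Fin g) → ℂ) where
  toFun φ a := φ fun k => stdVec (a k)
  map_add' _ _ := rfl
  map_smul' _ _ := rfl

theorem coords_apply (φ : AltForm g n) (a : Fin n → Fin g ⊕ Fin g) :
    coords g n φ a = φ fun k => stdVec (a k) := rfl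

theorem coords_injective : Function.Injective (coords g n) := by
  intro φ ψ h
  refine Module.Basis.ext_alternating (Pi.basisFun ℂ (Fin g ⊕ Fin g)) fun a _ => ?_
  have := congrFun h a
  simpa [coords_apply, stdVec] using this

theorem coords_eq_zero_of_not_injective (φ : AltForm g n) {a : Fin n → Fin g ⊕ Fin g}
    (ha : ¬ Function.Injective a) : coords g n φ a = 0 := by
  refine φ.map_eq_zero_of_not_injective _ fun h => ha fun k l hkl => h ?_
  simp only [hkl]

theorem apply_eq_sum (φ : AltForm g n) (v : Fin n → Fin g ⊕ Fin g → ℂ) :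
    φ v = ∑ b : Fin n → Fin g ⊕ Fin g, (∏ k, v k (b k)) * coords g n φ b := by
  have h : v = fun k => ∑ b, v k b • stdVec b := by
    ext k c
    simp [stdVec, Finset.sum_apply, Pi.single_apply]
  conv_lhs => rw [h]
  rw [← AlternatingMap.coe_multilinearMap, MultilinearMap.map_sum]
  refine Finset.sum_congr rfl fun b _ => ?_
  exact MultilinearMap.map_smul_univ φ.toMultilinearMap _ _

theorem continuous_coe (φ : AltForm g n) : Continuous φ := by
  rw [show (φ : (Fin n → Fin g ⊕ Fin g → ℂ) → ℂ) = _ from funext (apply_eq_sum φ)]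
  fun_prop

/-- The infinitesimal action of a matrix on alternating forms, in coordinates. -/
def infAct (X : Matrix (Fin g ⊕ Fin g) (Fin g ⊕ Fin g) ℂ) (φ : AltForm g n)
    (a : Fin n → Fin g ⊕ Fin g) : ℂ :=
  ∑ k, ∑ b, X (a k) b * coords g n φ (Function.update a k b)

section

attribute [local instance] Matrix.linftyOpNormedAddCommGroup Matrix.linftyOpNormedRing
  Matrix.linftyOpNormedAlgebra Matrix.linftyOpNormedSpace

theorem hasDerivAt_exp_smul (X : Matrix (Fin g ⊕ Fin g) (Fin g ⊕ Fin g) ℂ) (φ : AltForm g n)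
    (a : Fin n → Fin g ⊕ Fin g) :
    HasDerivAt (fun s : ℝ => φ fun k => (NormedSpace.exp (s • X))ᵀ *ᵥ stdVec (a k))
      (infAct X φ a) 0 := by
  let F : ContinuousMultilinearMap ℂ (fun _ : Fin n => Fin g ⊕ Fin g → ℂ) ℂ :=
    ⟨φ.toMultilinearMap, continuous_coe φ⟩
  let T : Matrix (Fin g ⊕ Fin g) (Fin g ⊕ Fin g) ℂ →ₗ[ℝ] (Fin n → Fin g ⊕ Fin g → ℂ) :=
    { toFun := fun A k => Aᵀ *ᵥ stdVec (a k)
      map_add' := fun A B => by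
        ext1 k
        simp [transpose_add, add_mulVec]
      map_smul' := fun c A => by
        ext1 k
        simp [transpose_smul, smul_mulVec] }
  have h1 := hasDerivAt_exp_smul_const (𝕂 := ℝ) X (0 : ℝ)
  have h2 := (T.toContinuousLinearMap.hasFDerivAt).comp_hasDerivAt (0 : ℝ) h1
  have h3 := ((F.hasFDerivAt (x := T (NormedSpace.exp ((0 : ℝ) • X)))).restrictScalars
    ℝ).comp_hasDerivAt (0 : ℝ) h2
  refine h3.congr_deriv ?_
  rw [infAct]
  simp only [zero_smul, NormedSpace.exp_zero, one_mul, ContinuousLinearMap.coe_restrictScalars',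
    ContinuousMultilinearMap.linearDeriv_apply]
  refine Finset.sum_congr rfl fun k _ => ?_
  have h4 : T X k = ∑ b, X (a k) b • stdVec b := transpose_mulVec_stdVec X (a k)
  have h5 : T 1 = fun k => stdVec (a k) := by
    ext1 k
    simp [T]
  refine (congrArg₂ (fun u w => F (Function.update u k w)) h5 h4).trans ?_
  refine (MultilinearMap.map_update_sum φ.toMultilinearMap _ _ _ _).trans ?_
  refine Finset.sum_congr rfl fun b _ => ?_
  rw [MultilinearMap.map_update_smul, smul_eq_mul, coords_apply]
  refine congrArg (X (a k) b * ·) (congrArg φ (funext fun l => ?_))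
  by_cases hl : l = k
  · subst hl
    simp
  · simp [hl]


theorem infAct_add_smul (X Y : Matrix (Fin g ⊕ Fin g) (Fin g ⊕ Fin g) ℂ) (c : ℂ)
    (φ : AltForm g n) : infAct (X + c • Y) φ = infAct X φ + c • infAct Y φ := by
  ext a
  simp only [infAct, Pi.add_apply, Pi.smul_apply, Matrix.add_apply, Matrix.smul_apply, smul_eq_mul,
    add_mul, Finset.sum_add_distrib, Finset.mul_sum, mul_assoc]

theorem infAct_smul (X : Matrix (Fin g ⊕ Fin g) (Fin g ⊕ Fin g) ℂ) (c : ℂ)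
    (φ : AltForm g n) : infAct (c • X) φ = c • infAct X φ := by
  ext a
  simp only [infAct, Pi.smul_apply, Matrix.smul_apply, smul_eq_mul, Finset.mul_sum, mul_assoc]

/-- The one-parameter group exp(sY) lies in `USp g`, so the difference quotients stay in U, which is
closed because finite-dimensional. -/
theorem infAct_mem_of_conjTranspose {U : Submodule ℂ (AltForm g n)}
    (hU : ∀ x, ∀ φ ∈ U, altRep g n x φ ∈ U) {Y : Matrix (Fin g ⊕ Fin g) (Fin g ⊕ Fin g) ℂ}
    (hY : Yᴴ = -Y) (hJ : Y * J (Fin g) ℂ + J (Fin g) ℂ * Yᵀ = 0) {φ : AltForm g n} (hφ : φ ∈ U) :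
    infAct Y φ ∈ U.map (coords g n) := by
  choose x hx using USp.exists_toMatrix_eq_exp hY hJ
  have h1 : HasDerivAt (fun s : ℝ => coords g n (altRep g n (x s) φ)) (infAct Y φ) 0 := by
    rw [hasDerivAt_pi]
    intro a
    simp_rw [coords_apply, altRep_apply, hx]
    exact hasDerivAt_exp_smul Y φ a
  have hcl : IsClosed (U.map (coords g n) : Set ((Fin n → Fin g ⊕ Fin g) → ℂ)) :=
    Submodule.closed_of_finiteDimensional _
  refine hcl.mem_of_tendsto (hasDerivAt_iff_tendsto_slope.1 h1) (Filter.Eventually.of_forall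
    fun s => ?_)
  rw [slope_def_module]
  have : ∀ r : ℝ, coords g n (altRep g n (x r) φ) ∈ U.map (coords g n) := fun r =>
    Submodule.mem_map_of_mem (hU _ _ hφ)
  have h2 := Submodule.smul_mem _ (((s - 0)⁻¹ : ℝ) : ℂ) (Submodule.sub_mem _ (this s) (this 0))
  rwa [Complex.coe_smul] at h2

/-- A subspace of alternating forms stable under `USp(2g)` is stable under the Lie algebra
`sp(2g, ℂ)`. -/
theorem infAct_mem {U : Submodule ℂ (AltForm g n)}
    (hU : ∀ x, ∀ φ ∈ U, altRep g n x φ ∈ U) {X : Matrix (Fin g ⊕ Fin g) (Fin g ⊕ Fin g) ℂ}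
    (hJ : X * J (Fin g) ℂ + J (Fin g) ℂ * Xᵀ = 0) {φ : AltForm g n} (hφ : φ ∈ U) :
    infAct X φ ∈ U.map (coords g n) := by
  have hJH : (J (Fin g) ℂ)ᴴ = -J (Fin g) ℂ := by
    simp [J, fromBlocks_conjTranspose, fromBlocks_neg]
  have hJ' : Xᴴ * J (Fin g) ℂ + J (Fin g) ℂ * Xᴴᵀ = 0 := by
    have h1 := congrArg conjTranspose hJ
    rw [conjTranspose_add, conjTranspose_mul, conjTranspose_mul, hJH, conjTranspose_zero,
      Matrix.neg_mul, Matrix.mul_neg, ← neg_add, neg_eq_zero, add_comm] at h1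
    have hJA : ∀ A, J (Fin g) ℂ * (J (Fin g) ℂ * A) = -A := fun A => by
      rw [← Matrix.mul_assoc, J_squared, Matrix.neg_mul, Matrix.one_mul]
    have h2 := congrArg (fun A => -(J (Fin g) ℂ * (A * J (Fin g) ℂ))) h1
    simp only [Matrix.mul_add, Matrix.add_mul, Matrix.mul_zero, Matrix.zero_mul, neg_zero] at h2
    rw [Matrix.mul_assoc, Matrix.mul_assoc, J_squared, hJA, Matrix.mul_neg, Matrix.mul_neg,
      Matrix.mul_one, ← neg_add, neg_neg] at h2
    first | exact h2 | (rw [add_comm]; exact h2)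
  -- sp(2g, ℂ) is the complexification of its skew-Hermitian part: it is closed under conjugate
  -- transpose, and X - Xᴴ and i(X + Xᴴ) are skew-Hermitian.
  have hX : X = (1 / 2 : ℂ) • (X - Xᴴ) + (-Complex.I / 2) • (Complex.I • (X + Xᴴ)) := by
    rw [smul_smul, show -Complex.I / 2 * Complex.I = 1 / 2 by
      rw [div_mul_eq_mul_div, _root_.neg_mul, Complex.I_mul_I, neg_neg], ← smul_add]
    rw [sub_add_add_cancel, ← two_smul ℂ X, smul_smul]
    norm_num
  have h1 : infAct (X - Xᴴ) φ ∈ U.map (coords g n) := by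
    refine infAct_mem_of_conjTranspose hU ?_ ?_ hφ
    · rw [conjTranspose_sub, conjTranspose_conjTranspose, neg_sub]
    · rw [transpose_sub, Matrix.sub_mul, Matrix.mul_sub, sub_add_sub_comm, hJ, hJ', sub_zero]
  have h2 : infAct (Complex.I • (X + Xᴴ)) φ ∈ U.map (coords g n) := by
    refine infAct_mem_of_conjTranspose hU ?_ ?_ hφ
    · rw [conjTranspose_smul, conjTranspose_add, conjTranspose_conjTranspose, add_comm,
        ← neg_smul]
      simp
    · rw [transpose_smul, transpose_add, Matrix.smul_mul, Matrix.mul_smul, ← smul_add,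
        Matrix.add_mul, Matrix.mul_add, add_add_add_comm, hJ, hJ', add_zero, smul_zero]
  rw [hX, infAct_add_smul, infAct_smul]
  exact Submodule.add_mem _ (Submodule.smul_mem _ _ h1) (Submodule.smul_mem _ _ h2)

end

end AltForm

end

/-! ### Highest weight vectors among the primitive forms. -/

section

open Matrix

namespace AltForm

variable {g n : ℕ}

/-- The height of the weight of a standard basis vector. -/
def height : Fin g ⊕ Fin g → ℕ
  | Sum.inl i => 2 * g - i
  | Sum.inr i => i

/-- The elements of `sp(2g)` that raise the height. -/
def IsRaising (X : Matrix (Fin g ⊕ Fin g) (Fin g ⊕ Fin g) ℂ) : Prop :=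
  X * J (Fin g) ℂ + J (Fin g) ℂ * Xᵀ = 0 ∧ ∀ p q, X p q ≠ 0 → height q < height p

/-- The alternating forms killed by all raising operators. -/
def IsKilled (φ : AltForm g n) : Prop := ∀ X, IsRaising X → infAct X φ = 0

/-- Raising operators act nilpotently: each one strictly increases the minimal total height of the
tuples with nonzero coordinate, and that height is at most 2gn. -/
theorem exists_isKilled {U : Submodule ℂ (AltForm g n)}
    (hU : ∀ x, ∀ φ ∈ U, altRep g n x φ ∈ U) (hne : U ≠ ⊥) : ∃ φ ∈ U, φ ≠ 0 ∧ IsKilled φ := by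
  by_contra! hcon
  have key : ∀ h : ℕ, ∃ φ ∈ U, φ ≠ 0 ∧ ∀ a, coords g n φ a ≠ 0 → h ≤ ∑ k, height (a k) := by
    intro h
    induction h with
    | zero =>
      obtain ⟨φ, h1, h2⟩ := Submodule.exists_mem_ne_zero_of_ne_bot hne
      exact ⟨φ, h1, h2, fun _ _ => Nat.zero_le _⟩
    | succ h ih =>
      obtain ⟨φ, h1, h2, h3⟩ := ih
      have h4 := hcon φ h1 h2
      rw [IsKilled] at h4
      push Not at h4
      obtain ⟨X, hX, hXφ⟩ := h4
      obtain ⟨ψ, hψ, hψX⟩ := Submodule.mem_map.1 (infAct_mem hU hX.1 h1)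
      refine ⟨ψ, hψ, fun h0 => hXφ (by rw [← hψX, h0, map_zero]), fun a ha => ?_⟩
      rw [hψX] at ha
      obtain ⟨k, -, hk⟩ := Finset.exists_ne_zero_of_sum_ne_zero ha
      obtain ⟨b, -, hb⟩ := Finset.exists_ne_zero_of_sum_ne_zero hk
      refine (h3 _ (right_ne_zero_of_mul hb)).trans_lt
        (Finset.sum_lt_sum (fun l _ => ?_) ⟨k, Finset.mem_univ _, ?_⟩)
      · by_cases hl : l = k
        · subst hl
          rw [Function.update_self]
          exact (hX.2 _ _ (left_ne_zero_of_mul hb)).le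
        · rw [Function.update_of_ne hl]
      · rw [Function.update_self]
        exact hX.2 _ _ (left_ne_zero_of_mul hb)
  obtain ⟨φ, -, h2, h3⟩ := key (n * (2 * g) + 1)
  refine h2 (coords_injective ?_)
  rw [map_zero]
  ext a
  by_contra ha
  have h4 : ∑ k, height (a k) ≤ ∑ _k : Fin n, 2 * g := by
    refine Finset.sum_le_sum fun k _ => ?_
    rcases a k with i | i <;> simp only [height] <;> omega
  rw [Finset.sum_const, Finset.card_univ, Fintype.card_fin, smul_eq_mul] at h4
  have := h3 a ha
  omega

theorem infAct_add (X Y : Matrix (Fin g ⊕ Fin g) (Fin g ⊕ Fin g) ℂ) (φ : AltForm g n) :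
    infAct (X + Y) φ = infAct X φ + infAct Y φ := by
  simpa using infAct_add_smul X Y 1 φ

theorem infAct_single (p q : Fin g ⊕ Fin g) (c : ℂ) (φ : AltForm g n)
    (a : Fin n → Fin g ⊕ Fin g) : infAct (Matrix.single p q c) φ a =
      ∑ k, if p = a k then c * coords g n φ (Function.update a k q) else 0 := by
  refine Finset.sum_congr rfl fun k _ => ?_
  rw [Finset.sum_eq_single q]
  · simp [Matrix.single_apply]
  · intro b _ hb
    simp [hb.symm]
  · simp

theorem infAct_single_of_forall_ne {p : Fin g ⊕ Fin g} (q : Fin g ⊕ Fin g) (c : ℂ)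
    (φ : AltForm g n) {a : Fin n → Fin g ⊕ Fin g} (h : ∀ k, a k ≠ p) :
    infAct (Matrix.single p q c) φ a = 0 := by
  rw [infAct_single]
  exact Finset.sum_eq_zero fun k _ => if_neg (h k).symm

theorem infAct_single_of_eq {p : Fin g ⊕ Fin g} (q : Fin g ⊕ Fin g) (c : ℂ)
    (φ : AltForm g n) {a : Fin n → Fin g ⊕ Fin g} (ha : Function.Injective a) {k : Fin n}
    (h : a k = p) :
    infAct (Matrix.single p q c) φ a = c * coords g n φ (Function.update a k q) := by
  rw [infAct_single, Finset.sum_eq_single k]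
  · rw [if_pos h.symm]
  · intro l _ hl
    exact if_neg fun h' => hl (ha (h'.symm.trans h.symm))
  · simp

theorem fromBlocks_mul_J_add (A B : Matrix (Fin g) (Fin g) ℂ) (hB : Bᵀ = B) :
    fromBlocks A B 0 (-Aᵀ) * J (Fin g) ℂ + J (Fin g) ℂ * (fromBlocks A B 0 (-Aᵀ))ᵀ = 0 := by
  rw [J, fromBlocks_transpose, fromBlocks_multiply, fromBlocks_multiply, fromBlocks_add,
    ← fromBlocks_zero]
  congr 1 <;> simp [hB]

/-- Root vectors for the positive root 2e_i; the next two lemmas treat e_i + e_j and e_i - e_j. -/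
theorem isRaising_single (i : Fin g) :
    IsRaising (Matrix.single (Sum.inl i : Fin g ⊕ Fin g) (Sum.inr i) (1 : ℂ)) := by
  constructor
  · have h : Matrix.single (Sum.inl i : Fin g ⊕ Fin g) (Sum.inr i : Fin g ⊕ Fin g) (1 : ℂ) =
        fromBlocks 0 (Matrix.single i i 1) 0 (-(0 : Matrix (Fin g) (Fin g) ℂ)ᵀ) := by
      ext p q
      rcases p with p | p <;> rcases q with q | q <;> simp [Matrix.single_apply]
    rw [h]
    exact fromBlocks_mul_J_add _ _ (Matrix.transpose_single _ _ _)
  · intro p q h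
    rw [Matrix.single_apply] at h
    obtain ⟨rfl, rfl⟩ : Sum.inl i = p ∧ Sum.inr i = q := by
      by_contra hc
      exact h (if_neg hc)
    simp only [height]
    omega

theorem isRaising_single_add_single (i j : Fin g) :
    IsRaising (Matrix.single (Sum.inl i) (Sum.inr j) (1 : ℂ) +
      Matrix.single (Sum.inl j) (Sum.inr i) (1 : ℂ)) := by
  constructor
  · have h : Matrix.single (Sum.inl i : Fin g ⊕ Fin g) (Sum.inr j : Fin g ⊕ Fin g) (1 : ℂ) +
        Matrix.single (Sum.inl j : Fin g ⊕ Fin g) (Sum.inr i) (1 : ℂ) =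
        fromBlocks 0 (Matrix.single i j 1 + Matrix.single j i 1) 0
          (-(0 : Matrix (Fin g) (Fin g) ℂ)ᵀ) := by
      ext p q
      rcases p with p | p <;> rcases q with q | q <;> simp [Matrix.single_apply]
    rw [h]
    refine fromBlocks_mul_J_add _ _ ?_
    rw [transpose_add, Matrix.transpose_single, Matrix.transpose_single, add_comm]
  · intro p q h
    rcases p with p | p <;> rcases q with q | q
    · exact absurd (by simp) h
    · simp only [height]
      omega
    · exact absurd (by simp) h
    · exact absurd (by simp) h

theorem isRaising_single_sub_single {i j : Fin g} (hij : i < j) :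
    IsRaising (Matrix.single (Sum.inl i) (Sum.inl j) (1 : ℂ) +
      Matrix.single (Sum.inr j) (Sum.inr i) (-1 : ℂ)) := by
  constructor
  · have h : Matrix.single (Sum.inl i : Fin g ⊕ Fin g) (Sum.inl j) (1 : ℂ) +
        Matrix.single (Sum.inr j) (Sum.inr i) (-1 : ℂ) =
        fromBlocks (Matrix.single i j 1) 0 0 (-(Matrix.single i j (1 : ℂ))ᵀ) := by
      rw [Matrix.transpose_single]
      ext p q
      rcases p with p | p <;> rcases q with q | q <;> simp [Matrix.single_apply, neg_ite]
    rw [h]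
    exact fromBlocks_mul_J_add _ _ transpose_zero
  · have hij' : (i : ℕ) < j := hij
    intro p q h
    rcases p with p | p <;> rcases q with q | q <;>
      simp only [height]
    · have h1 : i = p ∧ j = q := by
        by_contra hc
        apply h
        simp [hc]
      rw [← h1.1, ← h1.2]
      omega
    · exact absurd (by simp) h
    · exact absurd (by simp) h
    · have h1 : j = p ∧ i = q := by
        by_contra hc
        apply h
        simp [hc]
      rw [← h1.1, ← h1.2]
      omega

theorem _root_.Function.Injective.update_of_forall_ne {α β : Type*} [DecidableEq α] {f : α → β}
    (hf : Function.Injective f) (k : α) {b : β} (hb : ∀ l, l ≠ k → f l ≠ b) :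
    Function.Injective (Function.update f k b) := by
  intro x y hxy
  by_cases hx : x = k <;> by_cases hy : y = k
  · rw [hx, hy]
  · subst hx
    rw [Function.update_self, Function.update_of_ne hy] at hxy
    exact absurd hxy.symm (hb y hy)
  · subst hy
    rw [Function.update_self, Function.update_of_ne hx] at hxy
    exact absurd hxy (hb x hx)
  · rw [Function.update_of_ne hx, Function.update_of_ne hy] at hxy
    exact hf hxy

theorem coords_comp_perm (φ : AltForm g n) (a : Fin n → Fin g ⊕ Fin g) (σ : Equiv.Perm (Fin n)) :
    coords g n φ (a ∘ σ) = Equiv.Perm.sign σ • coords g n φ a :=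
  φ.map_perm (fun k => stdVec (a k)) σ

/-- Evaluated on the tuple with f_i replaced by e_i, the root vector of 2e_i has a single term, the
coordinate at `b`. -/
theorem IsKilled.coords_eq_zero_of_inr {φ : AltForm g n} (hφ : IsKilled φ)
    {b : Fin n → Fin g ⊕ Fin g} (hb : Function.Injective b) {k : Fin n} {i : Fin g}
    (hk : b k = Sum.inr i) (hi : ∀ l, b l ≠ Sum.inl i) : coords g n φ b = 0 := by
  have h := congrFun (hφ _ (isRaising_single i)) (Function.update b k (Sum.inl i))
  rwa [infAct_single_of_eq _ _ _ (hb.update_of_forall_ne k fun l _ => hi l)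
    (Function.update_self _ _ _), one_mul, Function.update_idem, ← hk,
    Function.update_eq_self] at h

theorem sum_coords_update_update {φ : AltForm g n} (hφ : φ ∈ (primitive g n).toSubmodule)
    (b : Fin n → Fin g ⊕ Fin g) {k l : Fin n} (hkl : k ≠ l) :
    ∑ j : Fin g, coords g n φ
      (Function.update (Function.update b k (Sum.inl j)) l (Sum.inr j)) = 0 := by
  obtain ⟨m, rfl⟩ : ∃ m, n = m + 2 := ⟨n - 2, by
    have := k.2
    have := l.2
    have : (k : ℕ) ≠ l := fun h => hkl (Fin.ext h)
    omega⟩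
  obtain ⟨σ, h0, h1⟩ : ∃ σ : Equiv.Perm (Fin (m + 2)), σ 0 = k ∧ σ 1 = l := by
    refine ⟨Equiv.swap (Equiv.swap 0 k 1) l * Equiv.swap 0 k, ?_, ?_⟩
    · rw [Equiv.Perm.mul_apply, Equiv.swap_apply_left, Equiv.swap_apply_of_ne_of_ne _ hkl]
      intro h
      have := (Equiv.swap 0 k).injective ((Equiv.swap_apply_left 0 k).trans h)
      simp at this
    · rw [Equiv.Perm.mul_apply, Equiv.swap_apply_left]
  have hker : contract g m φ = 0 := LinearMap.mem_ker.1 hφ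
  have h2 : ∀ j : Fin g, (fun t => stdVec ((Function.update (Function.update b k (Sum.inl j)) l
      (Sum.inr j) ∘ σ) t) : Fin (m + 2) → Fin g ⊕ Fin g → ℂ) =
      vecCons (stdVec (Sum.inl j)) (vecCons (stdVec (Sum.inr j))
        fun t => stdVec (b (σ t.succ.succ))) := by
    intro j
    ext t : 1
    refine Fin.cases ?_ (fun t => Fin.cases ?_ (fun t => ?_) t) t
    · simp [h0, hkl]
    · simp [h1]
    · have h3 : σ t.succ.succ ≠ l := fun h => by
        have := σ.injective (h.trans h1.symm)
        simp [Fin.ext_iff] at this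
      have h4 : σ t.succ.succ ≠ k := fun h => by
        have := σ.injective (h.trans h0.symm)
        simp [Fin.ext_iff] at this
      simp [h3, h4]
  have h3 := contract_apply φ (fun t => stdVec (b (σ t.succ.succ)))
  rw [hker] at h3
  simp_rw [← h2, ← coords_apply, coords_comp_perm] at h3
  rw [← Finset.smul_sum] at h3
  have h4 := congrArg (fun c => Equiv.Perm.sign σ • c) h3.symm
  rcases Int.units_eq_one_or (Equiv.Perm.sign σ) with h | h <;> simpa [h] using h3.symm

/-- The root e_i + e_j shows that replacing the pair (e_i, f_i) by (e_j, f_j) leaves the coordinate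
unchanged unless e_j occurs elsewhere, when the new coordinate is 0. The contraction equation thus
reads N times the coordinate = 0, with N ≥ 1 because j = i counts. -/
theorem IsKilled.coords_eq_zero_of_inl_inr {φ : AltForm g n} (hφ : IsKilled φ)
    (hprim : φ ∈ (primitive g n).toSubmodule)
    {b : Fin n → Fin g ⊕ Fin g} (hb : Function.Injective b) {k l : Fin n} {i : Fin g}
    (hk : b k = Sum.inl i) (hl : b l = Sum.inr i) : coords g n φ b = 0 := by
  classical
  have hkl : k ≠ l := by
    rintro rfl
    rw [hk] at hl
    cases hl
  have h1 : ∀ j : Fin g, coords g n φ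
      (Function.update (Function.update b k (Sum.inl j)) l (Sum.inr j)) =
      if ∀ m, m ≠ k → b m ≠ Sum.inl j then coords g n φ b else 0 := by
    intro j
    split_ifs with hj
    · by_cases hij : j = i
      · subst hij
        rw [← hk, Function.update_eq_self, ← hl, Function.update_eq_self]
      have hj' : ∀ m, b m ≠ Sum.inl j := by
        intro m
        by_cases hm : m = k
        · rw [hm, hk]
          exact fun h => hij (Sum.inl_injective h).symm
        · exact hj m hm
      set a := Function.update b l (Sum.inl j) with ha
      have hainj : Function.Injective a := hb.update_of_forall_ne l fun m _ => hj' m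
      have h2 := congrFun (hφ _ (isRaising_single_add_single i j)) a
      rw [infAct_add, Pi.add_apply, infAct_single_of_eq (k := k) _ _ _ hainj
        (by rw [ha, Function.update_of_ne hkl, hk]), infAct_single_of_eq (k := l) _ _ _ hainj
        (by rw [ha, Function.update_self]), one_mul, one_mul, ha, Function.update_idem, ← hl,
        Function.update_eq_self, Pi.zero_apply] at h2
      have h3 : Function.update (Function.update b k (Sum.inl j)) l (Sum.inr j) =
          Function.update (Function.update b l (Sum.inl j)) k (Sum.inr j) ∘ Equiv.swap k l := by
        ext1 t
        by_cases ht : t = k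
        · subst ht
          simp [hkl, hkl.symm]
        · by_cases ht' : t = l
          · subst ht'
            simp
          · simp [ht, ht', Equiv.swap_apply_of_ne_of_ne ht ht']
      rw [h3, coords_comp_perm, Equiv.Perm.sign_swap hkl]
      simp only [Units.neg_smul, one_smul]
      linear_combination -h2
    · push Not at hj
      obtain ⟨m, hm, hmj⟩ := hj
      have hml : m ≠ l := by
        rintro rfl
        rw [hl] at hmj
        cases hmj
      refine coords_eq_zero_of_not_injective _ fun h => hm (h ?_)
      rw [Function.update_of_ne hml, Function.update_of_ne hm, hmj, Function.update_of_ne hkl,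
        Function.update_self]
  have h2 := sum_coords_update_update hprim b hkl
  simp_rw [h1] at h2
  rw [← Finset.sum_filter, Finset.sum_const, smul_eq_zero] at h2
  refine h2.resolve_left fun h => ?_
  rw [Finset.card_eq_zero] at h
  have : i ∈ Finset.univ.filter fun j : Fin g => ∀ m, m ≠ k → b m ≠ Sum.inl j := by
    rw [Finset.mem_filter]
    exact ⟨Finset.mem_univ _, fun m hm h' => hm (hb (h'.trans hk.symm))⟩
  rw [h] at this
  exact absurd this (Finset.notMem_empty _)

/-- The index of the highest weight vector. -/
def topIndex (hn : n ≤ g) (k : Fin n) : Fin g ⊕ Fin g := Sum.inl (Fin.castLE hn k)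

/-- The two previous vanishing lemmas leave only tuples of vectors e_i. The roots e_i - e_j make
their index set closed downwards, so it consists of the first n indices. -/
theorem IsKilled.exists_perm {φ : AltForm g n} (hφ : IsKilled φ) (hn : n ≤ g)
    (hprim : φ ∈ (primitive g n).toSubmodule) {b : Fin n → Fin g ⊕ Fin g}
    (hb : coords g n φ b ≠ 0) : ∃ σ : Equiv.Perm (Fin n), b = topIndex hn ∘ σ := by
  have hinj : Function.Injective b := by
    by_contra h
    exact hb (coords_eq_zero_of_not_injective φ h)
  have h1 : ∀ k, ∃ i, b k = Sum.inl i := by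
    intro k
    rcases hk : b k with i | i
    · exact ⟨i, rfl⟩
    · exfalso
      by_cases hi : ∀ l, b l ≠ Sum.inl i
      · exact hb (hφ.coords_eq_zero_of_inr hinj hk hi)
      · push Not at hi
        obtain ⟨l, hl⟩ := hi
        exact hb (hφ.coords_eq_zero_of_inl_inr hprim hinj hl hk)
  choose c hc using h1
  have hcinj : Function.Injective c := fun k l h => hinj (by rw [hc, hc, h])
  have hdown : ∀ k, ∀ i < c k, ∃ l, c l = i := by
    intro k i hi
    by_contra! hcon
    apply hb
    have hne : ∀ l, b l ≠ Sum.inl i := fun l h => hcon l (Sum.inl_injective ((hc l).symm.trans h))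
    have h := congrFun (hφ _ (isRaising_single_sub_single hi))
      (Function.update b k (Sum.inl i))
    rwa [infAct_add, Pi.add_apply, infAct_single_of_eq (k := k) _ _ _
      (hinj.update_of_forall_ne k fun l _ => hne l)
      (Function.update_self _ _ _), one_mul, Function.update_idem, ← hc k,
      Function.update_eq_self, infAct_single_of_forall_ne, add_zero] at h
    intro l
    by_cases hl : l = k
    · subst hl
      rw [Function.update_self]
      exact Sum.inl_ne_inr
    · rw [Function.update_of_ne hl, hc l]
      exact Sum.inl_ne_inr
  have hlt : ∀ k, (c k : ℕ) < n := by
    intro k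
    have h2 : Finset.Iic (c k) ⊆ Finset.univ.image c := by
      intro i hi
      rw [Finset.mem_image]
      rcases (Finset.mem_Iic.1 hi).eq_or_lt with h | h
      · exact ⟨k, Finset.mem_univ _, h.symm⟩
      · obtain ⟨l, hl⟩ := hdown k i h
        exact ⟨l, Finset.mem_univ _, hl⟩
    have h3 := (Finset.card_le_card h2).trans Finset.card_image_le
    rw [Fin.card_Iic, Finset.card_univ, Fintype.card_fin] at h3
    omega
  have hσ : Function.Injective fun k => (⟨c k, hlt k⟩ : Fin n) := fun k l h =>
    hcinj (Fin.ext (Fin.mk.inj_iff.1 h))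
  refine ⟨Equiv.ofBijective _ (Finite.injective_iff_bijective.1 hσ), ?_⟩
  ext1 k
  rw [hc k]
  rfl

theorem IsKilled.eq_zero {φ : AltForm g n} (hφ : IsKilled φ) (hn : n ≤ g)
    (hprim : φ ∈ (primitive g n).toSubmodule) (h0 : coords g n φ (topIndex hn) = 0) : φ = 0 := by
  apply coords_injective
  rw [map_zero]
  ext b
  by_contra hb
  obtain ⟨σ, rfl⟩ := hφ.exists_perm hn hprim hb
  rw [coords_comp_perm, h0, smul_zero] at hb
  exact hb rfl

end AltForm

end

/-! ### Irreducibility and the highest weight. -/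

section

open Matrix

namespace AltForm

variable {g n : ℕ}

theorem coords_altRep (x : USp g) (φ : AltForm g n) (a : Fin n → Fin g ⊕ Fin g) :
    coords g n (altRep g n x φ) a =
      ∑ b : Fin n → Fin g ⊕ Fin g, (∏ k, USp.toMatrix x (a k) (b k)) * coords g n φ b := by
  rw [coords_apply, altRep_apply, apply_eq_sum]
  refine Finset.sum_congr rfl fun b _ => ?_
  congr 1
  refine Finset.prod_congr rfl fun k _ => ?_
  simp [stdVec]

theorem dotProduct_coords_altRep (x : USp g) (φ ψ : AltForm g n) :
    coords g n (altRep g n x ψ) ⬝ᵥ star (coords g n φ) =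
      coords g n ψ ⬝ᵥ star (coords g n (altRep g n x⁻¹ φ)) := by
  simp only [dotProduct, coords_altRep, Pi.star_apply, star_sum, Finset.sum_mul, Finset.mul_sum]
  rw [Finset.sum_comm]
  refine Finset.sum_congr rfl fun b _ => Finset.sum_congr rfl fun a _ => ?_
  rw [star_mul', star_prod]
  simp only [USp.toMatrix_inv, conjTranspose_apply, star_star]
  ring

/-- The coordinates of an alternating form, as a vector of a Euclidean space. -/
def euclideanCoords (g n : ℕ) :
    AltForm g n →ₗ[ℂ] EuclideanSpace ℂ (Fin n → Fin g ⊕ Fin g) :=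
  (WithLp.linearEquiv 2 ℂ _).symm.toLinearMap ∘ₗ coords g n

theorem euclideanCoords_injective : Function.Injective (euclideanCoords g n) :=
  (WithLp.linearEquiv 2 ℂ _).symm.injective.comp coords_injective

theorem inner_euclideanCoords (φ ψ : AltForm g n) :
    inner ℂ (euclideanCoords g n φ) (euclideanCoords g n ψ) =
      coords g n ψ ⬝ᵥ star (coords g n φ) := rfl

theorem IsKilled.smul_sub_smul {φ ψ : AltForm g n} (hφ : IsKilled φ) (hψ : IsKilled ψ)
    (c d : ℂ) : IsKilled (c • φ - d • ψ) := by
  intro X hX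
  have h : infAct X (c • φ - d • ψ) = c • infAct X φ - d • infAct X ψ := by
    ext a
    simp only [infAct, map_sub, map_smul, Pi.sub_apply, Pi.smul_apply, smul_eq_mul, mul_sub,
      Finset.sum_sub_distrib, Finset.mul_sum]
    congr 1 <;>
      exact Finset.sum_congr rfl fun k _ => Finset.sum_congr rfl fun b _ => mul_left_comm _ _ _
  rw [h, hφ X hX, hψ X hX, smul_zero, smul_zero, sub_zero]

/-- The Hermitian product of coordinate vectors is invariant, so a proper U has a nonzero invariant
complement in the primitive forms. Both contain killed vectors, and these are unique up to a scalar.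
-/
theorem eq_primitive_of_le (hn : n ≤ g) {U : Submodule ℂ (AltForm g n)}
    (hU : ∀ x, ∀ φ ∈ U, altRep g n x φ ∈ U) (hne : U ≠ ⊥)
    (hle : U ≤ (primitive g n).toSubmodule) : U = (primitive g n).toSubmodule := by
  set W := (primitive g n).toSubmodule with hW
  by_contra hUW
  set E := euclideanCoords g n
  have hE : Function.Injective E := euclideanCoords_injective
  let U' : Submodule ℂ (AltForm g n) := (U.map E)ᗮ.comap E ⊓ W
  have hU' : ∀ x, ∀ ψ ∈ U', altRep g n x ψ ∈ U' := by
    rintro x ψ ⟨h1, h2⟩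
    refine ⟨?_, (primitive g n).apply_mem_toSubmodule x h2⟩
    rw [SetLike.mem_coe, Submodule.mem_comap, Submodule.mem_orthogonal] at h1 ⊢
    rintro _ ⟨φ, hφ, rfl⟩
    rw [inner_euclideanCoords, dotProduct_coords_altRep, ← inner_euclideanCoords]
    exact h1 _ (Submodule.mem_map_of_mem (hU _ _ hφ))
  have hne' : U' ≠ ⊥ := by
    intro hbot
    have h1 := Submodule.sup_orthogonal_inf_of_hasOrthogonalProjection
      (Submodule.map_mono (f := E) hle)
    have h2 : (U.map E)ᗮ ⊓ W.map E = ⊥ := by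
      rw [eq_bot_iff]
      rintro _ ⟨h3, ψ, hψ, rfl⟩
      have : ψ ∈ U' := ⟨h3, hψ⟩
      rw [hbot, Submodule.mem_bot] at this
      rw [this, map_zero]
      exact Submodule.zero_mem _
    rw [h2, sup_bot_eq] at h1
    exact hUW (Submodule.map_injective_of_injective hE h1)
  obtain ⟨φ, hφU, hφ0, hφ⟩ := exists_isKilled hU hne
  obtain ⟨ψ, hψU, hψ0, hψ⟩ := exists_isKilled hU' hne'
  set a := coords g n φ (topIndex hn) with ha
  set b := coords g n ψ (topIndex hn) with hb
  have ha0 : a ≠ 0 := fun h => hφ0 (hφ.eq_zero hn (hle hφU) h)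
  -- The scalars cancel the top coordinate, which determines a killed primitive form.
  have h1 : a • ψ - b • φ = 0 := by
    refine (hψ.smul_sub_smul hφ a b).eq_zero hn
      (W.sub_mem (W.smul_mem _ hψU.2) (W.smul_mem _ (hle hφU))) ?_
    rw [map_sub, map_smul, map_smul, Pi.sub_apply, Pi.smul_apply, Pi.smul_apply, ← ha, ← hb,
      smul_eq_mul, smul_eq_mul, mul_comm, sub_self]
  have h2 : ψ ∈ U := by
    rw [sub_eq_zero] at h1
    rw [← inv_smul_smul₀ ha0 ψ, h1]
    exact U.smul_mem _ (U.smul_mem _ hφU)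
  have h3 : inner ℂ (E ψ) (E ψ) = 0 :=
    (Submodule.mem_orthogonal _ _).1 hψU.1 _ (Submodule.mem_map_of_mem h2)
  rw [inner_self_eq_zero] at h3
  exact hψ0 (hE (h3.trans (map_zero E).symm))

theorem isIrreducible_primitiveRep (hn : n ≤ g) : (primitiveRep g n).IsIrreducible := by
  have h : ∀ S : Subrepresentation (primitiveRep g n), S = ⊥ ∨ S = ⊤ := by
    intro S
    by_cases hS : S.toSubmodule = ⊥
    · exact Or.inl (Subrepresentation.toSubmodule_injective hS)
    right
    apply Subrepresentation.toSubmodule_injective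
    change S.toSubmodule = ⊤
    set W := (primitive g n).toSubmodule
    have h1 : S.toSubmodule.map W.subtype = W := by
      refine eq_primitive_of_le hn ?_ ?_ (Submodule.map_subtype_le _ _)
      · rintro x _ ⟨φ, hφ, rfl⟩
        exact ⟨primitiveRep g n x φ, S.apply_mem_toSubmodule x hφ, rfl⟩
      · exact fun h => hS (Submodule.map_injective_of_injective W.injective_subtype
          (h.trans (Submodule.map_bot _).symm))
    refine Submodule.map_injective_of_injective W.injective_subtype ?_
    rw [h1, Submodule.map_top, Submodule.range_subtype]
  have hnt : Nontrivial (Subrepresentation (primitiveRep g n)) := by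
    refine ⟨⊥, ⊤, fun h0 => primitive_ne_bot hn ?_⟩
    have h1 : (⊥ : Submodule ℂ (primitive g n).toSubmodule) = ⊤ :=
      congrArg Subrepresentation.toSubmodule h0
    rw [eq_bot_iff]
    intro φ hφ
    have h2 : (⟨φ, hφ⟩ : (primitive g n).toSubmodule) ∈
      (⊥ : Submodule ℂ (primitive g n).toSubmodule) := h1 ▸ Submodule.mem_top
    exact congrArg Subtype.val ((Submodule.mem_bot ℂ).1 h2)
  exact { eq_bot_or_eq_top := h }

end AltForm

theorem zpow_sum_of_ne_zero {ι K : Type*} [CommGroupWithZero K] {w : K} (hw : w ≠ 0)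
    (s : Finset ι) (f : ι → ℤ) : w ^ (∑ k ∈ s, f k) = ∏ k ∈ s, w ^ f k := by
  classical
  induction s using Finset.induction_on with
  | empty => simp
  | insert a s ha ih => rw [Finset.sum_insert ha, Finset.prod_insert ha, zpow_add₀ hw, ih]

/-- A vector of integers with nonnegative partial sums and even sum is a sum of simple roots. -/
theorem exists_eq_sum_simpleRoot {g : ℕ} (ν : Fin g → ℤ)
    (h : ∀ j, 0 ≤ ∑ i ∈ Finset.univ.filter (fun i : Fin g => (i : ℕ) < j), ν i)
    (hev : Even (∑ i, ν i)) : ∃ m : Fin g → ℕ, ν = ∑ k, m k • simpleRoot g k := by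
  set S : ℕ → ℤ := fun j => ∑ i ∈ Finset.univ.filter (fun i : Fin g => (i : ℕ) < j), ν i with hS
  have hS0 : S 0 = 0 := by simp [hS]
  have hSg : S g = ∑ i, ν i := by simp [hS]
  have hSs : ∀ i : Fin g, S (i + 1) = ν i + S i := by
    intro i
    have : Finset.univ.filter (fun k : Fin g => (k : ℕ) < i + 1) =
        insert i (Finset.univ.filter (fun k : Fin g => (k : ℕ) < i)) := by
      ext k
      simp only [Finset.mem_filter, Finset.mem_univ, true_and, Finset.mem_insert, Fin.ext_iff]
      omega
    simp only [hS]
    rw [this, Finset.sum_insert (by simp)]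
  -- Abel summation: the coefficients are the partial sums, halved at the last root 2e_g. This is
  -- where evenness enters.
  refine ⟨fun k => if (k : ℕ) + 1 < g then (S (k + 1)).toNat else (S g / 2).toNat, ?_⟩
  ext i
  have hroot : ∀ k : Fin g, simpleRoot g k i = (if k = i then (if (k : ℕ) + 1 < g then 1 else 2)
      else 0) - if (k : ℕ) + 1 = i then 1 else 0 := by
    intro k
    have := i.2
    unfold simpleRoot
    split_ifs with h1 h2 h3 h3 h2 h3 h3 <;>
      simp [Pi.single_apply, Fin.ext_iff] at * <;> omega
  rw [Finset.sum_apply]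
  simp only [Pi.smul_apply, hroot, nsmul_eq_mul, mul_sub, Finset.sum_sub_distrib, mul_ite, mul_zero,
    mul_one, Finset.sum_ite_eq', Finset.mem_univ, if_true]
  have h2 : ∑ k : Fin g, (if (k : ℕ) + 1 = i then (((if (k : ℕ) + 1 < g then (S (k + 1)).toNat
      else (S g / 2).toNat) : ℕ) : ℤ) else 0) = S i := by
    rcases i with ⟨i, hi⟩
    cases i with
    | zero => simp [hS0]
    | succ i =>
      rw [Finset.sum_eq_single ⟨i, by omega⟩]
      · simp only [if_true]
        rw [if_pos hi, Int.toNat_of_nonneg (h _)]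
      · intro k _ hk
        refine if_neg fun h' => hk (Fin.ext ?_)
        simp only at h' ⊢
        omega
      · simp
  rw [h2]
  have h3 := hSs i
  split_ifs with h4
  · rw [Int.toNat_of_nonneg (h _)]
    linarith
  · have h5 : (i : ℕ) + 1 = g := by
      have := i.2
      omega
    rw [h5] at h3
    obtain ⟨r, hr⟩ := hSg ▸ hev
    have h6 : 0 ≤ S g := h g
    rw [Int.toNat_of_nonneg (by omega)]
    omega

namespace AltForm

variable {g n : ℕ}

/-- The weight of a tuple of standard basis vectors. -/
def tupleWeight (a : Fin n → Fin g ⊕ Fin g) (i : Fin g) : ℤ :=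
  ∑ k, ((if a k = Sum.inl i then 1 else 0) - if a k = Sum.inr i then 1 else 0)

theorem prod_zpow_tupleWeight (a : Fin n → Fin g ⊕ Fin g) (z : Fin g → Circle) :
    ∏ i, (z i : ℂ) ^ tupleWeight a i =
      ∏ k, Sum.elim (fun i => (z i : ℂ)) (fun i => (z i : ℂ)⁻¹) (a k) := by
  simp only [tupleWeight]
  rw [Finset.prod_congr rfl fun i _ => zpow_sum_of_ne_zero (Circle.coe_ne_zero (z i)) _ _]
  rw [Finset.prod_comm]
  refine Finset.prod_congr rfl fun k _ => ?_
  rcases a k with j | j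
  · rw [Finset.prod_eq_single j]
    · simp
    · intro i _ hi
      simp [hi.symm]
    · simp
  · rw [Finset.prod_eq_single j]
    · simp
    · intro i _ hi
      simp [hi.symm]
    · simp

theorem tupleWeight_topIndex (hn : n ≤ g) : tupleWeight (topIndex hn) = fundamentalWeight g n := by
  ext i
  simp only [tupleWeight, topIndex, fundamentalWeight, reduceCtorEq, if_false, sub_zero,
    Sum.inl.injEq]
  split_ifs with h
  · rw [Finset.sum_eq_single ⟨i, h⟩]
    · simp
    · intro k _ hk
      refine if_neg fun h' => hk (Fin.ext ?_)
      simpa using congrArg (fun t : Fin g => (t : ℕ)) h'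
    · simp
  · refine Finset.sum_eq_zero fun k _ => if_neg fun h' => h ?_
    rw [← h']
    exact k.2

theorem tupleWeight_le_one {a : Fin n → Fin g ⊕ Fin g} (ha : Function.Injective a) (i : Fin g) :
    tupleWeight a i ≤ 1 := by
  have h1 : tupleWeight a i ≤ ∑ k, if a k = Sum.inl i then 1 else 0 :=
    Finset.sum_le_sum fun k _ => by split_ifs <;> simp
  refine h1.trans ?_
  rw [Finset.sum_boole]
  have : (Finset.univ.filter fun k => a k = Sum.inl i).card ≤ 1 :=
    Finset.card_le_one.2 fun k hk l hl => ha
      ((Finset.mem_filter.1 hk).2.trans (Finset.mem_filter.1 hl).2.symm)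
  exact_mod_cast this

theorem sum_tupleWeight_le (a : Fin n → Fin g ⊕ Fin g) (s : Finset (Fin g)) :
    ∑ i ∈ s, tupleWeight a i ≤ n := by
  simp only [tupleWeight]
  rw [Finset.sum_comm]
  have : ∀ k, ∑ i ∈ s, (((if a k = Sum.inl i then 1 else 0) -
      if a k = Sum.inr i then 1 else 0 : ℤ)) ≤ 1 := by
    intro k
    rw [Finset.sum_sub_distrib]
    rcases a k with j | j
    · simp only [Sum.inl.injEq, Finset.sum_ite_eq, reduceCtorEq, if_false, Finset.sum_const_zero]
      split_ifs <;> simp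
    · simp only [Sum.inr.injEq, Finset.sum_ite_eq, reduceCtorEq, if_false, Finset.sum_const_zero]
      split_ifs <;> simp
  calc _ ≤ ∑ _k : Fin n, (1 : ℤ) := Finset.sum_le_sum fun k _ => this k
    _ = n := by simp

theorem even_sub_sum_tupleWeight (a : Fin n → Fin g ⊕ Fin g) :
    Even ((n : ℤ) - ∑ i, tupleWeight a i) := by
  simp only [tupleWeight]
  rw [Finset.sum_comm]
  have h : (n : ℤ) = ∑ _k : Fin n, (1 : ℤ) := by simp
  rw [h, ← Finset.sum_sub_distrib]
  refine Finset.even_sum _ fun k _ => ?_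
  rw [Finset.sum_sub_distrib]
  rcases a k with j | j <;> simp

theorem sum_fundamentalWeight (hn : n ≤ g) (j : ℕ) (hj : j ≤ g) :
    ∑ i ∈ Finset.univ.filter (fun i : Fin g => (i : ℕ) < j), fundamentalWeight g n i =
      (min j n : ℕ) := by
  simp only [fundamentalWeight]
  rw [Finset.sum_boole, Finset.filter_filter]
  norm_cast
  simp_rw [← lt_min_iff]
  rw [Fin.card_filter_val_lt, min_eq_right (by omega)]

/-- The first j entries of the weight of an injective tuple add up to at most min(j, n), the value
for ϖ_n. Each of the n members contributes ±1 to the total, which settles parity. -/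
theorem exists_sub_tupleWeight_eq (hn : n ≤ g) {a : Fin n → Fin g ⊕ Fin g}
    (ha : Function.Injective a) :
    ∃ m : Fin g → ℕ, fundamentalWeight g n - tupleWeight a = ∑ k, m k • simpleRoot g k := by
  have hfil : Finset.univ.filter (fun i : Fin g => (i : ℕ) < g) = Finset.univ := by simp
  apply exists_eq_sum_simpleRoot
  · intro j
    wlog hj : j ≤ g generalizing j
    · have := this g le_rfl
      rw [hfil] at this
      rwa [Finset.filter_true_of_mem fun (i : Fin g) _ => i.2.trans (not_le.1 hj)]
    simp only [Pi.sub_apply]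
    rw [Finset.sum_sub_distrib, sum_fundamentalWeight hn j hj, sub_nonneg]
    have h1 : ∑ i ∈ Finset.univ.filter (fun i : Fin g => (i : ℕ) < j), tupleWeight a i ≤ j := by
      calc _ ≤ ∑ i ∈ Finset.univ.filter (fun i : Fin g => (i : ℕ) < j), (1 : ℤ) :=
            Finset.sum_le_sum fun i _ => tupleWeight_le_one ha i
        _ = (min g j : ℕ) := by
          rw [Finset.sum_const, Fin.card_filter_val_lt]
          simp
        _ ≤ j := by exact_mod_cast min_le_right _ _
    have h2 := sum_tupleWeight_le a (Finset.univ.filter (fun i : Fin g => (i : ℕ) < j))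
    push_cast
    exact le_min h1 h2
  · have := sum_fundamentalWeight hn g le_rfl
    rw [hfil, min_eq_right hn] at this
    simp only [Pi.sub_apply]
    rw [Finset.sum_sub_distrib, this]
    exact even_sub_sum_tupleWeight a

theorem isWeight_primitiveRep (hn : n ≤ g) :
    IsWeight (primitiveRep g n) (fundamentalWeight g n) := by
  obtain ⟨φ, hφ, h0, hk⟩ := exists_isKilled
    (fun x φ hφ => (primitive g n).apply_mem_toSubmodule x hφ) (primitive_ne_bot hn)
  refine ⟨⟨φ, hφ⟩, fun h => h0 (congrArg Subtype.val h), fun z => ?_⟩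
  apply Subtype.ext
  rw [primitiveRep_coe]
  apply coords_injective
  ext b
  change coords g n (altRep g n (USp.torus z) φ) b = coords g n (_ • φ) b
  rw [coords_apply, altRep_torus_stdVec, ← coords_apply, map_smul, Pi.smul_apply, smul_eq_mul]
  by_cases hb : coords g n φ b = 0
  · rw [hb, mul_zero, mul_zero]
  · obtain ⟨σ, rfl⟩ := hk.exists_perm hn hφ hb
    rw [← tupleWeight_topIndex hn, prod_zpow_tupleWeight]
    congr 1
    exact Equiv.prod_comp σ fun k =>
      Sum.elim (fun i => (z i : ℂ)) (fun i => (z i : ℂ)⁻¹) (topIndex hn k)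

theorem hasHighestWeight_primitiveRep (hn : n ≤ g) :
    HasHighestWeight (primitiveRep g n) (fundamentalWeight g n) := by
  refine ⟨isWeight_primitiveRep hn, ?_⟩
  rintro μ ⟨φ, h0, hφ⟩
  obtain ⟨a, ha⟩ : ∃ a, coords g n (φ : AltForm g n) a ≠ 0 := by
    by_contra! h
    exact h0 (Subtype.ext (coords_injective ((funext h).trans (map_zero _).symm)))
  have hinj : Function.Injective a := by
    by_contra h
    exact ha (coords_eq_zero_of_not_injective _ h)
  have hμ : μ = tupleWeight a := by
    refine torusMonomial_injective (MonoidHom.ext fun z => ?_)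
    rw [torusMonomial_apply, torusMonomial_apply, prod_zpow_tupleWeight]
    apply mul_right_cancel₀ ha
    rw [coords_apply, ← altRep_torus_stdVec, ← primitiveRep_coe, hφ z]
    rfl
  rw [hμ]
  exact exists_sub_tupleWeight_eq hn hinj

end AltForm

end

/-! ### Transport of structure and identification of the fundamental characters. -/

section

open Matrix

namespace Representation

variable {k G V W : Type*} [Field k] [Monoid G] [AddCommGroup V] [Module k V] [AddCommGroup W]
  [Module k W] {ρ : Representation k G V} {σ : Representation k G W}

theorem Equiv.apply_apply (e : Equiv ρ σ) (x : G) (v : V) :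
    e.toLinearEquiv (ρ x v) = σ x (e.toLinearEquiv v) :=
  IntertwiningMap.isIntertwining ρ σ e.toIntertwiningMap x v

theorem IsIrreducible.of_equiv (e : Equiv ρ σ) (h : ρ.IsIrreducible) : σ.IsIrreducible := by
  have hf : Function.Injective (Submodule.comap e.toLinearEquiv.toLinearMap) :=
    Submodule.comap_injective_of_surjective e.toLinearEquiv.surjective
  let T : Subrepresentation σ → Subrepresentation ρ := fun S =>
    { toSubmodule := S.toSubmodule.comap e.toLinearEquiv.toLinearMap
      apply_mem_toSubmodule := fun x v hv => by
        rw [Submodule.mem_comap] at hv ⊢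
        have := S.apply_mem_toSubmodule x hv
        rwa [LinearEquiv.coe_coe, ← e.apply_apply] at this }
  have hT : Function.Injective T := fun S S' hS =>
    Subrepresentation.toSubmodule_injective (hf (congrArg Subrepresentation.toSubmodule hS))
  have hbot : T ⊥ = ⊥ := Subrepresentation.toSubmodule_injective (by
    change Submodule.comap _ ⊥ = ⊥
    rw [Submodule.comap_bot]
    exact LinearEquiv.ker _)
  have htop : T ⊤ = ⊤ := Subrepresentation.toSubmodule_injective (Submodule.comap_top _)
  have hnt : Nontrivial (Subrepresentation σ) := ⟨⊥, ⊤, fun h0 => by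
    have h1 := congrArg T h0
    rw [hbot, htop] at h1
    exact bot_ne_top h1⟩
  exact
    { eq_bot_or_eq_top := fun S => (h.eq_bot_or_eq_top (T S)).imp
        (fun h1 => hT (h1.trans hbot.symm)) fun h1 => hT (h1.trans htop.symm) }

/-- Transport of a representation along a linear equivalence. -/
def transport (e : V ≃ₗ[k] W) (ρ : Representation k G V) : Representation k G W where
  toFun x := e.conj (ρ x)
  map_one' := by rw [map_one, Module.End.one_eq_id, LinearEquiv.conj_id]; rfl
  map_mul' x y := by simp [Module.End.mul_eq_comp, LinearEquiv.conj_comp]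

theorem transport_apply (e : V ≃ₗ[k] W) (ρ : Representation k G V) (x : G) (w : W) :
    transport e ρ x w = e (ρ x (e.symm w)) := rfl

/-- The equivalence between a representation and its transport. -/
def transportEquiv (e : V ≃ₗ[k] W) (ρ : Representation k G V) : Equiv ρ (transport e ρ) :=
  Equiv.mk e fun x => by
    ext v
    simp [transport_apply]

end Representation

section

variable {g : ℕ} {V W : Type*} [AddCommGroup V] [Module ℂ V] [AddCommGroup W] [Module ℂ W]
  {ρ : Representation ℂ (USp g) V} {σ : Representation ℂ (USp g) W}

theorem IsWeight.of_equiv (e : ρ.Equiv σ) {μ : Fin g → ℤ} (h : IsWeight ρ μ) : IsWeight σ μ := by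
  obtain ⟨v, hv, hμ⟩ := h
  refine ⟨e.toLinearEquiv v, fun h0 => hv (e.toLinearEquiv.map_eq_zero_iff.1 h0), fun z => ?_⟩
  rw [← e.apply_apply, hμ, map_smul]

theorem HasHighestWeight.of_equiv (e : ρ.Equiv σ) {lam : Fin g → ℤ}
    (h : HasHighestWeight ρ lam) : HasHighestWeight σ lam :=
  ⟨h.1.of_equiv e, fun μ hμ => h.2 μ (hμ.of_equiv e.symm)⟩

theorem simpleRoot_zero_nonneg {g : ℕ} (k i : Fin g) (hi : (i : ℕ) = 0) :
    0 ≤ simpleRoot g k i := by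
  unfold simpleRoot
  split_ifs with h
  · have : i ≠ ⟨k + 1, h⟩ := fun h' => by simp [h'] at hi
    rw [Pi.sub_apply, Pi.single_eq_of_ne this, sub_zero, Pi.single_apply]
    split_ifs <;> simp
  · rw [Pi.single_apply]
    split_ifs <;> simp

theorem sum_simpleRoot_nonneg {g : ℕ} (k : Fin g) : 0 ≤ ∑ i, simpleRoot g k i := by
  unfold simpleRoot
  split_ifs with h
  · simp [Finset.sum_sub_distrib]
  · simp

theorem HasHighestWeight.le_of_zero {lam μ : Fin g → ℤ} (h : HasHighestWeight ρ lam)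
    (hμ : IsWeight ρ μ) {i : Fin g} (hi : (i : ℕ) = 0) : μ i ≤ lam i := by
  obtain ⟨m, hm⟩ := h.2 μ hμ
  have h1 := congrFun hm i
  rw [Pi.sub_apply, Finset.sum_apply] at h1
  have h2 : 0 ≤ ∑ k, (m k • simpleRoot g k) i := Finset.sum_nonneg fun k _ =>
    nsmul_nonneg (simpleRoot_zero_nonneg k i hi) _
  linarith

theorem HasHighestWeight.sum_le {lam μ : Fin g → ℤ} (h : HasHighestWeight ρ lam)
    (hμ : IsWeight ρ μ) : ∑ i, μ i ≤ ∑ i, lam i := by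
  obtain ⟨m, hm⟩ := h.2 μ hμ
  have h1 := congrArg (fun ν : Fin g → ℤ => ∑ i, ν i) hm
  simp only [Pi.sub_apply, Finset.sum_sub_distrib, Finset.sum_apply, Pi.smul_apply] at h1
  rw [Finset.sum_comm] at h1
  have h2 : 0 ≤ ∑ k, ∑ i, m k • simpleRoot g k i := Finset.sum_nonneg fun k _ => by
    rw [← Finset.smul_sum]
    exact nsmul_nonneg (sum_simpleRoot_nonneg k) _
  linarith

theorem sum_univ_fundamentalWeight {n : ℕ} (hn : n ≤ g) : ∑ i, fundamentalWeight g n i = n := by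
  have := AltForm.sum_fundamentalWeight hn g le_rfl
  rw [min_eq_right hn] at this
  rw [← this]
  congr 1
  simp

theorem HasHighestWeight.fundamentalWeight_unique {m n : ℕ} (hm : m ≤ g) (hn : n ≤ g)
    (h1 : HasHighestWeight ρ (fundamentalWeight g m))
    (h2 : HasHighestWeight ρ (fundamentalWeight g n)) : m = n := by
  have h3 := h1.sum_le h2.1
  have h4 := h2.sum_le h1.1
  rw [sum_univ_fundamentalWeight hm, sum_univ_fundamentalWeight hn] at h3 h4
  omega

end

namespace AltForm

variable {g n : ℕ}

theorem continuous_coords_altRep (φ : AltForm g n) :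
    Continuous fun x => coords g n (altRep g n x φ) := by
  refine continuous_pi fun a => ?_
  simp_rw [coords_apply, altRep_apply]
  refine (continuous_coe φ).comp (continuous_pi fun k => ?_)
  exact (USp.continuous_toMatrix.matrix_transpose).matrix_mulVec continuous_const

theorem continuous_linearMap_primitiveRep {d : ℕ}
    (L : (primitive g n).toSubmodule →ₗ[ℂ] (Fin d → ℂ)) (w : (primitive g n).toSubmodule) :
    Continuous fun x => L (primitiveRep g n x w) := by
  obtain ⟨T, hT⟩ := LinearMap.exists_extend L
  obtain ⟨P, hP⟩ := LinearMap.exists_leftInverse_of_injective (coords g n)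
    (LinearMap.ker_eq_bot.2 coords_injective)
  -- Factoring through coordinates reduces continuity to coordinate space.
  have h : ∀ x, L (primitiveRep g n x w) = (T ∘ₗ P) (coords g n (altRep g n x w)) := by
    intro x
    have h1 : P (coords g n (altRep g n x w)) = altRep g n x w := LinearMap.congr_fun hP _
    rw [LinearMap.comp_apply, h1, ← primitiveRep_coe, ← hT]
    rfl
  simp_rw [h]
  exact (LinearMap.continuous_of_finiteDimensional _).comp (continuous_coords_altRep _)

theorem isFundamentalCharacter_primitiveRep (hn : n ≤ g) :
    IsFundamentalCharacter g n (primitiveRep g n).character := by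
  let e := (Module.finBasis ℂ (primitive g n).toSubmodule).equivFun
  let E := Representation.transportEquiv e (primitiveRep g n)
  exact ⟨_, Representation.transport e (primitiveRep g n),
    fun v => continuous_linearMap_primitiveRep e.toLinearMap _,
    (isIrreducible_primitiveRep hn).of_equiv E,
    (hasHighestWeight_primitiveRep hn).of_equiv E, Representation.char_iso E⟩

theorem sCoeff_eq_sum_character {j : ℕ} (hj : j ≤ g) (x : USp g) :
    sCoeff g j x =
      ∑ i ∈ Finset.range (g + 1), dCoeff g i j * (primitiveRep g i).character x := by
  have h1 : ∀ i ∈ Finset.range (g + 1), dCoeff g i j * (primitiveRep g i).character x =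
      ∑ k ∈ Finset.range (g + 1),
        (coeffFamily g k (i : ℤ) : ℂ) * dCoeff g i j * sCoeff g k x := by
    intro i hi
    rw [character_primitiveRep (Nat.lt_succ_iff.1 (Finset.mem_range.1 hi)), Finset.mul_sum]
    exact Finset.sum_congr rfl fun k _ => by ring
  rw [Finset.sum_congr rfl h1, Finset.sum_comm]
  have h2 : ∀ k ∈ Finset.range (g + 1), ∑ i ∈ Finset.range (g + 1),
      (coeffFamily g k (i : ℤ) : ℂ) * dCoeff g i j * sCoeff g k x =
      if k = j then sCoeff g k x else 0 := by
    intro k hk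
    rw [← Finset.sum_mul, sum_coeffFamily_mul_dCoeff
      (Nat.lt_succ_iff.1 (Finset.mem_range.1 hk)) j hj, ite_mul, one_mul, zero_mul]
  rw [Finset.sum_congr rfl h2, Finset.sum_ite_eq', if_pos (Finset.mem_range.2 (by omega))]

end AltForm

-- Highest weight ϖ_j bounds the first coordinates of all weights by 1, so the character is a
-- combination of the s_k, hence of the primitive characters. By independence the representation is
-- a primitive one of some degree i, and the coordinate sums of the highest weights give i = j.
open AltForm in
theorem IsFundamentalCharacter.eq_character_primitiveRep {g j : ℕ} (hj : j ≤ g)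
    {χ : USp g → ℂ} (h : IsFundamentalCharacter g j χ) : χ = (primitiveRep g j).character := by
  obtain ⟨n, ρ, hcont, hirr, hw, rfl⟩ := h
  obtain ⟨M, hM⟩ := exists_character_eq_sum_sCoeff ρ hcont fun μ hμ i hi =>
    (hw.le_of_zero hμ hi).trans (by unfold fundamentalWeight; split_ifs <;> simp)
  have hirr' : ∀ i : Fin (g + 1), (primitiveRep g i).IsIrreducible := fun i =>
    isIrreducible_primitiveRep (Nat.lt_succ_iff.1 i.2)
  obtain ⟨i, ⟨e⟩⟩ := Representation.exists_equiv_of_character_eq_sum (ρ := ρ)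
    (σ := fun i : Fin (g + 1) => primitiveRep g i)
    (fun i => ∑ k ∈ Finset.range (g + 1), M k * dCoeff g i k) (fun x => by
      rw [hM, Finset.sum_congr rfl fun k hk => by
        rw [sCoeff_eq_sum_character (Nat.lt_succ_iff.1 (Finset.mem_range.1 hk)), Finset.mul_sum],
        Finset.sum_comm, Finset.sum_range]
      refine Finset.sum_congr rfl fun i _ => ?_
      rw [Finset.sum_mul]
      exact Finset.sum_congr rfl fun k _ => by ring)
  have hi : (i : ℕ) ≤ g := Nat.lt_succ_iff.1 i.2
  have hij : j = i :=
    (hw.of_equiv e).fundamentalWeight_unique hj hi (hasHighestWeight_primitiveRep hi)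
  rw [hij]
  exact Representation.char_iso e

theorem AltForm.character_primitiveRep_zero (g : ℕ) : (primitiveRep g 0).character = 1 := by
  ext x
  rw [Representation.character, trace_primitiveRep_of_lt_two (by norm_num)]
  obtain ⟨y, z, rfl⟩ := USp.exists_eq_conj_torus x
  have := Representation.char_conj (altRep g 0) (USp.torus z) y
  rw [Representation.character, Representation.character, trace_altRep_torus, elemSymm_zero] at this
  exact this

end

theorem lemma4p2 (g : ℕ) :
    ∃ c : ℕ → ℤ → ℤ,
      -- the recurrence determines the integers `c i j`
      IsCoeffFamily g c ∧
      (∀ c' : ℕ → ℤ → ℤ, IsCoeffFamily g c' → ∀ i ≤ g, ∀ j : ℤ, c' i j = c i j) ∧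
      -- closed formula
      (∀ i ≤ g, ∀ j ≤ g,
        (c i (j : ℤ) : ℚ) =
          (1 + (-1) ^ (i + j)) / 2 *
            (2 * ((g : ℚ) + 1 - j) / (2 * ((g : ℚ) + 1) - ((i : ℚ) + j))) *
            (((g - i).choose (g - (i + j) / 2) : ℕ) : ℚ)) ∧
      -- the fundamental irreducible characters exist
      (∀ j, 1 ≤ j → j ≤ g → ∃ χ : USp g → ℂ, IsFundamentalCharacter g j χ) ∧
      -- expansions of the characters in the `s_i`, and conversely
      (∀ χ : ℕ → USp g → ℂ, χ 0 = 1 →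
        (∀ j, 1 ≤ j → j ≤ g → IsFundamentalCharacter g j (χ j)) →
        (∀ j ≤ g, ∀ x : USp g,
          χ j x = ∑ i ∈ Finset.range (g + 1), (c i (j : ℤ) : ℂ) * sCoeff g i x) ∧
        (∀ j ≤ g, ∀ x : USp g,
          sCoeff g j x = ∑ i ∈ Finset.range (g + 1), dCoeff g i j * χ i x)) := by
  refine ⟨coeffFamily g, isCoeffFamily_coeffFamily g, fun c' hc' i hi =>
    IsCoeffFamily.eq (isCoeffFamily_coeffFamily g) hc' hi, fun i hi j hj =>
    coeffFamily_closed_formula hi hj, fun j _ hj =>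
    ⟨_, AltForm.isFundamentalCharacter_primitiveRep hj⟩, fun χ h0 hχ => ?_⟩
  have h : ∀ j ≤ g, χ j = (AltForm.primitiveRep g j).character := by
    intro j hj
    rcases Nat.eq_zero_or_pos j with rfl | hj0
    · rw [h0, AltForm.character_primitiveRep_zero]
    · exact (hχ j hj0 hj).eq_character_primitiveRep hj
  refine ⟨fun j hj x => ?_, fun j hj x => ?_⟩
  · rw [h j hj, AltForm.character_primitiveRep hj]
  · rw [AltForm.sCoeff_eq_sum_character hj]
    exact Finset.sum_congr rfl fun i hi => by
      rw [h i (Nat.lt_succ_iff.1 (Finset.mem_range.1 hi))]
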